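/- Let $h\ge 3$ and let $H$ be a fixed graph with $h$ vertices. There is an algorithm that, given a (simple, undirected) graph $G=(V,E)$ with $n$ vertices and a weight function $w:E\to\mathbb{R}$, finds an induced $H$-subgraph of $G$ of maximum weight if $G$ has an induced $H$-subgraph, and reports that there is none otherwise, in $O(n^h/\log n)$ worst-case time. Here an induced $H$-subgraph is an induced subgraph of $G$ isomorphic to $H$, and the weight of a subgraph is the sum of the weights of its edges. The constant in the $O$ depends only on $H$. The algorithm is deterministic and is a single program, depending only on $H$, for a random access machine in the addition-comparison model: integers are words of $O(\log n)$ bits, on which the arithmetic operations $+,-,\times$, integer division, comparisons and indirect addressing take unit time, while real numbers are kept in separate memory cells and can only be copied, added and compared, each in unit time. The input is given by $n$, the adjacency matrix of $G$ and the matrix of edge weights. -/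

import Mathlib

open Asymptotics Filter

/-! ## The machine: a word RAM with real registers (addition-comparison model)

Programs are finite and work with finitely many word variables, word arrays and real arrays
(arrays are addressed indirectly, by computed indices). Words have `O(log n)` bits. Reals are stored
in separate cells; the only things that can be done with them are copying, adding and comparing.
Every operation costs one time unit. -/

namespace RAM

/-- Memory contents: word variables, word arrays, real arrays. -/
structure State where
  var : ℕ → ℕ
  arr : ℕ → ℕ → ℕ
  real : ℕ → ℕ → ℝ

/-- Word expressions. `arr a i` reads cell `i` of word array `a`; subtraction is truncated at `0` and
division is integer division. -/
inductive WExp where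
  | const (k : ℕ)
  | var (x : ℕ)
  | arr (a : ℕ) (i : WExp)
  | add (e f : WExp)
  | sub (e f : WExp)
  | mul (e f : WExp)
  | div (e f : WExp)

/-- Real expressions: read cell `i` of real array `a`, or add. -/
inductive RExp where
  | arr (a : ℕ) (i : WExp)
  | add (p q : RExp)

/-- Tests: comparison of words, comparison of reals, Boolean combinations. -/
inductive Test where
  | weq (e f : WExp)
  | wlt (e f : WExp)
  | rle (p q : RExp)
  | not (b : Test)
  | and (b c : Test)

/-- Programs. -/
inductive Prog where
  | skip
  | setVar (x : ℕ) (e : WExp)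
  | setArr (a : ℕ) (i e : WExp)
  | setReal (a : ℕ) (i : WExp) (p : RExp)
  | seq (c d : Prog)
  | ite (b : Test) (c d : Prog)
  | while (b : Test) (c : Prog)

/-- Number of operations needed to evaluate a word expression. -/
def WExp.cost : WExp → ℕ
  | .const _ => 1
  | .var _ => 1
  | .arr _ i => i.cost + 1
  | .add e f => e.cost + f.cost + 1
  | .sub e f => e.cost + f.cost + 1
  | .mul e f => e.cost + f.cost + 1
  | .div e f => e.cost + f.cost + 1

/-- Number of operations needed to evaluate a real expression. -/
def RExp.cost : RExp → ℕ
  | .arr _ i => i.cost + 1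
  | .add p q => p.cost + q.cost + 1

/-- Number of operations needed to evaluate a test. -/
def Test.cost : Test → ℕ
  | .weq e f => e.cost + f.cost + 1
  | .wlt e f => e.cost + f.cost + 1
  | .rle p q => p.cost + q.cost + 1
  | .not b => b.cost + 1
  | .and b c => b.cost + c.cost + 1

/-- Value of a word expression. -/
def WExp.eval (s : State) : WExp → ℕ
  | .const k => k
  | .var x => s.var x
  | .arr a i => s.arr a (i.eval s)
  | .add e f => e.eval s + f.eval s
  | .sub e f => e.eval s - f.eval s
  | .mul e f => e.eval s * f.eval s
  | .div e f => e.eval s / f.eval s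

/-- Value of a real expression. -/
def RExp.eval (s : State) : RExp → ℝ
  | .arr a i => s.real a (i.eval s)
  | .add p q => p.eval s + q.eval s

/-- Truth of a test. -/
def Test.holds (s : State) : Test → Prop
  | .weq e f => e.eval s = f.eval s
  | .wlt e f => e.eval s < f.eval s
  | .rle p q => p.eval s ≤ q.eval s
  | .not b => ¬ b.holds s
  | .and b c => b.holds s ∧ c.holds s

/-- No word overflow: the value of the expression and all its intermediate values (addresses
included) are smaller than the word bound `W`. -/
def WExp.Fits (W : ℕ) (s : State) : WExp → Prop
  | .const k => k < W
  | .var x => s.var x < W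
  | .arr a i => i.Fits W s ∧ s.arr a (i.eval s) < W
  | .add e f => e.Fits W s ∧ f.Fits W s ∧ e.eval s + f.eval s < W
  | .sub e f => e.Fits W s ∧ f.Fits W s
  | .mul e f => e.Fits W s ∧ f.Fits W s ∧ e.eval s * f.eval s < W
  | .div e f => e.Fits W s ∧ f.Fits W s

/-- All addresses occurring in a real expression fit into a word. -/
def RExp.Fits (W : ℕ) (s : State) : RExp → Prop
  | .arr _ i => i.Fits W s
  | .add p q => p.Fits W s ∧ q.Fits W s

/-- All words occurring in the evaluation of a test fit. -/
def Test.Fits (W : ℕ) (s : State) : Test → Prop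
  | .weq e f => e.Fits W s ∧ f.Fits W s
  | .wlt e f => e.Fits W s ∧ f.Fits W s
  | .rle p q => p.Fits W s ∧ q.Fits W s
  | .not b => b.Fits W s
  | .and b c => b.Fits W s ∧ c.Fits W s

/-- Write a word variable. -/
def State.setVar (s : State) (x v : ℕ) : State :=
  { s with var := Function.update s.var x v }

/-- Write a cell of a word array. -/
def State.setArr (s : State) (a i v : ℕ) : State :=
  { s with arr := Function.update s.arr a (Function.update (s.arr a) i v) }

/-- Write a cell of a real array. -/
def State.setReal (s : State) (a i : ℕ) (v : ℝ) : State :=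
  { s with real := Function.update s.real a (Function.update (s.real a) i v) }

/-- `Exec W c s t s'`: started in state `s`, the program `c` halts in state `s'` after exactly
`t` time units, and no word ever reaches the word bound `W` (a program that overflows is stuck). -/
inductive Exec (W : ℕ) : Prog → State → ℕ → State → Prop where
  | skip (s : State) : Exec W .skip s 1 s
  | setVar (s : State) (x : ℕ) (e : WExp) (he : e.Fits W s) :
      Exec W (.setVar x e) s (e.cost + 1) (s.setVar x (e.eval s))
  | setArr (s : State) (a : ℕ) (i e : WExp) (hi : i.Fits W s) (he : e.Fits W s) :
      Exec W (.setArr a i e) s (i.cost + e.cost + 1) (s.setArr a (i.eval s) (e.eval s))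
  | setReal (s : State) (a : ℕ) (i : WExp) (p : RExp) (hi : i.Fits W s) (hp : p.Fits W s) :
      Exec W (.setReal a i p) s (i.cost + p.cost + 1) (s.setReal a (i.eval s) (p.eval s))
  | seq {c d : Prog} {s s' s'' : State} {t t' : ℕ}
      (hc : Exec W c s t s') (hd : Exec W d s' t' s'') :
      Exec W (.seq c d) s (t + t') s''
  | iteTrue {b : Test} {c d : Prog} {s s' : State} {t : ℕ}
      (hf : b.Fits W s) (hb : b.holds s) (hc : Exec W c s t s') :
      Exec W (.ite b c d) s (b.cost + t) s'
  | iteFalse {b : Test} {c d : Prog} {s s' : State} {t : ℕ}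
      (hf : b.Fits W s) (hb : ¬ b.holds s) (hd : Exec W d s t s') :
      Exec W (.ite b c d) s (b.cost + t) s'
  | whileTrue {b : Test} {c : Prog} {s s' s'' : State} {t t' : ℕ}
      (hf : b.Fits W s) (hb : b.holds s) (hc : Exec W c s t s')
      (hw : Exec W (.while b c) s' t' s'') :
      Exec W (.while b c) s (b.cost + t + t') s''
  | whileFalse {b : Test} {c : Prog} {s : State}
      (hf : b.Fits W s) (hb : ¬ b.holds s) :
      Exec W (.while b c) s b.cost s

/-- The machine is deterministic: final state and running time are determined by the start state. -/
theorem Exec.deterministic {W : ℕ} {c : Prog} {s s₁ s₂ : State} {t₁ t₂ : ℕ}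
    (h₁ : Exec W c s t₁ s₁) (h₂ : Exec W c s t₂ s₂) : t₁ = t₂ ∧ s₁ = s₂ := by
  induction h₁ generalizing t₂ s₂ with
  | skip | setVar | setArr | setReal => cases h₂; exact ⟨rfl, rfl⟩
  | seq _ _ ih ih' =>
    cases h₂ with
    | seq hc hd =>
      obtain ⟨rfl, rfl⟩ := ih hc
      obtain ⟨rfl, rfl⟩ := ih' hd
      exact ⟨rfl, rfl⟩
  | iteTrue _ hb _ ih =>
    cases h₂ with
    | iteTrue _ _ hc => obtain ⟨rfl, rfl⟩ := ih hc; exact ⟨rfl, rfl⟩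
    | iteFalse _ hb' _ => exact absurd hb hb'
  | iteFalse _ hb _ ih =>
    cases h₂ with
    | iteTrue _ hb' _ => exact absurd hb' hb
    | iteFalse _ _ hd => obtain ⟨rfl, rfl⟩ := ih hd; exact ⟨rfl, rfl⟩
  | whileTrue _ hb _ _ ih ih' =>
    cases h₂ with
    | whileTrue _ _ hc hw =>
      obtain ⟨rfl, rfl⟩ := ih hc
      obtain ⟨rfl, rfl⟩ := ih' hw
      exact ⟨rfl, rfl⟩
    | whileFalse _ hb' => exact absurd hb hb'
  | whileFalse _ hb =>
    cases h₂ with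
    | whileTrue _ hb' _ _ => exact absurd hb' hb
    | whileFalse _ _ => exact ⟨rfl, rfl⟩

end RAM

/-! ## Edge-weighted graphs, their encoding, and the MAX `H`-subgraph problem -/

namespace MaxSubgraph

/-- `S` is an induced `H`-subgraph of `G`: an induced subgraph that is isomorphic to `H`. -/
def IsInducedCopy {h n : ℕ} (H : SimpleGraph (Fin h)) {G : SimpleGraph (Fin n)}
    (S : G.Subgraph) : Prop :=
  S.IsInduced ∧ Nonempty (H ≃g S.coe)

open Classical in
/-- The weight of a subgraph: the sum of the weights of its edges. -/
noncomputable def weight {n : ℕ} {G : SimpleGraph (Fin n)} (w : G.edgeSet → ℝ)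
    (S : G.Subgraph) : ℝ :=
  ∑ e : G.edgeSet, if (e : Sym2 (Fin n)) ∈ S.edgeSet then w e else 0

open Classical in
/-- Entry of the adjacency matrix. -/
noncomputable def adjEntry {n : ℕ} (G : SimpleGraph (Fin n)) (u v : Fin n) : ℕ :=
  if G.Adj u v then 1 else 0

open Classical in
/-- Entry of the weight matrix: `w(uv)` if `uv` is an edge, and `0` otherwise. -/
noncomputable def weightEntry {n : ℕ} (G : SimpleGraph (Fin n)) (w : G.edgeSet → ℝ)
    (u v : Fin n) : ℝ :=
  if huv : G.Adj u v then w ⟨s(u, v), huv⟩ else 0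

/-- The input: variable `0` holds `n`, word array `0` the adjacency matrix and real array `0` the
weight matrix, both row by row (entry `(u, v)` is in cell `u * n + v`); the rest is `0`. -/
noncomputable def input {n : ℕ} (G : SimpleGraph (Fin n)) (w : G.edgeSet → ℝ) : RAM.State where
  var x := if x = 0 then n else 0
  arr a k := if hk : a = 0 ∧ k < n * n then
    adjEntry G (Fin.divNat ⟨k, hk.2⟩) (Fin.modNat ⟨k, hk.2⟩) else 0
  real a k := if hk : a = 0 ∧ k < n * n then
    weightEntry G w (Fin.divNat ⟨k, hk.2⟩) (Fin.modNat ⟨k, hk.2⟩) else 0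

/-- The output is correct: either variable `1` is `1` and cells `0, …, h - 1` of word array `1`
hold the vertices of an induced `H`-subgraph of maximum weight, listed along an isomorphism from `H`,
or variable `1` is `0` and there is no induced `H`-subgraph. -/
def CorrectOutput {h n : ℕ} (H : SimpleGraph (Fin h)) {G : SimpleGraph (Fin n)}
    (w : G.edgeSet → ℝ) (s : RAM.State) : Prop :=
  (s.var 1 = 1 ∧ ∃ S : G.Subgraph, IsInducedCopy H S ∧
      (∀ S' : G.Subgraph, IsInducedCopy H S' → weight w S' ≤ weight w S) ∧
      ∃ φ : H ≃g S.coe, ∀ i : Fin h, s.arr 1 (i : ℕ) = ((φ i : Fin n) : ℕ)) ∨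
  (s.var 1 = 0 ∧ ¬ ∃ S : G.Subgraph, IsInducedCopy H S)

end MaxSubgraph

/-! ### A program logic for the machine: overflow bounds, frames, total correctness with time
bounds. -/

namespace RAM

/-! ## Word bounds -/

/-! Candidates are all maps from the vertices of `H` to the vertices of `G`, ranked first by the
number of violations (pairs whose images are wrongly adjacent, wrongly non-adjacent, or equal) and
then by weight. A best map has no violation exactly if an induced copy exists, and it is then a
heaviest copy (`violAll_eq_zero_iff`, `exists_induced`, `wtAll_of_iso`). So it suffices to find a
best map.

Fix the images `r` of the vertices from `3` on, and let `i`, `j`, `k` be the images of `0`, `1`,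
`2`. Violations and weight both have the form A(i,k) + B(j,k) + C(i,j) (`sum_map_allPairs`). When
two choices of `k` are compared for the same `i`, `j`, the term C cancels and the inequality
separates into a side that depends on `i` only and one that depends on `j` only (`KeysAt.le_iff`).
Cut the vertices of `G` into blocks of length d = log_256 n + 1 (rounded down). For given `k₀`, the
pairs (i,j) for which `k₀` is best in its block are then the dominance pairs between n blue points
(the `j`) and n red points (the `i`) in d coordinates. Ties are broken by the vertex number, so each
block has exactly one winner for each (i,j), and all `k₀` together give at most n²(n/d + 1) pairs
(`sum_winCount_le`). Checking these in constant time each costs O(n^h / log n) over all `r`. Nothing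
is lost, since the winner of the block of `k` is at least as good as `k` (`exists_wins`,
`Covers.of_beats`).

The dominance pairs are computed one coordinate at a time. A group is a list of points and stands
for its pairs of a blue entry and a later red entry. Initially there is one group, all blue points
followed by all red ones. To keep only the pairs ordered by the next key, each group is sorted by
bottom-up merge sort, and each merge emits a new group: the blue points of the left run and the red
points of the right run, in merged order. A blue entry and a later red entry meet in exactly one
merge, and they are in the right order in the emitted group exactly if their keys are (`cnt_em`,
`cross_pass`, `cntSum_splitAll`). So each pair stays represented exactly once or disappears.

The groups stay small because the sum of |g|·√|g| grows by a factor of at most 4 per coordinate: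
pass number i emits groups of length at most 2^(i+1) and of total length at most |g|, and the
resulting geometric sum is dominated by its end (`pot_split`). As 4^d ≤ 4·n^(1/4), the total size
remains O(n^(7/4)). All d rounds then take O(n^(7/4) log² n) = O(n² / log n) time for each of the
n^(h-2) choices of `k₀` and `r`.

For the machine, each program has a syntactic degree: while all stored words are below `B`, all
intermediate words are below `B ^ deg`. Hence only stored values have to be bounded, by a power of
`n + 2` whose exponent depends only on `h`, and the final word bound is again such a power, with an
exponent that depends only on `H`. -/

/-- All words in memory are smaller than `B`. -/
structure State.Bounded (B : ℕ) (s : State) : Prop where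
  two_le : 2 ≤ B
  var : ∀ x, s.var x < B
  arr : ∀ a i, s.arr a i < B

/-- In memory bounded by `B`, all words occurring in the evaluation are below `B ^ deg`. -/
def WExp.deg : WExp → ℕ
  | .const k => k + 1
  | .var _ => 1
  | .arr _ i => i.deg
  | .add e f => e.deg + f.deg
  | .sub e f => e.deg + f.deg
  | .mul e f => e.deg + f.deg
  | .div e f => e.deg + f.deg

/-- In memory bounded by `B`, all addresses in the expression are below `B ^ deg`. -/
def RExp.deg : RExp → ℕ
  | .arr _ i => i.deg
  | .add p q => p.deg + q.deg

/-- In memory bounded by `B`, all words occurring in the test are below `B ^ deg`. -/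
def Test.deg : Test → ℕ
  | .weq e f => e.deg + f.deg
  | .wlt e f => e.deg + f.deg
  | .rle p q => p.deg + q.deg
  | .not b => b.deg
  | .and b c => b.deg + c.deg

/-- In memory bounded by `B`, all words occurring in an execution are below `B ^ deg`, as long as the
memory stays bounded by `B`. -/
def Prog.deg : Prog → ℕ
  | .skip => 1
  | .setVar _ e => e.deg
  | .setArr _ i e => i.deg + e.deg
  | .setReal _ i p => i.deg + p.deg
  | .seq c d => c.deg + d.deg
  | .ite b c d => b.deg + (c.deg + d.deg)
  | .while b c => b.deg + c.deg

theorem WExp.one_le_deg (e : WExp) : 1 ≤ e.deg := by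
  induction e <;> simp only [WExp.deg] <;> omega

theorem pow_le_of_le_add_left {B W m k : ℕ} (hB : 2 ≤ B) (h : B ^ (m + k) ≤ W) : B ^ m ≤ W :=
  (Nat.pow_le_pow_right (by omega) (by omega)).trans h

theorem pow_le_of_le_add_right {B W m k : ℕ} (hB : 2 ≤ B) (h : B ^ (m + k) ≤ W) : B ^ k ≤ W :=
  (Nat.pow_le_pow_right (by omega) (by omega)).trans h

/-- Since `B` is at least `2`, a sum of two positive powers of `B` is at most their product, so sums
and products obey the same bound. Constants fit because `k < 2 ^ k`. -/
theorem WExp.eval_lt {B : ℕ} {s : State} (hs : s.Bounded B) (e : WExp) :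
    e.eval s < B ^ e.deg := by
  have hB := hs.two_le
  have key (m k : ℕ) (hm : 1 ≤ m) (hk : 1 ≤ k) : B ^ m + B ^ k ≤ B ^ (m + k) := by
    have h1 : 2 ≤ B ^ m := hB.trans (Nat.le_self_pow (by omega) B)
    have h2 : 2 ≤ B ^ k := hB.trans (Nat.le_self_pow (by omega) B)
    rw [pow_add]; nlinarith
  induction e with
  | const k =>
    exact (Nat.lt_two_pow_self (n := k)).trans_le
      ((Nat.pow_le_pow_right (by omega) (Nat.le_succ k)).trans (Nat.pow_le_pow_left hB _))
  | var x => simpa [WExp.eval, WExp.deg] using hs.var x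
  | arr a i _ => exact (hs.arr a _).trans_le (Nat.le_self_pow (Nat.one_le_iff_ne_zero.mp i.one_le_deg) B)
  | add e f ihe ihf =>
    exact (add_lt_add ihe ihf).trans_le (key _ _ e.one_le_deg f.one_le_deg)
  | sub e f ihe ihf =>
    exact ((Nat.sub_le _ _).trans_lt ihe).trans_le (Nat.pow_le_pow_right (by omega) (by simp [WExp.deg]))
  | mul e f ihe ihf => rw [WExp.deg, pow_add]; exact Nat.mul_lt_mul'' ihe ihf
  | div e f ihe ihf =>
    exact ((Nat.div_le_self _ _).trans_lt ihe).trans_le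
      (Nat.pow_le_pow_right (by omega) (by simp [WExp.deg]))

theorem WExp.fits {B W : ℕ} {s : State} (hs : s.Bounded B) (e : WExp) (hW : B ^ e.deg ≤ W) :
    e.Fits W s := by
  have hB := hs.two_le
  induction e with
  | const k => exact (WExp.eval_lt hs (.const k)).trans_le hW
  | var x => exact (WExp.eval_lt hs (.var x)).trans_le hW
  | arr a i ih => exact ⟨ih hW, (WExp.eval_lt hs (.arr a i)).trans_le hW⟩
  | add e f ihe ihf =>
    exact ⟨ihe (pow_le_of_le_add_left hB hW), ihf (pow_le_of_le_add_right hB hW),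
      (WExp.eval_lt hs (.add e f)).trans_le hW⟩
  | sub e f ihe ihf => exact ⟨ihe (pow_le_of_le_add_left hB hW), ihf (pow_le_of_le_add_right hB hW)⟩
  | mul e f ihe ihf =>
    exact ⟨ihe (pow_le_of_le_add_left hB hW), ihf (pow_le_of_le_add_right hB hW),
      (WExp.eval_lt hs (.mul e f)).trans_le hW⟩
  | div e f ihe ihf => exact ⟨ihe (pow_le_of_le_add_left hB hW), ihf (pow_le_of_le_add_right hB hW)⟩

theorem RExp.fits {B W : ℕ} {s : State} (hs : s.Bounded B) (p : RExp) (hW : B ^ p.deg ≤ W) :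
    p.Fits W s := by
  have hB := hs.two_le
  induction p with
  | arr a i => exact i.fits hs hW
  | add p q ihp ihq => exact ⟨ihp (pow_le_of_le_add_left hB hW), ihq (pow_le_of_le_add_right hB hW)⟩

theorem Test.fits {B W : ℕ} {s : State} (hs : s.Bounded B) (b : Test) (hW : B ^ b.deg ≤ W) :
    b.Fits W s := by
  have hB := hs.two_le
  induction b with
  | weq e f => exact ⟨e.fits hs (pow_le_of_le_add_left hB hW), f.fits hs (pow_le_of_le_add_right hB hW)⟩
  | wlt e f => exact ⟨e.fits hs (pow_le_of_le_add_left hB hW), f.fits hs (pow_le_of_le_add_right hB hW)⟩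
  | rle e f => exact ⟨e.fits hs (pow_le_of_le_add_left hB hW), f.fits hs (pow_le_of_le_add_right hB hW)⟩
  | not b ih => exact ih hW
  | and b c ihb ihc => exact ⟨ihb (pow_le_of_le_add_left hB hW), ihc (pow_le_of_le_add_right hB hW)⟩

/-- Every loop iteration therefore consumes time, so the time budget can serve as the termination
measure. -/
theorem Test.one_le_cost (b : Test) : 1 ≤ b.cost := by
  cases b <;> simp [Test.cost]

/-! ## Reading updated memory -/

@[simp] theorem State.setVar_var (s : State) (x v y : ℕ) :
    (s.setVar x v).var y = if y = x then v else s.var y := by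
  simp [State.setVar, Function.update_apply]

@[simp] theorem State.setVar_arr (s : State) (x v : ℕ) : (s.setVar x v).arr = s.arr := rfl

@[simp] theorem State.setVar_real (s : State) (x v : ℕ) : (s.setVar x v).real = s.real := rfl

@[simp] theorem State.setArr_var (s : State) (a i v : ℕ) : (s.setArr a i v).var = s.var := rfl

@[simp] theorem State.setArr_real (s : State) (a i v : ℕ) : (s.setArr a i v).real = s.real := rfl

@[simp] theorem State.setArr_arr (s : State) (a i v b : ℕ) :
    (s.setArr a i v).arr b = if b = a then Function.update (s.arr a) i v else s.arr b := by
  unfold State.setArr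
  by_cases h : b = a
  · subst h; simp
  · simp [h]

@[simp] theorem State.setReal_var (s : State) (a i : ℕ) (v : ℝ) : (s.setReal a i v).var = s.var := rfl

@[simp] theorem State.setReal_arr (s : State) (a i : ℕ) (v : ℝ) : (s.setReal a i v).arr = s.arr := rfl

@[simp] theorem State.setReal_real (s : State) (a i : ℕ) (v : ℝ) (b : ℕ) :
    (s.setReal a i v).real b = if b = a then Function.update (s.real a) i v else s.real b := by
  unfold State.setReal
  by_cases h : b = a
  · subst h; simp
  · simp [h]

theorem State.Bounded.setVar {B : ℕ} {s : State} (hs : s.Bounded B) (x : ℕ) {v : ℕ} (hv : v < B) :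
    (s.setVar x v).Bounded B where
  two_le := hs.two_le
  var y := by
    rw [State.setVar_var]; split
    · exact hv
    · exact hs.var y
  arr := hs.arr

theorem State.Bounded.setArr {B : ℕ} {s : State} (hs : s.Bounded B) (a i : ℕ) {v : ℕ} (hv : v < B) :
    (s.setArr a i v).Bounded B where
  two_le := hs.two_le
  var := hs.var
  arr b j := by
    rw [State.setArr_arr]; split
    · rw [Function.update_apply]; split
      · exact hv
      · exact hs.arr a j
    · exact hs.arr b j

theorem State.Bounded.setReal {B : ℕ} {s : State} (hs : s.Bounded B) (a i : ℕ) (v : ℝ) :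
    (s.setReal a i v).Bounded B where
  two_le := hs.two_le
  var := hs.var
  arr := hs.arr

/-! ## What a program leaves unchanged -/

/-- The program contains an assignment to the word variable `x`. -/
def Prog.writesVar (x : ℕ) : Prog → Bool
  | .setVar y _ => x == y
  | .seq c d => c.writesVar x || d.writesVar x
  | .ite _ c d => c.writesVar x || d.writesVar x
  | .while _ c => c.writesVar x
  | _ => false

/-- The program contains an assignment to a cell of the word array `a`. -/
def Prog.writesArr (a : ℕ) : Prog → Bool
  | .setArr b _ _ => a == b
  | .seq c d => c.writesArr a || d.writesArr a
  | .ite _ c d => c.writesArr a || d.writesArr a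
  | .while _ c => c.writesArr a
  | _ => false

/-- The program contains an assignment to a cell of the real array `a`. -/
def Prog.writesReal (a : ℕ) : Prog → Bool
  | .setReal b _ _ => a == b
  | .seq c d => c.writesReal a || d.writesReal a
  | .ite _ c d => c.writesReal a || d.writesReal a
  | .while _ c => c.writesReal a
  | _ => false

/-- `s` and `s'` agree on everything that `c` does not write. -/
structure Frame (c : Prog) (s s' : State) : Prop where
  var : ∀ x, c.writesVar x = false → s'.var x = s.var x
  arr : ∀ a, c.writesArr a = false → s'.arr a = s.arr a
  real : ∀ a, c.writesReal a = false → s'.real a = s.real a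

theorem Frame.refl (c : Prog) (s : State) : Frame c s s :=
  ⟨fun _ _ => rfl, fun _ _ => rfl, fun _ _ => rfl⟩

theorem Frame.trans {c : Prog} {s s' s'' : State} (h : Frame c s s') (h' : Frame c s' s'') :
    Frame c s s'' :=
  ⟨fun x hx => (h'.var x hx).trans (h.var x hx), fun x hx => (h'.arr x hx).trans (h.arr x hx),
    fun x hx => (h'.real x hx).trans (h.real x hx)⟩

theorem Frame.seq_left {c d : Prog} {s s' : State} (h : Frame c s s') : Frame (.seq c d) s s' := by
  constructor <;> intro x hx
  · exact h.var x (by simp [Prog.writesVar] at hx; exact hx.1)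
  · exact h.arr x (by simp [Prog.writesArr] at hx; exact hx.1)
  · exact h.real x (by simp [Prog.writesReal] at hx; exact hx.1)

theorem Frame.seq_right {c d : Prog} {s s' : State} (h : Frame d s s') : Frame (.seq c d) s s' := by
  constructor <;> intro x hx
  · exact h.var x (by simp [Prog.writesVar] at hx; exact hx.2)
  · exact h.arr x (by simp [Prog.writesArr] at hx; exact hx.2)
  · exact h.real x (by simp [Prog.writesReal] at hx; exact hx.2)

theorem Frame.while {b : Test} {c : Prog} {s s' : State} (h : Frame c s s') :
    Frame (.while b c) s s' :=
  ⟨h.var, h.arr, h.real⟩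

theorem Frame.setVar {x : ℕ} {e : WExp} (s : State) (v : ℕ) :
    Frame (.setVar x e) s (s.setVar x v) := by
  refine ⟨fun y hy => ?_, fun _ _ => rfl, fun _ _ => rfl⟩
  have : y ≠ x := by simpa [Prog.writesVar] using hy
  simp [this]

/-- Only indices are computed at run time, whereas the written variables and arrays can be read off
the program text. So this syntactic frame needs no reasoning about aliasing. -/
theorem Exec.frame {W : ℕ} {c : Prog} {s s' : State} {t : ℕ} (h : Exec W c s t s') :
    Frame c s s' := by
  induction h with
  | skip s => exact Frame.refl _ _
  | setVar s x e he => exact Frame.setVar s _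
  | setArr s a i e hi he =>
    refine ⟨fun _ _ => rfl, fun b hb => ?_, fun _ _ => rfl⟩
    have : b ≠ a := by simpa [Prog.writesArr] using hb
    simp [this]
  | setReal s a i p hi hp =>
    refine ⟨fun _ _ => rfl, fun _ _ => rfl, fun b hb => ?_⟩
    have : b ≠ a := by simpa [Prog.writesReal] using hb
    simp [this]
  | seq _ _ ih ih' => exact ih.seq_left.trans ih'.seq_right
  | iteTrue _ _ _ ih =>
    constructor <;> intro x hx
    · exact ih.var x (by simp [Prog.writesVar] at hx; exact hx.1)
    · exact ih.arr x (by simp [Prog.writesArr] at hx; exact hx.1)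
    · exact ih.real x (by simp [Prog.writesReal] at hx; exact hx.1)
  | iteFalse _ _ _ ih =>
    constructor <;> intro x hx
    · exact ih.var x (by simp [Prog.writesVar] at hx; exact hx.2)
    · exact ih.arr x (by simp [Prog.writesArr] at hx; exact hx.2)
    · exact ih.real x (by simp [Prog.writesReal] at hx; exact hx.2)
  | whileTrue _ _ _ _ ih ih' => exact ih.while.trans ih'
  | whileFalse _ _ => exact Frame.refl _ _

/-! ## Total correctness with time bounds -/

/-- From `s`, with memory bounded by `B`, the program `c` halts within `t` time units in a state that
satisfies `Q`, and memory is still bounded by `B`. -/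
def Runs (B : ℕ) (c : Prog) (s : State) (t : ℕ) (Q : State → Prop) : Prop :=
  s.Bounded B → ∀ W, B ^ c.deg ≤ W → ∃ t' ≤ t, ∃ s', Exec W c s t' s' ∧ s'.Bounded B ∧ Q s'

theorem Runs.mono {B : ℕ} {c : Prog} {s : State} {t t' : ℕ} {Q Q' : State → Prop}
    (h : Runs B c s t Q) (ht : t ≤ t') (hQ : ∀ s', Frame c s s' → Q s' → Q' s') :
    Runs B c s t' Q' := by
  intro hs W hW
  obtain ⟨u, hu, s', he, hb, hq⟩ := h hs W hW
  exact ⟨u, hu.trans ht, s', he, hb, hQ s' he.frame hq⟩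

theorem Runs.of_bounded {B : ℕ} {c : Prog} {s : State} {t : ℕ} {Q : State → Prop}
    (h : s.Bounded B → Runs B c s t Q) : Runs B c s t Q :=
  fun hs => h hs hs

theorem Runs.seq {B : ℕ} {c d : Prog} {s : State} {t t' : ℕ} {R Q : State → Prop}
    (hc : Runs B c s t R) (hd : ∀ s', Frame c s s' → R s' → Runs B d s' t' Q) :
    Runs B (.seq c d) s (t + t') Q := by
  intro hs W hW
  obtain ⟨u, hu, s', he, hb, hq⟩ := hc hs W (pow_le_of_le_add_left hs.two_le hW)
  obtain ⟨u', hu', s'', he', hb', hq'⟩ :=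
    hd s' he.frame hq hb W (pow_le_of_le_add_right hs.two_le hW)
  exact ⟨u + u', by omega, s'', .seq he he', hb', hq'⟩

/-- Strong induction on the remaining budget: each test costs at least one unit, so termination
needs no separate variant. -/
theorem Runs.while_of_budget {B : ℕ} {b : Test} {c : Prog} {Q : State → Prop} (I : State → ℕ → Prop)
    (hstep : ∀ s τ, I s τ → b.holds s →
      ∃ τ₁ τ₂, b.cost + τ₁ + τ₂ ≤ τ ∧ Runs B c s τ₁ fun s' => I s' τ₂)
    (hdone : ∀ s τ, I s τ → ¬ b.holds s → b.cost ≤ τ ∧ Q s) (s : State) (τ : ℕ) (hI : I s τ) :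
    Runs B (.while b c) s τ Q := by
  induction τ using Nat.strong_induction_on generalizing s with
  | _ τ ih =>
    intro hs W hW
    have hf := b.fits hs (pow_le_of_le_add_left hs.two_le hW)
    by_cases hb : b.holds s
    · obtain ⟨τ₁, τ₂, hle, hr⟩ := hstep s τ hI hb
      have := b.one_le_cost
      obtain ⟨u, hu, s', he, hbd, hq⟩ := hr hs W (pow_le_of_le_add_right hs.two_le hW)
      obtain ⟨u', hu', s'', he', hb', hq'⟩ := ih τ₂ (by omega) s' hq hbd W hW
      exact ⟨b.cost + u + u', by omega, s'', .whileTrue hf hb he he', hb', hq'⟩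
    · obtain ⟨hle, hq⟩ := hdone s τ hI hb
      exact ⟨b.cost, hle, s, .whileFalse hf hb, hs, hq⟩

/-- The rule for loops: `I s τ` says that in state `s` a time budget of `τ` suffices for the rest of
the loop. -/
theorem Runs.while {B : ℕ} {b : Test} {c : Prog} {Q : State → Prop} (I : State → ℕ → Prop)
    {s₀ : State} {τ₀ : ℕ} (hI : I s₀ τ₀)
    (hstep : ∀ s τ, Frame c s₀ s → I s τ → b.holds s →
      ∃ τ₁ τ₂, b.cost + τ₁ + τ₂ ≤ τ ∧ Runs B c s τ₁ fun s' => I s' τ₂)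
    (hdone : ∀ s τ, Frame c s₀ s → I s τ → ¬ b.holds s → b.cost ≤ τ ∧ Q s) :
    Runs B (.while b c) s₀ τ₀ Q := by
  refine Runs.while_of_budget (fun s τ => Frame c s₀ s ∧ I s τ) ?_ ?_ s₀ τ₀ ⟨Frame.refl _ _, hI⟩
  · rintro s τ ⟨hF, h⟩ hb
    obtain ⟨τ₁, τ₂, hle, hr⟩ := hstep s τ hF h hb
    exact ⟨τ₁, τ₂, hle, hr.mono le_rfl fun s' hF' h' => ⟨hF.trans hF', h'⟩⟩
  · rintro s τ ⟨hF, h⟩ hb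
    exact hdone s τ hF h hb

/-- Weakest precondition of loop-free programs. -/
def wp (B : ℕ) : Prog → State → (State → Prop) → Prop
  | .skip, s, Q => Q s
  | .setVar x e, s, Q => e.eval s < B ∧ Q (s.setVar x (e.eval s))
  | .setArr a i e, s, Q => e.eval s < B ∧ Q (s.setArr a (i.eval s) (e.eval s))
  | .setReal a i p, s, Q => Q (s.setReal a (i.eval s) (p.eval s))
  | .seq c d, s, Q => wp B c s fun s' => wp B d s' Q
  | .ite b c d, s, Q => (b.holds s → wp B c s Q) ∧ (¬ b.holds s → wp B d s Q)
  | .while _ _, _, _ => False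

/-- Upper bound for the running time of loop-free programs. -/
def Prog.cost : Prog → ℕ
  | .skip => 1
  | .setVar _ e => e.cost + 1
  | .setArr _ i e => i.cost + e.cost + 1
  | .setReal _ i p => i.cost + p.cost + 1
  | .seq c d => c.cost + d.cost
  | .ite b c d => b.cost + (c.cost + d.cost)
  | .while _ _ => 0

theorem Runs.of_wp {B : ℕ} {c : Prog} {s : State} {Q : State → Prop} (h : wp B c s Q) :
    Runs B c s c.cost Q := by
  induction c generalizing s Q with
  | skip => exact fun hs W _ => ⟨1, le_rfl, s, .skip s, hs, h⟩
  | setVar x e => exact fun hs W hW => ⟨_, le_rfl, _, .setVar s x e (e.fits hs hW), hs.setVar x h.1, h.2⟩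
  | setArr a i e =>
    exact fun hs W hW => ⟨_, le_rfl, _, .setArr s a i e
      (i.fits hs (pow_le_of_le_add_left hs.two_le hW)) (e.fits hs (pow_le_of_le_add_right hs.two_le hW)),
      hs.setArr a _ h.1, h.2⟩
  | setReal a i p =>
    exact fun hs W hW => ⟨_, le_rfl, _, .setReal s a i p
      (i.fits hs (pow_le_of_le_add_left hs.two_le hW)) (p.fits hs (pow_le_of_le_add_right hs.two_le hW)),
      hs.setReal a _ _, h⟩
  | seq c d ihc ihd => exact Runs.seq (ihc h) fun s' _ hs' => ihd hs'
  | ite b c d ihc ihd =>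
    intro hs W hW
    have hf := b.fits hs (pow_le_of_le_add_left hs.two_le hW)
    have hW' := pow_le_of_le_add_right hs.two_le hW
    by_cases hb : b.holds s
    · obtain ⟨u, hu, s', he, hbd, hq⟩ := ihc (h.1 hb) hs W (pow_le_of_le_add_left hs.two_le hW')
      exact ⟨b.cost + u, by simp only [Prog.cost]; omega, s', .iteTrue hf hb he, hbd, hq⟩
    · obtain ⟨u, hu, s', he, hbd, hq⟩ := ihd (h.2 hb) hs W (pow_le_of_le_add_right hs.two_le hW')
      exact ⟨b.cost + u, by simp only [Prog.cost]; omega, s', .iteFalse hf hb he, hbd, hq⟩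
  | _ => exact h.elim

theorem Runs.ite {B : ℕ} {b : Test} {c d : Prog} {s : State} {t : ℕ} {Q : State → Prop}
    (hc : b.holds s → Runs B c s t Q) (hd : ¬ b.holds s → Runs B d s t Q) :
    Runs B (.ite b c d) s (b.cost + t) Q := by
  intro hs W hW
  have hf := b.fits hs (pow_le_of_le_add_left hs.two_le hW)
  have hW' := pow_le_of_le_add_right hs.two_le hW
  by_cases hb : b.holds s
  · obtain ⟨u, hu, s', he, hbd, hq⟩ := hc hb hs W (pow_le_of_le_add_left hs.two_le hW')
    exact ⟨b.cost + u, by omega, s', .iteTrue hf hb he, hbd, hq⟩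
  · obtain ⟨u, hu, s', he, hbd, hq⟩ := hd hb hs W (pow_le_of_le_add_right hs.two_le hW')
    exact ⟨b.cost + u, by omega, s', .iteFalse hf hb he, hbd, hq⟩

/-- `for x = 0, …, e - 1 do c`. -/
def forLoop (x : ℕ) (e : WExp) (c : Prog) : Prog :=
  .seq (.setVar x (.const 0))
    (.while (.wlt (.var x) e) (.seq c (.setVar x (.add (.var x) (.const 1)))))

/-- The cost may vary with the index because in the outer loop only the sum of the numbers of
reported pairs is well bounded. The bound `e` is evaluated anew in each turn, hence the invariant
has to fix its value. Each turn pays `e.cost + 2` for the test and `4` for the increment. -/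
theorem Runs.for_range {B x N : ℕ} {e : WExp} {c : Prog} {s : State} (I : ℕ → State → Prop)
    (cost : ℕ → ℕ) (hx : c.writesVar x = false) (hN : N < B) (he : ∀ i s', I i s' → e.eval s' = N)
    (h0 : I 0 (s.setVar x 0))
    (hstep : ∀ i < N, ∀ s', Frame (forLoop x e c) s s' → s'.var x = i → I i s' →
      Runs B c s' (cost i) fun s'' => I (i + 1) (s''.setVar x (i + 1))) :
    Runs B (forLoop x e c) s (∑ i ∈ Finset.range N, (cost i + (e.cost + 6)) + (e.cost + 4)) (I N) := by
  have hr : Runs B (.setVar x (.const 0)) s 2 fun s' => s' = s.setVar x 0 :=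
    Runs.of_wp (c := .setVar x (.const 0)) ⟨by simp [WExp.eval]; omega, rfl⟩
  refine (hr.seq (t' := ∑ i ∈ Finset.range N, (cost i + (e.cost + 6)) + (e.cost + 2)) ?_).mono
    (by omega) fun _ _ h => h
  rintro s₁ hF₁ rfl
  refine Runs.while (fun s' τ => ∃ i ≤ N, s'.var x = i ∧ I i s' ∧
    τ = ∑ j ∈ Finset.Ico i N, (cost j + (e.cost + 6)) + (e.cost + 2)) ?_ ?_ ?_
  · exact ⟨0, by omega, by simp, h0, by simp⟩
  · rintro s' τ hF ⟨i, hi, hxi, hI, rfl⟩ hb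
    have hlt : i < N := by simpa [Test.holds, WExp.eval, hxi, he i s' hI] using hb
    rw [Finset.sum_eq_sum_Ico_succ_bot hlt]
    refine ⟨cost i + 4, ∑ j ∈ Finset.Ico (i + 1) N, (cost j + (e.cost + 6)) + (e.cost + 2),
      by simp only [Test.cost, WExp.cost]; omega, ?_⟩
    refine Runs.seq (hstep i hlt s' ?_ hxi hI) ?_
    · exact (Frame.seq_left hF₁).trans (Frame.seq_right hF.while)
    · intro s'' hF'' hI''
      have : s''.var x = i := (hF''.var x hx).trans hxi
      refine Runs.of_wp (c := .setVar x (.add (.var x) (.const 1)))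
        ⟨by simp [WExp.eval, this]; omega, i + 1, hlt, ?_⟩
      simpa [WExp.eval, this] using hI''
  · rintro s' τ hF ⟨i, hi, hxi, hI, rfl⟩ hb
    have : ¬ i < N := by simpa [Test.holds, WExp.eval, hxi, he i s' hI] using hb
    obtain rfl : i = N := by omega
    exact ⟨by simp [Test.cost, WExp.cost]; omega, hI⟩

theorem Runs.for_range_const {B x N t : ℕ} {e : WExp} {c : Prog} {s : State} (I : ℕ → State → Prop)
    (hx : c.writesVar x = false) (hN : N < B) (he : ∀ i s', I i s' → e.eval s' = N)
    (h0 : I 0 (s.setVar x 0))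
    (hstep : ∀ i < N, ∀ s', Frame (forLoop x e c) s s' → s'.var x = i → I i s' →
      Runs B c s' t fun s'' => I (i + 1) (s''.setVar x (i + 1))) :
    Runs B (forLoop x e c) s (N * (t + (e.cost + 6)) + (e.cost + 4)) (I N) :=
  (Runs.for_range I (fun _ => t) hx hN he h0 hstep).mono (by simp) fun _ _ h => h

end RAM

/-! ### Splitting lists by merge sort: counts of ordered pairs, and the potential. -/

namespace Dominance

/-- Number of pairs of positions `s < t` of the list with entries `q` and `p`. -/
def cnt (q p : ℕ) : List ℕ → ℕ
  | [] => 0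
  | x :: l => (if x = q then l.count p else 0) + cnt q p l

theorem cnt_append (q p : ℕ) (l r : List ℕ) :
    cnt q p (l ++ r) = cnt q p l + cnt q p r + l.count q * r.count p := by
  induction l with
  | nil => simp [cnt]
  | cons x l ih =>
    simp only [List.cons_append, cnt, ih, List.count_append, List.count_cons, beq_iff_eq]
    split_ifs <;> ring

/-- Total number over a list of groups of the pairs of positions with entries `q` and `p`. -/
def cntSum (q p : ℕ) (gs : List (List ℕ)) : ℕ := (gs.map (cnt q p)).sum

/-- Number of pairs of positions with entries `q` and `p` in different runs. -/
def cross (q p : ℕ) : List (List ℕ) → ℕ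
  | [] => 0
  | r :: rs => r.count q * rs.flatten.count p + cross q p rs

variable (n : ℕ) (le : ℕ → ℕ → Prop) [DecidableRel le]

/-- Merge of two sorted lists. -/
def mrg : List ℕ → List ℕ → List ℕ
  | [], r => r
  | a :: l, [] => a :: l
  | a :: l, b :: r => if le a b then a :: mrg l (b :: r) else b :: mrg (a :: l) r
termination_by l r => l.length + r.length

/-- The merge of the blue points (those `≥ n`) of the first list with the red points (those `< n`) of
the second list. -/
def em : List ℕ → List ℕ → List ℕ
  | [], r => r.filter (· < n)
  | a :: l, [] => (a :: l).filter (n ≤ ·)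
  | a :: l, b :: r =>
    if le a b then (if n ≤ a then [a] else []) ++ em l (b :: r)
    else (if b < n then [b] else []) ++ em (a :: l) r
termination_by l r => l.length + r.length

theorem mrg_nil_left (r : List ℕ) : mrg le [] r = r := by cases r <;> simp [mrg]

theorem mrg_nil_right (l : List ℕ) : mrg le l [] = l := by cases l <;> simp [mrg]

theorem em_nil_right (l : List ℕ) : em n le l [] = l.filter (n ≤ ·) := by cases l <;> simp [em]

theorem mrg_perm (l r : List ℕ) : (mrg le l r).Perm (l ++ r) := by
  fun_induction mrg le l r with
  | case1 r => simp
  | case2 a l => simp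
  | case3 a l b r h ih => simpa using ih
  | case4 a l b r h ih => exact (ih.cons b).trans (List.perm_middle (l₁ := a :: l)).symm

theorem mrg_length (l r : List ℕ) : (mrg le l r).length = l.length + r.length := by
  simpa using (mrg_perm le l r).length_eq

theorem mrg_sorted (hle : Std.Total le) (htr : IsTrans ℕ le) {l r : List ℕ}
    (hl : l.Pairwise le) (hr : r.Pairwise le) : (mrg le l r).Pairwise le := by
  fun_induction mrg le l r with
  | case1 r => exact hr
  | case2 a l => exact hl
  | case3 a l b r h ih =>
    rw [List.pairwise_cons] at hl ⊢
    refine ⟨fun x hx => ?_, ih hl.2 hr⟩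
    rcases List.mem_append.1 ((mrg_perm le _ _).mem_iff.1 hx) with hx | hx
    · exact hl.1 x hx
    · rcases List.mem_cons.1 hx with rfl | hx
      · exact h
      · exact htr.trans _ _ _ h ((List.pairwise_cons.1 hr).1 x hx)
  | case4 a l b r h ih =>
    have hba : le b a := (hle.total a b).resolve_left h
    rw [List.pairwise_cons] at hr ⊢
    refine ⟨fun x hx => ?_, ih hl hr.2⟩
    rcases List.mem_append.1 ((mrg_perm le _ _).mem_iff.1 hx) with hx | hx
    · rcases List.mem_cons.1 hx with rfl | hx
      · exact hba
      · exact htr.trans _ _ _ hba ((List.pairwise_cons.1 hl).1 x hx)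
    · exact hr.1 x hx

theorem em_mem {l r : List ℕ} {x : ℕ} (hx : x ∈ em n le l r) : x ∈ l ++ r := by
  fun_induction em n le l r with
  | case1 r => simpa using List.mem_of_mem_filter hx
  | case2 a l => simpa using List.mem_of_mem_filter hx
  | case3 a l b r h ih =>
    rcases List.mem_append.1 hx with hx | hx
    · split_ifs at hx <;> simp_all
    · have := ih hx; simp only [List.cons_append, List.mem_cons]; exact Or.inr this
  | case4 a l b r h ih =>
    rcases List.mem_append.1 hx with hx | hx
    · split_ifs at hx <;> simp_all
    · have := ih hx; simp at this ⊢; tauto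

theorem em_length_le (l r : List ℕ) : (em n le l r).length ≤ l.length + r.length := by
  fun_induction em n le l r with
  | case1 r => simpa using List.length_filter_le _ r
  | case2 a l => simpa using List.length_filter_le _ (a :: l)
  | case3 a l b r h ih =>
    simp only [List.length_append, List.length_cons] at ih ⊢
    split_ifs <;> simp <;> omega
  | case4 a l b r h ih =>
    simp only [List.length_append, List.length_cons] at ih ⊢
    split_ifs <;> simp <;> omega

/-- The emitted group has all red points of the right run and none of the left. Thus a blue point,
at the moment it is emitted, precedes exactly the red points that remain in the right run. -/
theorem count_em_red {p : ℕ} (hp : p < n) (l r : List ℕ) : (em n le l r).count p = r.count p := by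
  fun_induction em n le l r with
  | case1 r => rw [List.count_filter]; simpa using hp
  | case2 a l =>
    rw [List.count_eq_zero.2]; · simp
    intro h; have := List.of_mem_filter h; simp at this; omega
  | case3 a l b r h ih =>
    rw [List.count_append, ih]
    split_ifs
    · have : a ≠ p := by omega
      simp [this]
    · simp
  | case4 a l b r h ih =>
    rw [List.count_append, ih, List.count_cons]
    split_ifs with h1 h2 h2
    · simp at h2; simp [h2]; omega
    · simp at h2; simp [h2]
    · simp at h2; omega
    · simp

theorem cnt_eq_zero_left {q : ℕ} (p : ℕ) {l : List ℕ} (h : q ∉ l) : cnt q p l = 0 := by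
  induction l with
  | nil => rfl
  | cons x l ih =>
    rw [List.mem_cons, not_or] at h
    rw [cnt, ih h.2, if_neg (Ne.symm h.1)]

theorem cnt_eq_zero_right (q : ℕ) {p : ℕ} {l : List ℕ} (h : p ∉ l) : cnt q p l = 0 := by
  induction l with
  | nil => rfl
  | cons x l ih =>
    rw [List.mem_cons, not_or] at h
    rw [cnt, ih h.2, List.count_eq_zero.2 h.2]; simp

/-- A merge step keeps exactly the pairs that are ordered by the new key. -/
theorem cnt_em (htr : IsTrans ℕ le) {q p : ℕ} (hq : n ≤ q) (hp : p < n)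
    {l r : List ℕ} (hl : l.Pairwise le) (hr : r.Pairwise le) :
    cnt q p (em n le l r) = if le q p then l.count q * r.count p else 0 := by
  fun_induction em n le l r with
  | case1 r =>
    rw [cnt_eq_zero_left]; · simp
    intro h; have := List.of_mem_filter h; simp at this; omega
  | case2 a l =>
    rw [cnt_eq_zero_right]; · simp
    intro h; have := List.of_mem_filter h; simp at this; omega
  | case3 a l b r h ih =>
    have hc : (em n le l (b :: r)).count p = (b :: r).count p := count_em_red n le hp _ _
    have key : cnt q p ((if n ≤ a then [a] else []) ++ em n le l (b :: r)) =
        (if a = q then (b :: r).count p else 0) + cnt q p (em n le l (b :: r)) := by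
      by_cases ha : n ≤ a
      · simp [ha, cnt, hc]
      · have : a ≠ q := by omega
        simp [ha, this]
    rw [key, ih (List.pairwise_cons.1 hl).2 hr, List.count_cons (a := q) (b := a)]
    by_cases haq : a = q
    · subst haq
      by_cases hle' : le a p
      · simp [hle']; ring
      -- The blue point `q = a` goes before the whole sorted rest `b :: r`; by transitivity any `p`
      -- in it would satisfy `le q p`.
      · have : p ∉ b :: r := by
          intro hm
          rcases List.mem_cons.1 hm with rfl | hm
          · exact hle' h
          · exact hle' (htr.trans _ _ _ h ((List.pairwise_cons.1 hr).1 p hm))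
        simp [hle', List.count_eq_zero.2 this]
    · simp [haq]
  | case4 a l b r h ih =>
    have key : cnt q p ((if b < n then [b] else []) ++ em n le (a :: l) r) =
        cnt q p (em n le (a :: l) r) := by
      by_cases hb : b < n
      · have : b ≠ q := by omega
        simp [hb, cnt, this]
      · simp [hb]
    rw [key, ih hl (List.pairwise_cons.1 hr).2, List.count_cons (a := p) (b := b)]
    by_cases hbp : b = p
    · subst hbp
      by_cases hle' : le q b
      -- If `q` were still waiting on the left, then `a ≤ q ≤ b` would contradict that `b` was taken
      -- first.
      · have : q ∉ a :: l := by
          intro hm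
          rcases List.mem_cons.1 hm with rfl | hm
          · exact h hle'
          · exact h (htr.trans _ _ _ ((List.pairwise_cons.1 hl).1 q hm) hle')
        rw [List.count_eq_zero.2 this]; simp
      · simp [hle']
    · simp [hbp]

/-! ### Passes of bottom-up merge sort -/

/-- Merge neighbouring runs. -/
def passRuns : List (List ℕ) → List (List ℕ)
  | a :: b :: rs => mrg le a b :: passRuns rs
  | rs => rs

/-- The groups emitted while merging neighbouring runs. -/
def passEm : List (List ℕ) → List (List ℕ)
  | a :: b :: rs => em n le a b :: passEm rs
  | _ => []

theorem passRuns_flatten_perm (R : List (List ℕ)) : (passRuns le R).flatten.Perm R.flatten := by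
  fun_induction passRuns le R with
  | case1 a b rs ih => simpa using (mrg_perm le a b).append ih
  | case2 R h => exact List.Perm.refl _

theorem passRuns_sorted (hle : Std.Total le) (htr : IsTrans ℕ le) {R : List (List ℕ)}
    (hR : ∀ r ∈ R, r.Pairwise le) : ∀ r ∈ passRuns le R, r.Pairwise le := by
  fun_induction passRuns le R with
  | case1 a b rs ih =>
    simp only [List.mem_cons, forall_eq_or_imp] at hR ⊢
    exact ⟨mrg_sorted le hle htr hR.1 hR.2.1, ih hR.2.2⟩
  | case2 R h => exact hR

/-- A conservation law: a pair in different runs either lies in two runs that are merged now, and is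
emitted exactly if `le q p` holds, or it still lies in different runs after the pass. -/
theorem cross_pass (htr : IsTrans ℕ le) {q p : ℕ} (hq : n ≤ q) (hp : p < n)
    {R : List (List ℕ)} (hR : ∀ r ∈ R, r.Pairwise le) :
    cntSum q p (passEm n le R) + (if le q p then cross q p (passRuns le R) else 0) =
      if le q p then cross q p R else 0 := by
  fun_induction passRuns le R with
  | case1 a b rs ih =>
    simp only [List.mem_cons, forall_eq_or_imp] at hR
    have h1 := cnt_em n le htr hq hp hR.1 hR.2.1
    have h2 := ih hR.2.2
    have h3 := (passRuns_flatten_perm le rs).count_eq p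
    have h4 := (mrg_perm le a b).count_eq q
    simp only [cntSum, passEm, List.map_cons, List.sum_cons, cross, List.flatten_cons,
      List.count_append] at h1 h2 h3 h4 ⊢
    rw [h1, h3, h4]
    split_ifs at h2 ⊢
    · rw [← h2]; ring
    · omega
  | case2 R h =>
    rcases R with _ | ⟨a, _ | ⟨b, R⟩⟩
    · simp [passEm, cntSum]
    · simp [passEm, cntSum]
    · exact (h a b R rfl).elim

theorem passEm_length (R : List (List ℕ)) :
    (passEm n le R).length + (passRuns le R).length = R.length := by
  fun_induction passRuns le R with
  | case1 a b rs ih => simp only [passEm, List.length_cons]; omega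
  | case2 R h =>
    rcases R with _ | ⟨a, _ | ⟨b, R⟩⟩
    · simp [passEm]
    · simp [passEm]
    · exact (h a b R rfl).elim

theorem passEm_flatten_length (R : List (List ℕ)) :
    (passEm n le R).flatten.length ≤ R.flatten.length := by
  fun_induction passEm n le R with
  | case1 a b rs ih =>
    have := em_length_le n le a b
    simp only [List.flatten_cons, List.length_append] at ih ⊢
    omega
  | case2 R h => simp

theorem passEm_mem {R : List (List ℕ)} {e : List ℕ} (he : e ∈ passEm n le R) {x : ℕ} (hx : x ∈ e) :
    x ∈ R.flatten := by
  fun_induction passEm n le R with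
  | case1 a b rs ih =>
    rcases List.mem_cons.1 he with rfl | he
    · have := em_mem n le hx
      simp only [List.flatten_cons, List.mem_append] at this ⊢; tauto
    · have := ih he
      simp only [List.flatten_cons, List.mem_append] at this ⊢; tauto
  | case2 R h => simp at he

/-- All runs have length `w`, except that the last one may be shorter (but is nonempty). -/
def Chunked (w : ℕ) : List (List ℕ) → Prop
  | [] => True
  | [r] => 0 < r.length ∧ r.length ≤ w
  | r :: r' :: rs => r.length = w ∧ Chunked w (r' :: rs)

theorem Chunked.tail {w : ℕ} {r : List ℕ} {rs : List (List ℕ)} (h : Chunked w (r :: rs)) :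
    Chunked w rs := by
  cases rs with
  | nil => trivial
  | cons r' rs => exact h.2

theorem Chunked.length_head_le {w : ℕ} {r : List ℕ} {rs : List (List ℕ)}
    (h : Chunked w (r :: rs)) : r.length ≤ w := by
  cases rs with
  | nil => exact h.2
  | cons r' rs => exact h.1.le

theorem Chunked.length_head_pos {w : ℕ} (hw : 0 < w) {r : List ℕ} {rs : List (List ℕ)}
    (h : Chunked w (r :: rs)) : 0 < r.length := by
  cases rs with
  | nil => exact h.1
  | cons r' rs => rw [h.1]; exact hw

theorem passRuns_chunked {w : ℕ} (hw : 0 < w) {R : List (List ℕ)} (h : Chunked w R) :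
    Chunked (2 * w) (passRuns le R) := by
  fun_induction passRuns le R with
  | case1 a b rs ih =>
    have hb := h.2
    have := ih hb.tail
    rcases rs with _ | ⟨c, rs⟩
    · simp only [passRuns, Chunked, mrg_length]
      have := h.1; have := hb.length_head_le
      exact ⟨by omega, by omega⟩
    · have h1 : (mrg le a b).length = 2 * w := by
        have := h.1; have := hb.1
        rw [mrg_length]; omega
      cases hpr : passRuns le (c :: rs) with
      | nil => simp only [Chunked, h1]; exact ⟨by omega, le_rfl⟩
      | cons d ds => exact ⟨h1, hpr ▸ this⟩
  | case2 R h' =>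
    rcases R with _ | ⟨a, _ | ⟨b, R⟩⟩
    · trivial
    · exact ⟨h.1, h.2.trans (by omega)⟩
    · exact (h' a b R rfl).elim

theorem passEm_length_le {w : ℕ} {R : List (List ℕ)} (h : Chunked w R) {e : List ℕ}
    (he : e ∈ passEm n le R) : e.length ≤ 2 * w := by
  fun_induction passEm n le R with
  | case1 a b rs ih =>
    rcases List.mem_cons.1 he with rfl | he
    · have := em_length_le n le a b
      have := h.1; have := h.2.length_head_le
      omega
    · exact ih h.2.tail he
  | case2 R h => simp at he

theorem chunked_singletons (l : List ℕ) : Chunked 1 (l.map fun x => [x]) := by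
  induction l with
  | nil => trivial
  | cons a l ih =>
    cases l with
    | nil => simp [Chunked]
    | cons b l => exact ⟨rfl, ih⟩

/-! ### Splitting a group along its order, and sorting it by the next key -/

/-- The runs after `i` passes. -/
def runsAt (l : List ℕ) (i : ℕ) : List (List ℕ) := (passRuns le)^[i] (l.map fun x => [x])

/-- The groups emitted in the first `i` passes. -/
def emits (l : List ℕ) : ℕ → List (List ℕ)
  | 0 => []
  | i + 1 => emits l i ++ passEm n le (runsAt le l i)

/-- The groups emitted while sorting `l`. -/
def split (l : List ℕ) : List (List ℕ) := emits n le l (Nat.clog 2 l.length)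

theorem runsAt_succ (l : List ℕ) (i : ℕ) : runsAt le l (i + 1) = passRuns le (runsAt le l i) :=
  Function.iterate_succ_apply' _ _ _

theorem runsAt_chunked (l : List ℕ) (i : ℕ) : Chunked (2 ^ i) (runsAt le l i) := by
  induction i with
  | zero => exact chunked_singletons l
  | succ i ih => rw [runsAt_succ, pow_succ']; exact passRuns_chunked le (by positivity) ih

theorem runsAt_flatten_perm (l : List ℕ) (i : ℕ) : (runsAt le l i).flatten.Perm l := by
  induction i with
  | zero => simp [runsAt, ← List.flatMap_def]
  | succ i ih => rw [runsAt_succ]; exact (passRuns_flatten_perm le _).trans ih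

theorem runsAt_flatten_length (l : List ℕ) (i : ℕ) : (runsAt le l i).flatten.length = l.length :=
  (runsAt_flatten_perm le l i).length_eq

theorem runsAt_sorted (hle : Std.Total le) (htr : IsTrans ℕ le) (l : List ℕ) (i : ℕ) :
    ∀ r ∈ runsAt le l i, r.Pairwise le := by
  induction i with
  | zero => simp [runsAt]
  | succ i ih => rw [runsAt_succ]; exact passRuns_sorted le hle htr ih

theorem Chunked.length_le_one {w : ℕ} {R : List (List ℕ)} (hw : 0 < w) (h : Chunked w R)
    (hl : R.flatten.length ≤ w) : R.length ≤ 1 := by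
  rcases R with _ | ⟨a, _ | ⟨b, R⟩⟩
  · simp
  · simp
  · have h1 := h.1
    have h2 := h.2.length_head_pos hw
    simp only [List.flatten_cons, List.length_append] at hl
    omega

theorem runsAt_clog (l : List ℕ) : (runsAt le l (Nat.clog 2 l.length)).length ≤ 1 :=
  (runsAt_chunked le l _).length_le_one (by positivity)
    (by rw [runsAt_flatten_length]; exact Nat.le_pow_clog (by omega) _)

/-- At the start every position is a run of its own, so all ordered pairs are still pending. -/
theorem cross_singletons {q p : ℕ} (l : List ℕ) :
    cross q p (l.map fun x => [x]) = cnt q p l := by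
  induction l with
  | nil => rfl
  | cons a l ih =>
    have : (l.map fun x => [x]).flatten = l := by simp [← List.flatMap_def]
    rw [List.map_cons, cross, ih, cnt, this, List.count_singleton]
    by_cases h : a = q <;> simp [h]

theorem cntSum_append (q p : ℕ) (gs gs' : List (List ℕ)) :
    cntSum q p (gs ++ gs') = cntSum q p gs + cntSum q p gs' := by
  simp [cntSum]

/-- The conservation law `cross_pass` telescopes: pairs emitted so far plus pairs still pending are
constant. -/
theorem cntSum_emits (hle : Std.Total le) (htr : IsTrans ℕ le) {q p : ℕ} (hq : n ≤ q) (hp : p < n)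
    (l : List ℕ) (i : ℕ) :
    cntSum q p (emits n le l i) + (if le q p then cross q p (runsAt le l i) else 0) =
      if le q p then cnt q p l else 0 := by
  induction i with
  | zero => simp [emits, cntSum, runsAt, cross_singletons]
  | succ i ih =>
    rw [emits, cntSum_append, runsAt_succ, add_assoc,
      cross_pass n le htr hq hp (runsAt_sorted le hle htr l i), ih]

/-- After the last pass at most one run is left, so no pair is pending. -/
theorem cntSum_split (hle : Std.Total le) (htr : IsTrans ℕ le) {q p : ℕ} (hq : n ≤ q) (hp : p < n)
    (l : List ℕ) : cntSum q p (split n le l) = if le q p then cnt q p l else 0 := by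
  rw [← cntSum_emits n le hle htr hq hp l (Nat.clog 2 l.length)]
  have h1 := runsAt_clog le l
  have h2 : cross q p (runsAt le l (Nat.clog 2 l.length)) = 0 := by
    match hr : runsAt le l (Nat.clog 2 l.length) with
    | [] => rfl
    | [a] => simp [cross]
    | a :: b :: R => rw [hr] at h1; simp at h1
  simp [split, h2]

/-- Each merge emits one group and reduces the number of runs by one. This bounds the number of
groups, which their total size does not do because groups may be empty. -/
theorem emits_length_add (l : List ℕ) (i : ℕ) :
    (emits n le l i).length + (runsAt le l i).length = l.length := by
  induction i with
  | zero => simp [emits, runsAt]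
  | succ i ih =>
    rw [emits, List.length_append, runsAt_succ, add_assoc, passEm_length, ih]

theorem split_length_le (l : List ℕ) : (split n le l).length ≤ l.length := by
  have := emits_length_add n le l (Nat.clog 2 l.length)
  unfold split; omega

theorem emits_flatten_length (l : List ℕ) (i : ℕ) :
    (emits n le l i).flatten.length ≤ i * l.length := by
  induction i with
  | zero => simp [emits]
  | succ i ih =>
    rw [emits, List.flatten_append, List.length_append, Nat.succ_mul]
    exact Nat.add_le_add ih ((passEm_flatten_length n le _).trans (runsAt_flatten_length le l i).le)

theorem mem_of_mem_emits (l : List ℕ) (i : ℕ) {e : List ℕ} (he : e ∈ emits n le l i) {x : ℕ}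
    (hx : x ∈ e) : x ∈ l := by
  induction i with
  | zero => simp [emits] at he
  | succ i ih =>
    rcases List.mem_append.1 he with he | he
    · exact ih he
    · exact (runsAt_flatten_perm le l i).mem_iff.1 (passEm_mem n le he hx)

/-! ### The potential -/

/-- An integer version of the square root of `m`. -/
def rt (m : ℕ) : ℕ := 2 ^ ((Nat.clog 2 m + 1) / 2)

/-- The potential of a list of groups: the sum of `|g| * rt |g|`. -/
def pot (gs : List (List ℕ)) : ℕ := (gs.map fun g => g.length * rt g.length).sum

theorem pot_append (gs gs' : List (List ℕ)) : pot (gs ++ gs') = pot gs + pot gs' := by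
  simp [pot]

theorem rt_pos (m : ℕ) : 0 < rt m := by unfold rt; positivity

theorem rt_mono {m m' : ℕ} (h : m ≤ m') : rt m ≤ rt m' := by
  have := Nat.clog_mono_right 2 h
  exact Nat.pow_le_pow_right (by omega) (by omega)

theorem length_flatten_le_pot (gs : List (List ℕ)) : gs.flatten.length ≤ pot gs := by
  induction gs with
  | nil => simp [pot]
  | cons g gs ih =>
    have h1 : g.length ≤ g.length * rt g.length := Nat.le_mul_of_pos_right _ (rt_pos _)
    simp only [pot, List.flatten_cons, List.length_append, List.map_cons, List.sum_cons] at ih ⊢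
    omega

theorem pot_le {gs : List (List ℕ)} {m : ℕ} (h : ∀ g ∈ gs, g.length ≤ m) :
    pot gs ≤ gs.flatten.length * rt m := by
  induction gs with
  | nil => simp [pot]
  | cons g gs ih =>
    simp only [List.mem_cons, forall_eq_or_imp] at h
    have h1 : g.length * rt g.length ≤ g.length * rt m := Nat.mul_le_mul_left _ (rt_mono h.1)
    have h2 := ih h.2
    simp only [pot, List.flatten_cons, List.length_append, List.map_cons, List.sum_cons] at h2 ⊢
    rw [add_mul]; omega

/-- Pass `i` emits groups of length at most `2 ^ (i + 1)`, with at most `l.length` entries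
altogether. -/
theorem pot_passEm (l : List ℕ) (i : ℕ) :
    pot (passEm n le (runsAt le l i)) ≤ l.length * 2 ^ ((i + 2) / 2) := by
  have h1 : ∀ g ∈ passEm n le (runsAt le l i), g.length ≤ 2 ^ (i + 1) := fun g hg => by
    rw [pow_succ']; exact passEm_length_le n le (runsAt_chunked le l i) hg
  refine (pot_le h1).trans ?_
  have h2 : rt (2 ^ (i + 1)) = 2 ^ ((i + 2) / 2) := by rw [rt, Nat.clog_pow _ _ (by omega)]
  rw [h2]
  exact Nat.mul_le_mul_right _ ((passEm_flatten_length n le _).trans (runsAt_flatten_length le l i).le)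

/-- The passes contribute the factors 2, 2, 4, 4, 8, 8, …, each exponent twice because `rt` rounds
up to a power of two. Hence the separation by parity: 4·2^k after `2 * k` passes, and 2^(k+1) more
after the next one. -/
theorem pot_emits (l : List ℕ) (k : ℕ) :
    pot (emits n le l (2 * k)) ≤ l.length * (4 * 2 ^ k) ∧
      pot (emits n le l (2 * k + 1)) ≤ l.length * (6 * 2 ^ k) := by
  have h0 : ∀ k, pot (emits n le l (2 * k)) ≤ l.length * (4 * 2 ^ k) →
      pot (emits n le l (2 * k + 1)) ≤ l.length * (6 * 2 ^ k) := fun k hk => by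
    have h1 := pot_passEm n le l (2 * k)
    rw [show (2 * k + 2) / 2 = k + 1 by omega, pow_succ] at h1
    rw [emits, pot_append]
    nlinarith
  induction k with
  | zero => exact ⟨by simp [emits, pot], h0 0 (by simp [emits, pot])⟩
  | succ k ih =>
    have : pot (emits n le l (2 * (k + 1))) ≤ l.length * (4 * 2 ^ (k + 1)) := by
      have h1 := pot_passEm n le l (2 * k + 1)
      rw [show (2 * k + 1 + 2) / 2 = k + 1 by omega, pow_succ] at h1
      rw [show 2 * (k + 1) = 2 * k + 1 + 1 by ring, emits, pot_append, pow_succ]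
      nlinarith [ih.2]
    exact ⟨this, h0 _ this⟩

/-- For an even number `2 * k` of passes `rt` is `2 ^ k`; for `2 * k + 1` it is `2 ^ (k + 1)`, and
6·2^k is below 4·2^(k+1). -/
theorem pot_split (l : List ℕ) : pot (split n le l) ≤ 4 * (l.length * rt l.length) := by
  unfold split rt
  generalize Nat.clog 2 l.length = i
  rcases Nat.even_or_odd' i with ⟨k, rfl | rfl⟩
  · have := (pot_emits n le l k).1
    rw [show (2 * k + 1) / 2 = k by omega]; linarith
  · have := (pot_emits n le l k).2
    rw [show (2 * k + 1 + 1) / 2 = k + 1 by omega, pow_succ]; nlinarith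

/-- Split all groups. -/
def splitAll (gs : List (List ℕ)) : List (List ℕ) := gs.flatMap (split n le)

theorem splitAll_cons (g : List ℕ) (gs : List (List ℕ)) :
    splitAll n le (g :: gs) = split n le g ++ splitAll n le gs := by simp [splitAll]

theorem cntSum_splitAll (hle : Std.Total le) (htr : IsTrans ℕ le) {q p : ℕ} (hq : n ≤ q)
    (hp : p < n) (gs : List (List ℕ)) :
    cntSum q p (splitAll n le gs) = if le q p then cntSum q p gs else 0 := by
  induction gs with
  | nil => simp [splitAll, cntSum]
  | cons g gs ih =>
    rw [splitAll_cons, cntSum_append, ih, cntSum_split n le hle htr hq hp]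
    split_ifs <;> simp [cntSum]

theorem pot_splitAll (gs : List (List ℕ)) : pot (splitAll n le gs) ≤ 4 * pot gs := by
  induction gs with
  | nil => simp [splitAll, pot]
  | cons g gs ih =>
    have h1 := pot_split n le g
    have h2 : pot (g :: gs) = g.length * rt g.length + pot gs := by simp [pot]
    rw [splitAll_cons, pot_append, h2]
    omega

theorem splitAll_length_le (gs : List (List ℕ)) : (splitAll n le gs).length ≤ gs.flatten.length := by
  induction gs with
  | nil => simp [splitAll]
  | cons g gs ih =>
    have := split_length_le n le g
    rw [splitAll_cons, List.flatten_cons, List.length_append, List.length_append]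
    omega

theorem mem_of_mem_splitAll {gs : List (List ℕ)} {e : List ℕ} (he : e ∈ splitAll n le gs) {x : ℕ}
    (hx : x ∈ e) : x ∈ gs.flatten := by
  obtain ⟨g, hg, he⟩ := List.mem_flatMap.1 he
  exact List.mem_flatten.2 ⟨g, hg, mem_of_mem_emits n le g _ he hx⟩

/-! ### Counting the reported pairs -/

/-- Number of pairs of a red entry and an earlier blue entry; `b` is the number of blue entries read
so far. -/
def pairs : ℕ → List ℕ → ℕ
  | _, [] => 0
  | b, x :: l => if x < n then b + pairs b l else pairs (b + 1) l

theorem sum_count_eq_countP (l : List ℕ) :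
    ∑ p ∈ Finset.range n, l.count p = l.countP (· < n) := by
  induction l with
  | nil => simp
  | cons x l ih =>
    simp only [List.count_cons, Finset.sum_add_distrib, ih, List.countP_cons, beq_iff_eq,
      Finset.sum_ite_eq, Finset.mem_range, decide_eq_true_eq]

/-- The `b` blue entries read before pair up with every red entry of `l`. With `b = 0` this turns
the work of scanning a group into the pair counts controlled by `cntSum_splitAll`. -/
theorem pairs_eq (b : ℕ) {l : List ℕ} {N : ℕ} (hl : ∀ x ∈ l, x < N) :
    pairs n b l = b * l.countP (· < n) +
      ∑ q ∈ Finset.Ico n N, ∑ p ∈ Finset.range n, cnt q p l := by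
  induction l generalizing b with
  | nil => simp [pairs, cnt]
  | cons x l ih =>
    simp only [List.mem_cons, forall_eq_or_imp] at hl
    have key : ∑ q ∈ Finset.Ico n N, ∑ p ∈ Finset.range n, cnt q p (x :: l) =
        (if n ≤ x then l.countP (· < n) else 0) +
          ∑ q ∈ Finset.Ico n N, ∑ p ∈ Finset.range n, cnt q p l := by
      simp only [cnt, Finset.sum_add_distrib]
      congr 1
      rw [← sum_count_eq_countP]
      calc _ = ∑ q ∈ Finset.Ico n N, if x = q then ∑ p ∈ Finset.range n, l.count p else 0 :=
            Finset.sum_congr rfl fun q _ => by split_ifs <;> simp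
        _ = _ := by rw [Finset.sum_ite_eq]; simp [hl.1]
    rw [pairs, ih _ hl.2, ih _ hl.2, key, List.countP_cons]
    by_cases hx : x < n
    · simp [hx, Nat.not_le.2 hx]; ring
    · simp [hx, Nat.not_lt.1 hx]; ring

end Dominance

/-! ### Memory layout, lists in memory, comparison of keys, and the merge of two runs. -/

namespace Dominance

open RAM

/-! ## Memory layout -/

notation "vN" => 0
notation "vRes" => 1
notation "vFound" => 2
notation "vBest" => 3
notation "vD" => 4
notation "vPow" => 5
notation "vQ" => 6
notation "vNumQ" => 7
notation "vK₀" => 8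
notation "vBase" => 9
notation "vX" => 10
notation "vGroups" => 11
notation "vEnd" => 12
notation "vCur" => 13
notation "vC" => 14
notation "vK" => 15
notation "vGroupsEnd" => 16
notation "vA" => 17
notation "vB" => 18
notation "vW" => 19
notation "vLo" => 20
notation "vL" => 21
notation "vR" => 22
notation "vMid" => 23
notation "vHi" => 24
notation "vZ" => 25
notation "vFlag" => 26
notation "aTup" => 2
notation "aPts" => 3
notation "aStart" => 4
notation "aTmp" => 5
notation "aVP" => 6
notation "aVM" => 7
notation "aTie" => 8
notation "rP" => 1
notation "rM" => 2
notation "rBest" => 3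
-- Never written, so it keeps the zeros of the input and supplies the constant `0`, which real
-- expressions lack.
notation "rZero" => 4

/-! ## Lists in memory -/

/-- The cells from `lo` on hold the list. -/
def AtL (f : ℕ → ℕ) : ℕ → List ℕ → Prop
  | _, [] => True
  | lo, x :: l => f lo = x ∧ AtL f (lo + 1) l

theorem atL_append {f : ℕ → ℕ} {lo : ℕ} {l r : List ℕ} :
    AtL f lo (l ++ r) ↔ AtL f lo l ∧ AtL f (lo + l.length) r := by
  induction l generalizing lo with
  | nil => simp [AtL]
  | cons x l ih =>
    simp only [List.cons_append, AtL, ih, List.length_cons, and_assoc]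
    rw [show lo + (l.length + 1) = lo + 1 + l.length by ring]

theorem AtL.congr {f g : ℕ → ℕ} {lo : ℕ} {l : List ℕ} (h : AtL f lo l)
    (hfg : ∀ i, lo ≤ i → i < lo + l.length → g i = f i) : AtL g lo l := by
  induction l generalizing lo with
  | nil => trivial
  | cons x l ih =>
    simp only [List.length_cons] at hfg
    exact ⟨(hfg lo le_rfl (by omega)).trans h.1, ih h.2 fun i h1 h2 => hfg i (by omega) (by omega)⟩

theorem AtL.update {f : ℕ → ℕ} {lo i v : ℕ} {l : List ℕ} (h : AtL f lo l)
    (hi : i < lo ∨ lo + l.length ≤ i) : AtL (Function.update f i v) lo l :=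
  h.congr fun j _ _ => Function.update_of_ne (by omega) _ _

theorem AtL.snoc {f : ℕ → ℕ} {lo v : ℕ} {l : List ℕ} (h : AtL f lo l) :
    AtL (Function.update f (lo + l.length) v) lo (l ++ [v]) :=
  atL_append.2 ⟨h.update (Or.inr le_rfl), by simp [AtL]⟩

/-- The groups from number `g` on are the given ones: group `g` occupies the cells of `A` from `S g` up
to `S (g + 1)`. -/
def Groups (S A : ℕ → ℕ) : ℕ → List (List ℕ) → Prop
  | _, [] => True
  | g, l :: gs => S (g + 1) = S g + l.length ∧ AtL A (S g) l ∧ Groups S A (g + 1) gs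

theorem groups_append {S A : ℕ → ℕ} {g : ℕ} {gs gs' : List (List ℕ)} :
    Groups S A g (gs ++ gs') ↔ Groups S A g gs ∧ Groups S A (g + gs.length) gs' := by
  induction gs generalizing g with
  | nil => simp [Groups]
  | cons l gs ih =>
    simp only [List.cons_append, Groups, ih, List.length_cons, and_assoc]
    rw [show g + (gs.length + 1) = g + 1 + gs.length by ring]

theorem Groups.end_eq {S A : ℕ → ℕ} {g : ℕ} {gs : List (List ℕ)} (h : Groups S A g gs) :
    S (g + gs.length) = S g + gs.flatten.length := by
  induction gs generalizing g with
  | nil => simp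
  | cons l gs ih =>
    have := ih h.2.2
    rw [h.1] at this
    simp only [List.length_cons, List.flatten_cons, List.length_append]
    rw [show g + (gs.length + 1) = g + 1 + gs.length by ring, this]; ring

theorem Groups.congr {S S' A A' : ℕ → ℕ} {g : ℕ} {gs : List (List ℕ)} (h : Groups S A g gs)
    (hS : ∀ i, g ≤ i → i ≤ g + gs.length → S' i = S i)
    (hA : ∀ i, S g ≤ i → i < S g + gs.flatten.length → A' i = A i) : Groups S' A' g gs := by
  induction gs generalizing g with
  | nil => trivial
  | cons l gs ih =>
    simp only [List.length_cons, List.flatten_cons, List.length_append] at hS hA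
    have h1 := hS g le_rfl (by omega)
    have h2 := hS (g + 1) (by omega) (by omega)
    have h3 := h.1
    refine ⟨by rw [h2, h1, h.1], ?_, ih h.2.2 (fun i h1 h2 => hS i (by omega) (by omega))
      fun i h4 h5 => hA i (by omega) (by omega)⟩
    rw [h1]
    exact h.2.1.congr fun i h4 h5 => hA i h4 (by omega)

/-! ## Keys -/

/-- Keys of points: `(vM - vP, wP - wM, tie)`, compared lexicographically. -/
structure Keys where
  vP : ℕ → ℕ
  vM : ℕ → ℕ
  tie : ℕ → ℕ
  wP : ℕ → ℝ
  wM : ℕ → ℝ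

/-- Comparison of keys. -/
def Keys.le (K : Keys) (x y : ℕ) : Prop :=
  K.vM x + K.vP y < K.vM y + K.vP x ∨ K.vM x + K.vP y = K.vM y + K.vP x ∧
    K.wP x + K.wM y ≤ K.wP y + K.wM x ∧ (¬ K.wP y + K.wM x ≤ K.wP x + K.wM y ∨ K.tie x ≤ K.tie y)

open Classical in
noncomputable instance (K : Keys) : DecidableRel K.le := fun _ _ => inferInstance

/-- The key as an element of a linear order. -/
noncomputable def Keys.toLex (K : Keys) (x : ℕ) : ℤ ×ₗ ℝ ×ₗ ℕ :=
  _root_.toLex ((K.vM x : ℤ) - K.vP x, _root_.toLex (K.wP x - K.wM x, K.tie x))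

/-- `Keys.le` compares sums because the machine truncates differences of words and cannot subtract
reals. Moving terms across shows that it is a lexicographic order of differences, hence total and
transitive. -/
theorem Keys.le_iff (K : Keys) (x y : ℕ) : K.le x y ↔ K.toLex x ≤ K.toLex y := by
  have h1 : ((K.vM x : ℤ) - K.vP x < K.vM y - K.vP y) ↔ K.vM x + K.vP y < K.vM y + K.vP x := by
    omega
  have h2 : ((K.vM x : ℤ) - K.vP x = K.vM y - K.vP y) ↔ K.vM x + K.vP y = K.vM y + K.vP x := by
    omega
  simp only [Keys.toLex, Prod.Lex.le_iff, ofLex_toLex, h1, h2, Keys.le]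
  refine or_congr Iff.rfl (and_congr Iff.rfl ⟨?_, ?_⟩)
  · rintro ⟨h, h' | h'⟩
    · left; linarith
    · rcases h.lt_or_eq with h | h
      · left; linarith
      · right; exact ⟨by linarith, h'⟩
  · rintro (h | ⟨h, h'⟩)
    · exact ⟨by linarith, Or.inl (by linarith)⟩
    · exact ⟨by linarith, Or.inr h'⟩

theorem Keys.total (K : Keys) : Std.Total K.le :=
  ⟨fun x y => by simp only [K.le_iff]; exact le_total _ _⟩

theorem Keys.trans (K : Keys) : IsTrans ℕ K.le :=
  ⟨fun x y z h h' => by rw [K.le_iff] at *; exact h.trans h'⟩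

/-- The keys stored in memory. -/
def keys (s : State) : Keys := ⟨s.arr aVP, s.arr aVM, s.arr aTie, s.real rP, s.real rM⟩

/-- The program that compares keys. -/
def keyTest (x y : WExp) : Test :=
  let v := WExp.add (.arr aVM x) (.arr aVP y)
  let v' := WExp.add (.arr aVM y) (.arr aVP x)
  let w := RExp.add (.arr rP x) (.arr rM y)
  let w' := RExp.add (.arr rP y) (.arr rM x)
  -- The disjunctions of `Keys.le` by De Morgan, as tests offer only negation and conjunction.
  .not (.and (.not (.wlt v v')) (.not (.and (.weq v v')
    (.and (.rle w w') (.not (.and (.rle w' w) (.wlt (.arr aTie y) (.arr aTie x))))))))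

theorem keyTest_holds (s : State) (x y : WExp) :
    (keyTest x y).holds s ↔ (keys s).le (x.eval s) (y.eval s) := by
  simp only [keyTest, Test.holds, WExp.eval, RExp.eval, Keys.le, keys, ← not_lt (a := s.arr aTie _)]
  tauto

theorem keys_eq_of_frame {c : Prog} {s s' : State} (h : Frame c s s')
    (h6 : c.writesArr aVP = false) (h7 : c.writesArr aVM = false) (h8 : c.writesArr aTie = false)
    (h1 : c.writesReal rP = false) (h2 : c.writesReal rM = false) : keys s' = keys s := by
  rw [keys, keys, h.arr _ h6, h.arr _ h7, h.arr _ h8, h.real _ h1, h.real _ h2]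

/-! ## Merging -/

/-- Set the flag to `0` if the next point is to be taken from the left run, and to `1` otherwise. -/
def selectRun : Prog :=
  .seq (.setVar vFlag (.const 1))
    (.ite (.wlt (.var vL) (.var vMid))
      (.ite (.wlt (.var vR) (.var vHi))
        (.ite (keyTest (.arr aPts (.var vL)) (.arr aPts (.var vR))) (.setVar vFlag (.const 0)) .skip)
        (.setVar vFlag (.const 0)))
      .skip)

/-- Append the point in position `e` to the queue. -/
def emit (e : WExp) : Prog :=
  .seq (.setArr aPts (.var vEnd) (.arr aPts e)) (.setVar vEnd (.add (.var vEnd) (.const 1)))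

/-- Take the next point from the left run. -/
def takeLeft : Prog :=
  .seq (.setArr aTmp (.var vZ) (.arr aPts (.var vL)))
    (.seq (.ite (.wlt (.arr aPts (.var vL)) (.var vN)) .skip (emit (.var vL)))
      (.seq (.setVar vL (.add (.var vL) (.const 1))) (.setVar vZ (.add (.var vZ) (.const 1)))))

/-- Take the next point from the right run. -/
def takeRight : Prog :=
  .seq (.setArr aTmp (.var vZ) (.arr aPts (.var vR)))
    (.seq (.ite (.wlt (.arr aPts (.var vR)) (.var vN)) (emit (.var vR)) .skip)
      (.seq (.setVar vR (.add (.var vR) (.const 1))) (.setVar vZ (.add (.var vZ) (.const 1)))))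

/-- One step of a merge. -/
def mergeStep : Prog :=
  .seq selectRun (.ite (.weq (.var vFlag) (.const 0)) takeLeft takeRight)

/-- Merge two runs into the temporary array, emitting the new group. -/
def mergeLoop : Prog := .while (.wlt (.var vZ) (.var vHi)) mergeStep

/-- State of a merge: `l` and `r` are the parts of the two runs still to be merged. -/
structure MergeInv (K : Keys) (n lo mid hi e₀ : ℕ) (A₀ : ℕ → ℕ) (M EM l r : List ℕ) (s : State) :
    Prop where
  n_eq : s.var vN = n
  keys_eq : keys s = K
  mid_eq : s.var vMid = mid
  hi_eq : s.var vHi = hi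
  left : AtL (s.arr aPts) (s.var vL) l
  left_end : s.var vL + l.length = mid
  right : AtL (s.arr aPts) (s.var vR) r
  right_end : s.var vR + r.length = hi
  merged : ∃ dm, dm ++ mrg K.le l r = M ∧ AtL (s.arr aTmp) lo dm ∧ s.var vZ = lo + dm.length
  emitted : ∃ de, de ++ em n K.le l r = EM ∧ AtL (s.arr aPts) e₀ de ∧ s.var vEnd = e₀ + de.length
  low : ∀ i < e₀, s.arr aPts i = A₀ i

section Merge

variable {B : ℕ} {K : Keys} {n lo mid hi e₀ : ℕ} {A₀ : ℕ → ℕ} {M EM l r : List ℕ} {s : State}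

/-- The equations `h1` and `h2` cover both reasons for taking from the left, an exhausted right run
and `K.le a b`. Since the runs end before `e₀`, appending to the queue does not touch them. -/
theorem takeLeft_spec {a : ℕ} (hmid : mid ≤ hi) (hhi : hi ≤ e₀) (he : e₀ + EM.length < B)
    (hM : lo + M.length = hi) (h : MergeInv K n lo mid hi e₀ A₀ M EM (a :: l) r s)
    (h1 : mrg K.le (a :: l) r = a :: mrg K.le l r)
    (h2 : em n K.le (a :: l) r = (if n ≤ a then [a] else []) ++ em n K.le l r) :
    Runs B takeLeft s takeLeft.cost (MergeInv K n lo mid hi e₀ A₀ M EM l r) := by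
  refine Runs.of_bounded fun hs => Runs.of_wp ?_
  obtain ⟨dm, hdm, hT, hz⟩ := h.merged
  obtain ⟨de, hde, hE, hend⟩ := h.emitted
  have hle := h.left_end
  simp only [List.length_cons] at hle
  have hre := h.right_end
  have haB : s.arr aPts (s.var vL) < B := hs.arr _ _
  have ha : s.arr aPts (s.var vL) = a := h.left.1
  have hzM : dm.length + 1 ≤ M.length := by rw [← hdm, h1]; simp
  rw [h1] at hdm
  rw [h2] at hde
  simp only [takeLeft, emit, wp, Test.holds, WExp.eval, State.setArr_var, State.setArr_arr,
    State.setVar_var, h.n_eq, ha] at haB ⊢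
  simp only [Nat.reduceEqDiff, reduceIte, ha]
  refine ⟨haB, fun han => ?_, fun han => ?_⟩
  · rw [if_neg (by omega), List.nil_append] at hde
    refine ⟨by omega, by omega, ⟨?_, ?_, ?_, ?_, ?_, ?_, ?_, ?_, ⟨dm ++ [a], ?_, ?_, ?_⟩,
      ⟨de, hde, ?_, ?_⟩, ?_⟩⟩
    · simpa using h.n_eq
    · exact h.keys_eq
    · simpa using h.mid_eq
    · simpa using h.hi_eq
    · simpa using h.left.2
    · simp; omega
    · simpa using h.right
    · simpa using h.right_end
    · simpa using hdm
    · simpa [hz] using hT.snoc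
    · simp [hz]; omega
    · simpa using hE
    · simpa using hend
    · simpa using h.low
  · rw [if_pos (by omega), ← List.append_assoc] at hde
    have : de.length + 1 ≤ EM.length := by rw [← hde]; simp
    refine ⟨haB, by omega, by omega, by omega, ⟨?_, ?_, ?_, ?_, ?_, ?_, ?_, ?_, ⟨dm ++ [a], ?_, ?_, ?_⟩,
      ⟨de ++ [a], hde, ?_, ?_⟩, ?_⟩⟩
    · simpa using h.n_eq
    · exact h.keys_eq
    · simpa using h.mid_eq
    · simpa using h.hi_eq
    · simpa using h.left.2.update (by omega)
    · simp; omega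
    · simpa using h.right.update (by omega)
    · simpa using h.right_end
    · simpa using hdm
    · simpa [hz] using hT.snoc
    · simp [hz]; omega
    · simpa [hend] using hE.snoc
    · simp [hend]; omega
    · intro i hi'
      simp only [State.setVar_arr, State.setArr_arr, if_true]
      rw [Function.update_of_ne (by omega)]
      simpa using h.low i hi'

theorem takeRight_spec {b : ℕ} (hmid : mid ≤ hi) (hhi : hi ≤ e₀) (he : e₀ + EM.length < B)
    (hM : lo + M.length = hi) (h : MergeInv K n lo mid hi e₀ A₀ M EM l (b :: r) s)
    (h1 : mrg K.le l (b :: r) = b :: mrg K.le l r)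
    (h2 : em n K.le l (b :: r) = (if b < n then [b] else []) ++ em n K.le l r) :
    Runs B takeRight s takeRight.cost (MergeInv K n lo mid hi e₀ A₀ M EM l r) := by
  refine Runs.of_bounded fun hs => Runs.of_wp ?_
  obtain ⟨dm, hdm, hT, hz⟩ := h.merged
  obtain ⟨de, hde, hE, hend⟩ := h.emitted
  have hle := h.left_end
  have hre := h.right_end
  simp only [List.length_cons] at hre
  have haB : s.arr aPts (s.var vR) < B := hs.arr _ _
  have ha : s.arr aPts (s.var vR) = b := h.right.1
  have hzM : dm.length + 1 ≤ M.length := by rw [← hdm, h1]; simp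
  rw [h1] at hdm
  rw [h2] at hde
  simp only [takeRight, emit, wp, Test.holds, WExp.eval, State.setArr_var, State.setArr_arr,
    State.setVar_var, h.n_eq, ha] at haB ⊢
  simp only [Nat.reduceEqDiff, reduceIte, ha]
  refine ⟨haB, fun han => ?_, fun han => ?_⟩
  · rw [if_pos (by omega), ← List.append_assoc] at hde
    have : de.length + 1 ≤ EM.length := by rw [← hde]; simp
    refine ⟨haB, by omega, by omega, by omega, ⟨?_, ?_, ?_, ?_, ?_, ?_, ?_, ?_, ⟨dm ++ [b], ?_, ?_, ?_⟩,
      ⟨de ++ [b], hde, ?_, ?_⟩, ?_⟩⟩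
    · simpa using h.n_eq
    · exact h.keys_eq
    · simpa using h.mid_eq
    · simpa using h.hi_eq
    · simpa using h.left.update (by omega)
    · simpa using h.left_end
    · simpa using h.right.2.update (by omega)
    · simp; omega
    · simpa using hdm
    · simpa [hz] using hT.snoc
    · simp [hz]; omega
    · simpa [hend] using hE.snoc
    · simp [hend]; omega
    · intro i hi'
      simp only [State.setVar_arr, State.setArr_arr, if_true]
      rw [Function.update_of_ne (by omega)]
      simpa using h.low i hi'
  · rw [if_neg (by omega), List.nil_append] at hde
    refine ⟨by omega, by omega, ⟨?_, ?_, ?_, ?_, ?_, ?_, ?_, ?_, ⟨dm ++ [b], ?_, ?_, ?_⟩,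
      ⟨de, hde, ?_, ?_⟩, ?_⟩⟩
    · simpa using h.n_eq
    · exact h.keys_eq
    · simpa using h.mid_eq
    · simpa using h.hi_eq
    · simpa using h.left
    · simpa using h.left_end
    · simpa using h.right.2
    · simp; omega
    · simpa using hdm
    · simpa [hz] using hT.snoc
    · simp [hz]; omega
    · simpa using hE
    · simpa using hend
    · simpa using h.low

theorem MergeInv.setFlag (h : MergeInv K n lo mid hi e₀ A₀ M EM l r s) (v : ℕ) :
    MergeInv K n lo mid hi e₀ A₀ M EM l r (s.setVar vFlag v) := by
  obtain ⟨h1, h2, h3, h4, h5, h6, h7, h8, h9, h10, h11⟩ := h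
  constructor <;> simpa using ‹_›

/-- Does the next point come from the left run? -/
def fromLeft (K : Keys) : List ℕ → List ℕ → Prop
  | [], _ => False
  | _ :: _, [] => True
  | a :: _, b :: _ => K.le a b

theorem selectRun_spec (hB : 2 ≤ B) (h : MergeInv K n lo mid hi e₀ A₀ M EM l r s) :
    Runs B selectRun s selectRun.cost fun s' => MergeInv K n lo mid hi e₀ A₀ M EM l r s' ∧
      (s'.var vFlag = 0 ↔ fromLeft K l r) := by
  refine Runs.of_wp ?_
  have hle := h.left_end
  have hre := h.right_end
  have hk : (keyTest (.arr aPts (.var vL)) (.arr aPts (.var vR))).holds (s.setVar vFlag 1) ↔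
      K.le (s.arr aPts (s.var vL)) (s.arr aPts (s.var vR)) := by
    rw [keyTest_holds, ← h.keys_eq]; simp [WExp.eval, keys]
  simp only [selectRun, wp, Test.holds, WExp.eval, State.setVar_var, h.mid_eq, h.hi_eq, hk]
  simp only [Nat.reduceEqDiff, reduceIte]
  refine ⟨by omega, fun h1 => ⟨fun h2 => ⟨fun h3 => ⟨by omega, ?_, ?_⟩, fun h3 => ⟨?_, ?_⟩⟩,
    fun h2 => ⟨by omega, ?_, ?_⟩⟩, fun h1 => ⟨?_, ?_⟩⟩
  · exact (h.setFlag _).setFlag _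
  · rcases l with _ | ⟨a, l⟩
    · simp at hle; omega
    rcases r with _ | ⟨b, r⟩
    · simp at hre; omega
    rw [h.left.1, h.right.1] at h3
    simpa [fromLeft] using h3
  · exact h.setFlag _
  · rcases l with _ | ⟨a, l⟩
    · simp at hle; omega
    rcases r with _ | ⟨b, r⟩
    · simp at hre; omega
    rw [h.left.1, h.right.1] at h3
    simpa [fromLeft] using h3
  · exact (h.setFlag _).setFlag _
  · rcases l with _ | ⟨a, l⟩
    · simp at hle; omega
    rcases r with _ | ⟨b, r⟩
    · simp [fromLeft]
    · simp at hre; omega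
  · exact h.setFlag _
  · rcases l with _ | ⟨a, l⟩
    · simp [fromLeft]
    · simp at hle; omega

theorem mergeStep_spec (hB : 2 ≤ B) (hmid : mid ≤ hi) (hhi : hi ≤ e₀) (he : e₀ + EM.length < B)
    (hM : lo + M.length = hi) (h : MergeInv K n lo mid hi e₀ A₀ M EM l r s)
    (hne : 0 < l.length + r.length) :
    Runs B mergeStep s mergeStep.cost fun s' => ∃ l' r', MergeInv K n lo mid hi e₀ A₀ M EM l' r' s' ∧
      l'.length + r'.length + 1 = l.length + r.length := by
  refine (Runs.seq (selectRun_spec hB h) (t' := mergeStep.cost - selectRun.cost) ?_).mono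
    (by decide) fun _ _ h => h
  rintro s' - ⟨h', hflag⟩
  refine (Runs.ite (t := takeLeft.cost) (fun hc => ?_) fun hc => ?_).mono (by decide) fun _ _ h => h
  · replace hc : s'.var vFlag = 0 := hc
    rw [hflag] at hc
    rcases l with _ | ⟨a, l⟩
    · exact hc.elim
    refine (takeLeft_spec hmid hhi he hM h' ?_ ?_).mono le_rfl fun s'' _ h'' => ⟨l, r, h'', by simp; omega⟩
    · rcases r with _ | ⟨b, r⟩
      · simp [mrg_nil_right]
      · rw [mrg, if_pos (show K.le a b from hc)]
    · rcases r with _ | ⟨b, r⟩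
      · rw [em, em_nil_right, List.filter_cons]
        by_cases hna : n ≤ a <;> simp [hna]
      · rw [em, if_pos (show K.le a b from hc)]
  · replace hc : ¬ s'.var vFlag = 0 := hc
    rw [hflag] at hc
    rcases r with _ | ⟨b, r⟩
    · rcases l with _ | ⟨a, l⟩
      · simp at hne
      · simp [fromLeft] at hc
    refine (takeRight_spec hmid hhi he hM h' ?_ ?_).mono (by decide) fun s'' _ h'' => ⟨l, r, h'', by simp; omega⟩
    · rcases l with _ | ⟨a, l⟩
      · simp [mrg_nil_left]
      · rw [mrg, if_neg (show ¬ K.le a b from hc)]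
    · rcases l with _ | ⟨a, l⟩
      · rw [em, em, List.filter_cons]
        by_cases hna : b < n <;> simp [hna]
      · rw [em, if_neg (show ¬ K.le a b from hc)]

theorem mergeLoop_spec (hB : 2 ≤ B) (hmid : mid ≤ hi) (hhi : hi ≤ e₀) (he : e₀ + EM.length < B)
    (hM : lo + M.length = hi) (h : MergeInv K n lo mid hi e₀ A₀ M EM l r s) :
    Runs B mergeLoop s ((l.length + r.length) * (mergeStep.cost + 3) + 3)
      (MergeInv K n lo mid hi e₀ A₀ M EM [] []) := by
  refine Runs.while (fun s' τ => ∃ l r, MergeInv K n lo mid hi e₀ A₀ M EM l r s' ∧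
    τ = (l.length + r.length) * (mergeStep.cost + 3) + 3) ⟨l, r, h, rfl⟩ ?_ ?_
  all_goals rintro s' τ - ⟨l, r, h, rfl⟩ hb
  all_goals
    obtain ⟨dm, hdm, -, hz⟩ := h.merged
    have hlen : dm.length + (l.length + r.length) = M.length := by
      rw [← hdm, List.length_append, mrg_length]
    simp only [Test.holds, WExp.eval, h.hi_eq, hz] at hb
  · obtain ⟨k, hk⟩ : ∃ k, l.length + r.length = k + 1 := ⟨l.length + r.length - 1, by omega⟩
    refine ⟨mergeStep.cost, k * (mergeStep.cost + 3) + 3, ?_, ?_⟩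
    · rw [hk]; simp only [Test.cost, WExp.cost]; linarith
    · refine (mergeStep_spec hB hmid hhi he hM h (by omega)).mono le_rfl ?_
      rintro s'' - ⟨l', r', h', hlen'⟩
      exact ⟨l', r', h', by rw [show l'.length + r'.length = k by omega]⟩
  · obtain ⟨h1, h2⟩ : l.length = 0 ∧ r.length = 0 := by omega
    rw [List.length_eq_zero_iff] at h1 h2
    subst h1 h2
    exact ⟨by simp [Test.cost, WExp.cost], h⟩

end Merge

end Dominance

/-! ### Passes over a group, and the splitting of a group at the head of the queue. -/

namespace Dominance

open RAM

/-! ## Copying a run back -/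

/-- Copy the merged run from the temporary array. -/
def copyLoop : Prog :=
  .while (.wlt (.var vZ) (.var vHi))
    (.seq (.setArr aPts (.var vZ) (.arr aTmp (.var vZ)))
      (.setVar vZ (.add (.var vZ) (.const 1))))

theorem copyLoop_spec {B lo hi : ℕ} {M : List ℕ} {s : State} (hT : AtL (s.arr aTmp) lo M)
    (hz : s.var vZ = lo) (hhi : s.var vHi = hi) (hM : lo + M.length = hi) (hB : hi < B) :
    Runs B copyLoop s (M.length * 11 + 3) fun s' =>
      AtL (s'.arr aPts) lo M ∧ ∀ i, (i < lo ∨ hi ≤ i) → s'.arr aPts i = s.arr aPts i := by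
  refine Runs.while (fun s' τ => ∃ dm rm, dm ++ rm = M ∧ s'.var vZ = lo + dm.length ∧
    τ = rm.length * 11 + 3 ∧ AtL (s'.arr aTmp) (lo + dm.length) rm ∧ AtL (s'.arr aPts) lo dm ∧
      ∀ i, (i < lo ∨ hi ≤ i) → s'.arr aPts i = s.arr aPts i)
    ⟨[], M, rfl, by simpa using hz, rfl, by simpa using hT, trivial, fun _ _ => rfl⟩ ?_ ?_
  all_goals
    rintro s' τ hF ⟨dm, rm, hdm, hz', rfl, hT', hA', hout⟩ hb
    have hhi' : s'.var vHi = hi := (hF.var vHi rfl).trans hhi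
    have hlen : dm.length + rm.length = M.length := by rw [← hdm]; simp
    simp only [Test.holds, WExp.eval, hz', hhi'] at hb
  · rcases rm with _ | ⟨x, rm⟩
    · simp at hlen; omega
    simp only [List.length_cons] at hlen
    refine ⟨8, rm.length * 11 + 3, ?_, Runs.of_bounded fun hs =>
      (Runs.of_wp ?_).mono (by decide) fun _ _ h => h⟩
    · simp only [Test.cost, WExp.cost, List.length_cons]; omega
    · have hx : s'.arr aTmp (lo + dm.length) = x := hT'.1
      have hxB : s'.arr aTmp (lo + dm.length) < B := hs.arr _ _
      simp only [wp, WExp.eval, hz', State.setArr_var]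
      refine ⟨hxB, by omega, dm ++ [x], rm, by simpa using hdm, by simp; omega, rfl, ?_, ?_, ?_⟩
      · simpa [add_assoc] using hT'.2
      · simpa [hx] using hA'.snoc
      · intro i hi'
        simp only [State.setVar_arr, State.setArr_arr, if_true]
        rw [Function.update_of_ne (by omega)]
        exact hout i hi'
  · have : rm = [] := List.length_eq_zero_iff.1 (by omega)
    subst this
    rw [List.append_nil] at hdm
    subst hdm
    exact ⟨by simp [Test.cost, WExp.cost], hA', hout⟩

/-! ## Merging neighbouring runs -/

/-- Set up the pointers for a merge. -/
def mergeInit : Prog :=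
  .seq (.setVar vL (.var vLo)) (.seq (.setVar vMid (.add (.var vLo) (.var vW)))
    (.seq (.setVar vR (.var vMid))
      -- Truncated subtraction makes this the minimum of `vB` and `vLo + 2 * vW`.
      (.seq (.setVar vHi (.sub (.var vB)
        (.sub (.var vB) (.add (.var vLo) (.add (.var vW) (.var vW))))))
      (.setVar vZ (.var vLo)))))

/-- Close the emitted group. -/
def mergeDone : Prog :=
  .seq (.setVar vGroups (.add (.var vGroups) (.const 1)))
    (.seq (.setArr aStart (.var vGroups) (.var vEnd)) (.setVar vLo (.var vHi)))

/-- Merge two neighbouring runs. -/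
def mergeRuns : Prog :=
  .seq mergeInit (.seq mergeLoop (.seq (.setVar vZ (.var vLo)) (.seq copyLoop mergeDone)))

/-- State of a pass over the group number `g` in the cells from `a` up to `b`, with runs of
length `w`: the runs `done` are ready, the runs `rest` are not; `pend` are the groups waiting. -/
structure PassInv (K : Keys) (n a b w g : ℕ) (done rest pend : List (List ℕ)) (s : State) :
    Prop where
  n_eq : s.var vN = n
  keys_eq : keys s = K
  b_eq : s.var vB = b
  w_eq : s.var vW = w
  done_mem : AtL (s.arr aPts) a done.flatten
  lo_eq : s.var vLo = a + done.flatten.length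
  rest_mem : AtL (s.arr aPts) (s.var vLo) rest.flatten
  rest_end : s.var vLo + rest.flatten.length = b
  pend_mem : Groups (s.arr aStart) (s.arr aPts) (g + 1) pend
  start_eq : s.arr aStart (g + 1) = b
  groups_eq : s.var vGroups = g + 1 + pend.length
  end_eq : s.var vEnd = b + pend.flatten.length

theorem mergeRuns_spec {B n a b w g : ℕ} {K : Keys} {done rest pend : List (List ℕ)}
    {x y : List ℕ} {s : State} (hw : 0 < w) (hx : x.length = w) (hy : y.length ≤ w)
    (hy' : y.length = w ∨ rest = [])
    (hE : b + pend.flatten.length + (em n K.le x y).length < B) (hG : g + pend.length + 2 < B)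
    (h : PassInv K n a b w g done (x :: y :: rest) pend s) :
    Runs B mergeRuns s ((x.length + y.length) * (mergeStep.cost + 14) + 60)
      (PassInv K n a b w g (done ++ [mrg K.le x y]) rest (pend ++ [em n K.le x y])) := by
  refine Runs.of_bounded fun hs => ?_
  have hlo := h.lo_eq
  have hrest := h.rest_end
  have hmem := h.rest_mem
  have hend := h.end_eq
  simp only [List.flatten_cons, List.length_append] at hrest
  rw [List.flatten_cons, List.flatten_cons, atL_append, atL_append] at hmem
  generalize hloeq : s.var vLo = lo at *
  -- Only the last run may be short, and then the minimum is the end `b` of the group.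
  have hhi : b - (b - (lo + (w + w))) = lo + w + y.length := by
    rcases hy' with hy' | rfl
    · omega
    · simp at hrest; omega
  have h1 : Runs B mergeInit s mergeInit.cost fun s' =>
      MergeInv K n lo (lo + w) (lo + w + y.length) (b + pend.flatten.length) (s.arr aPts)
        (mrg K.le x y) (em n K.le x y) x y s' ∧ s'.var vLo = lo := by
    refine Runs.of_wp ?_
    simp only [mergeInit, wp, WExp.eval, State.setVar_var, Nat.reduceEqDiff, reduceIte, hloeq, h.w_eq,
      h.b_eq, hhi]
    refine ⟨by omega, by omega, by omega, by omega, by omega,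
      ⟨?_, ?_, ?_, ?_, ?_, ?_, ?_, ?_, ⟨[], rfl, trivial, ?_⟩, ⟨[], rfl, trivial, ?_⟩, ?_⟩, ?_⟩
    · simpa using h.n_eq
    · exact h.keys_eq
    · simp
    · simp
    · simpa using hmem.1
    · simp [hx]
    · simpa [hx] using hmem.2.1
    · simp
    · simp
    · simpa using hend
    · simp
    · simp
  refine (h1.seq (t' := (x.length + y.length) * (mergeStep.cost + 14) + 30) ?_).mono
    (by have : mergeInit.cost ≤ 30 := by decide
        omega) fun _ _ h => h
  rintro s₁ hF₁ ⟨hinv, hlo₁⟩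
  have h2 := mergeLoop_spec hs.two_le (by omega) (by omega) hE
    (by rw [mrg_length]; omega) hinv
  refine (h2.seq (t' := (x.length + y.length) * 11 + 27) ?_).mono (by ring_nf; omega) fun _ _ h => h
  intro s₂ hF₂ hinv₂
  have hlo₂ : s₂.var vLo = lo := (hF₂.var vLo rfl).trans hlo₁
  obtain ⟨dm, hdm, hT, -⟩ := hinv₂.merged
  obtain ⟨de, hde, hEm, hEnd⟩ := hinv₂.emitted
  have hlow := hinv₂.low
  simp only [mrg, List.append_nil] at hdm
  have : em n K.le [] [] = [] := by simp [em]
  rw [this, List.append_nil] at hde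
  subst hdm hde
  have h3 : Runs B (.setVar vZ (.var vLo)) s₂ 2 fun s' => s' = s₂.setVar vZ lo :=
    Runs.of_wp (c := .setVar vZ (.var vLo)) ⟨by simp only [WExp.eval, hlo₂]; omega, by simp only [WExp.eval, hlo₂]⟩
  refine (h3.seq (t' := (x.length + y.length) * 11 + 25) ?_).mono (by omega) fun _ _ h => h
  rintro s₃ hF₃ rfl
  have h4 := copyLoop_spec (B := B) (s := s₂.setVar vZ lo) (lo := lo) (hi := lo + w + y.length)
    (M := mrg K.le x y) (by simpa using hT) (by simp) (by simpa using hinv₂.hi_eq)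
    (by rw [mrg_length]; omega) (by omega)
  rw [mrg_length] at h4
  refine (h4.seq (t' := 22) ?_).mono (by omega) fun _ _ h => h
  rintro s₄ hF₄ ⟨hM, hout⟩
  have hlo₄ : s₄.var vHi = lo + w + y.length := (hF₄.var vHi rfl).trans (by simpa using hinv₂.hi_eq)
  have hgr : s₄.var vGroups = s.var vGroups :=
    (hF₄.var vGroups rfl).trans (((hF₂.var vGroups rfl).trans (hF₁.var vGroups rfl)))
  have hEnd₄ : s₄.var vEnd = b + pend.flatten.length + (em n K.le x y).length :=
    (hF₄.var vEnd rfl).trans (by simpa using hEnd)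
  have hst : s₄.arr aStart = s.arr aStart :=
    (hF₄.arr aStart rfl).trans (((hF₂.arr aStart rfl).trans (hF₁.arr aStart rfl)))
  have hout' : ∀ i, (i < lo ∨ lo + w + y.length ≤ i) → i < b + pend.flatten.length →
      s₄.arr aPts i = s.arr aPts i := fun i hi hi' => (hout i hi).trans (hlow i hi')
  have hge : (em n K.le x y).length ≤ (em n K.le x y).length := le_rfl
  have hpe := h.pend_mem.end_eq
  rw [h.start_eq] at hpe
  refine (Runs.of_wp ?_).mono (by decide) fun _ _ h => h
  simp only [mergeDone, wp, WExp.eval, State.setVar_var, State.setArr_var, Nat.reduceEqDiff, reduceIte,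
    hgr, h.groups_eq, hlo₄, hEnd₄]
  refine ⟨by omega, by omega, by omega, ⟨?_, ?_, ?_, ?_, ?_, ?_, ?_, ?_, ?_, ?_, ?_, ?_⟩⟩
  · simpa [hF₄.var vN rfl] using hinv₂.n_eq
  · refine Eq.trans (Eq.trans ?_ (keys_eq_of_frame hF₄ rfl rfl rfl rfl rfl)) hinv₂.keys_eq
    simp [keys]
  · simpa [hF₄.var vB rfl, hF₂.var vB rfl, hF₁.var vB rfl] using h.b_eq
  · simpa [hF₄.var vW rfl, hF₂.var vW rfl, hF₁.var vW rfl] using h.w_eq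
  · simp only [List.flatten_append, State.setVar_arr, State.setArr_arr, Nat.reduceEqDiff, reduceIte,
      List.flatten_singleton]
    rw [atL_append, ← hlo]
    exact ⟨h.done_mem.congr fun i _ hi => hout' i (by omega) (by omega), hM⟩
  · simp [mrg_length, -List.length_flatten]; omega
  · simp only [State.setVar_arr, State.setArr_arr, State.setVar_var, Nat.reduceEqDiff, reduceIte]
    rw [← hx]
    refine (hmem.2.2.congr fun i _ hi => ?_)
    exact hout' i (by omega) (by omega)
  · simp [-List.length_flatten]; omega
  · simp only [State.setVar_arr, State.setArr_arr, Nat.reduceEqDiff, reduceIte]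
    rw [groups_append]
    refine ⟨h.pend_mem.congr (fun i _ hi => ?_) fun i hi hi' => ?_, ?_, ?_, trivial⟩
    · rw [Function.update_of_ne (by omega), hst]
    · rw [h.start_eq] at hi hi'
      exact hout' i (by omega) (by omega)
    · rw [Function.update_self, Function.update_of_ne (by omega), hst, hpe]
    -- Copying back changes only cells below the end of the current group, so the freshly emitted
    -- group survives.
    · rw [Function.update_of_ne (by omega), hst, hpe]
      refine hEm.congr fun i hi _ => ?_
      simpa using hout i (by omega)
  · simp only [State.setVar_arr, State.setArr_arr, reduceIte]
    rw [Function.update_of_ne (by omega), hst, h.start_eq]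
  · simp; omega
  · simp [hEnd₄]; ring

/-! ## A pass over a group -/

/-- Merge neighbouring runs of a group. -/
def passLoop : Prog := .while (.wlt (.add (.var vLo) (.var vW)) (.var vB)) mergeRuns

/-- State between two passes over the group number `g` in the cells from `a` up to `b`. -/
structure GroupInv (K : Keys) (n a b w g : ℕ) (runs pend : List (List ℕ)) (s : State) : Prop where
  n_eq : s.var vN = n
  keys_eq : keys s = K
  b_eq : s.var vB = b
  w_eq : s.var vW = w
  mem : AtL (s.arr aPts) a runs.flatten
  mem_end : a + runs.flatten.length = b
  pend_mem : Groups (s.arr aStart) (s.arr aPts) (g + 1) pend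
  start_eq : s.arr aStart (g + 1) = b
  groups_eq : s.var vGroups = g + 1 + pend.length
  end_eq : s.var vEnd = b + pend.flatten.length

theorem PassInv.groupInv {K : Keys} {n a b w g : ℕ} {done rest pend : List (List ℕ)} {s : State}
    (h : PassInv K n a b w g done rest pend s) : GroupInv K n a b w g (done ++ rest) pend s := by
  have h1 := h.lo_eq
  have h2 := h.rest_end
  have h3 := h.rest_mem
  rw [h1] at h3
  exact ⟨h.n_eq, h.keys_eq, h.b_eq, h.w_eq, by rw [List.flatten_append, atL_append]; exact ⟨h.done_mem, h3⟩,
    by rw [List.flatten_append, List.length_append]; omega, h.pend_mem, h.start_eq, h.groups_eq, h.end_eq⟩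

theorem passLoop_spec {B n a b w g : ℕ} {K : Keys} {done rest pend : List (List ℕ)} {s : State}
    (hw : 0 < w) (hch : Chunked w rest)
    (hE : b + pend.flatten.length + (passEm n K.le rest).flatten.length < B)
    (hG : g + pend.length + (passEm n K.le rest).length + 1 < B)
    (h : PassInv K n a b w g done rest pend s) :
    Runs B passLoop s (rest.flatten.length * (mergeStep.cost + 80) + 5)
      (GroupInv K n a b w g (done ++ passRuns K.le rest) (pend ++ passEm n K.le rest)) := by
  refine Runs.while (fun s' τ => ∃ done' rest' pend', PassInv K n a b w g done' rest' pend' s' ∧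
    Chunked w rest' ∧ done' ++ passRuns K.le rest' = done ++ passRuns K.le rest ∧
    pend' ++ passEm n K.le rest' = pend ++ passEm n K.le rest ∧
    τ = rest'.flatten.length * (mergeStep.cost + 80) + 5)
    ⟨done, rest, pend, h, hch, rfl, rfl, rfl⟩ ?_ ?_
  all_goals
    rintro s' τ - ⟨done', rest', pend', h', hch', hd', hp', rfl⟩ hb
    have hend := h'.rest_end
    simp only [Test.holds, WExp.eval, h'.w_eq, h'.b_eq] at hb
  · rcases rest' with _ | ⟨x, _ | ⟨y, rest'⟩⟩
    · simp at hend; omega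
    · have := hch'.2
      simp at hend; omega
    simp only [passEm, passRuns] at hd' hp'
    have hx : x.length = w := hch'.1
    have hy : y.length ≤ w := hch'.2.length_head_le
    have hy' : y.length = w ∨ rest' = [] := by
      rcases rest' with _ | ⟨z, rest'⟩
      · exact Or.inr rfl
      · exact Or.inl hch'.2.1
    have hE' := congrArg (fun L => L.flatten.length) hp'
    have hG' := congrArg List.length hp'
    simp only [List.flatten_append, List.flatten_cons, List.length_append, List.length_cons] at hE' hG'
    refine ⟨(x.length + y.length) * (mergeStep.cost + 14) + 60,
      rest'.flatten.length * (mergeStep.cost + 80) + 5, ?_, ?_⟩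
    -- The fixed overhead, `60` for the merge and `5` for the test, is charged to the entries of the
    -- two runs, of which there is at least one.
    · have : 1 ≤ x.length + y.length := by omega
      simp only [Test.cost, WExp.cost, List.flatten_cons, List.length_append]
      nlinarith
    · refine (mergeRuns_spec hw hx hy hy' (by omega) (by omega) h').mono le_rfl fun s'' _ h'' => ?_
      exact ⟨_, rest', _, h'', hch'.tail.tail, by simpa using hd', by simpa using hp', rfl⟩
  · refine ⟨by simp [Test.cost, WExp.cost], ?_⟩
    have hr : passRuns K.le rest' = rest' ∧ passEm n K.le rest' = [] := by
      rcases rest' with _ | ⟨x, _ | ⟨y, rest'⟩⟩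
      · simp [passRuns, passEm]
      · simp [passRuns, passEm]
      · have h1 := hch'.1
        have h2 := hch'.2.length_head_pos hw
        simp at hend; omega
    rw [hr.1] at hd'
    rw [hr.2, List.append_nil] at hp'
    rw [← hd', ← hp']
    exact h'.groupInv

/-! ## Splitting a group -/

/-- One pass over the current group. -/
def passProg : Prog :=
  .seq (.setVar vLo (.var vA)) (.seq passLoop (.setVar vW (.add (.var vW) (.var vW))))

/-- Split and sort the current group. -/
def groupProg : Prog :=
  .seq (.seq (.setVar vA (.arr aStart (.var vCur)))
    (.seq (.setVar vB (.arr aStart (.add (.var vCur) (.const 1)))) (.setVar vW (.const 1))))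
    (.seq (.while (.wlt (.add (.var vA) (.var vW)) (.var vB)) passProg)
      (.setVar vCur (.add (.var vCur) (.const 1))))

theorem passProg_spec {B n a b w g : ℕ} {K : Keys} {runs pend : List (List ℕ)} {s : State}
    (hw : 0 < w) (hch : Chunked w runs) (hA : s.var vA = a) (hwB : 2 * w < B)
    (hE : b + pend.flatten.length + (passEm n K.le runs).flatten.length < B)
    (hG : g + pend.length + (passEm n K.le runs).length + 1 < B)
    (h : GroupInv K n a b w g runs pend s) :
    Runs B passProg s (runs.flatten.length * (mergeStep.cost + 80) + 11)
      (GroupInv K n a b (2 * w) g (passRuns K.le runs) (pend ++ passEm n K.le runs)) := by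
  have hend := h.mem_end
  have h1 : Runs B (.setVar vLo (.var vA)) s 2 (PassInv K n a b w g [] runs pend) := by
    refine Runs.of_wp (c := .setVar vLo (.var vA)) ?_
    simp only [wp, WExp.eval, hA]
    refine ⟨by omega, ?_, h.keys_eq, ?_, ?_, trivial, ?_, ?_, ?_, ?_, ?_, ?_, ?_⟩
    · simpa using h.n_eq
    · simpa using h.b_eq
    · simpa using h.w_eq
    · simp
    · simpa using h.mem
    · simpa [-List.length_flatten] using h.mem_end
    · simpa using h.pend_mem
    · simpa using h.start_eq
    · simpa using h.groups_eq
    · simpa using h.end_eq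
  refine (h1.seq (t' := runs.flatten.length * (mergeStep.cost + 80) + 9) ?_).mono (by omega)
    fun _ _ h => h
  intro s₁ _ hs₁
  refine ((passLoop_spec hw hch hE hG hs₁).seq (t' := 4) ?_).mono (by omega) fun _ _ h => h
  intro s₂ _ h₂
  refine Runs.of_wp (c := .setVar vW (.add (.var vW) (.var vW))) ?_
  simp only [wp, WExp.eval, h₂.w_eq, ← two_mul]
  refine ⟨hwB, ?_, h₂.keys_eq, ?_, ?_, ?_, ?_, ?_, ?_, ?_, ?_⟩
  · simpa using h₂.n_eq
  · simpa using h₂.b_eq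
  · simp
  · simpa using h₂.mem
  · simpa [-List.length_flatten] using h₂.mem_end
  · simpa using h₂.pend_mem
  · simpa using h₂.start_eq
  · simpa using h₂.groups_eq
  · simpa using h₂.end_eq

/-- Memory between the processing of two groups: `gs` are the groups waiting from number `g` on. -/
structure QueueInv (K : Keys) (n g : ℕ) (gs : List (List ℕ)) (s : State) : Prop where
  n_eq : s.var vN = n
  keys_eq : keys s = K
  cur_eq : s.var vCur = g
  mem : Groups (s.arr aStart) (s.arr aPts) g gs
  groups_eq : s.var vGroups = g + gs.length
  end_eq : s.var vEnd = s.arr aStart g + gs.flatten.length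

/-- Cost of sorting per entry and pass. -/
def sortCost : ℕ := mergeStep.cost + 120

/-- Bounds the memory used after any pass by that used after the last one. -/
theorem emits_length_mono (n : ℕ) (le : ℕ → ℕ → Prop) [DecidableRel le] (l : List ℕ) {i j : ℕ}
    (h : i ≤ j) : (emits n le l i).length ≤ (emits n le l j).length ∧
      (emits n le l i).flatten.length ≤ (emits n le l j).flatten.length := by
  induction j, h using Nat.le_induction with
  | base => simp
  | succ j _ ih =>
    simp only [emits, List.length_append, List.flatten_append]
    omega

/-- There are `Nat.clog 2 l.length` passes, each linear in `l.length`. The summand `l.length` in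
`hE` keeps the doubled run length in range: a pass starts only with `w < l.length`, so `2 * w` is
below `vEnd + l.length`. -/
theorem groupProg_spec {B n g : ℕ} {K : Keys} {l : List ℕ} {gs : List (List ℕ)} {s : State}
    (hE : s.var vEnd + (split n K.le l).flatten.length + l.length < B)
    (hG : g + gs.length + l.length + 1 < B)
    (h : QueueInv K n g (l :: gs) s) :
    Runs B groupProg s (Nat.clog 2 l.length * (l.length * sortCost) + sortCost) fun s' =>
      QueueInv K n (g + 1) (gs ++ split n K.le l) s' ∧
        s'.var vEnd = s.var vEnd + (split n K.le l).flatten.length := by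
  obtain ⟨hS, hl, hgs⟩ := h.mem
  have hend := h.end_eq
  have hgr := h.groups_eq
  simp only [List.flatten_cons, List.length_append, List.length_cons] at hend hgr
  generalize ha : s.arr aStart g = a at *
  have h1 : Runs B (.seq (.setVar vA (.arr aStart (.var vCur)))
      (.seq (.setVar vB (.arr aStart (.add (.var vCur) (.const 1)))) (.setVar vW (.const 1)))) s 15
      fun s' => GroupInv K n a (a + l.length) (2 ^ 0) g (runsAt K.le l 0) (gs ++ emits n K.le l 0) s' ∧
        s'.var vA = a := by
    refine (Runs.of_wp (c := .seq _ (.seq _ _)) ?_).mono (by decide) fun _ _ h => h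
    simp only [wp, WExp.eval, State.setVar_var, State.setVar_arr, Nat.reduceEqDiff, reduceIte, h.cur_eq,
      ha, hS]
    refine ⟨by omega, by omega, by omega, ⟨?_, h.keys_eq, ?_, ?_, ?_, ?_, ?_, ?_, ?_, ?_⟩, ?_⟩
    · simpa using h.n_eq
    · simp
    · simp
    · simpa [runsAt, ← List.flatMap_def] using hl
    · rw [runsAt_flatten_length]
    · simpa [emits] using hgs
    · simpa using hS
    · simp [emits]; omega
    · simp [emits, -List.length_flatten]; omega
    · simp
  refine (h1.seq (t' := Nat.clog 2 l.length * (l.length * sortCost) + 20) ?_).mono ?_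
    fun _ _ h => h
  swap
  · have : sortCost = mergeStep.cost + 120 := rfl
    omega
  rintro s₁ hF₁ ⟨h₁, hA₁⟩
  have hcur₁ : s₁.var vCur = g := (hF₁.var vCur rfl).trans h.cur_eq
  have h2 : Runs B (.while (.wlt (.add (.var vA) (.var vW)) (.var vB)) passProg) s₁
      (Nat.clog 2 l.length * (l.length * sortCost) + 5)
      (GroupInv K n a (a + l.length) (2 ^ Nat.clog 2 l.length) g
        (runsAt K.le l (Nat.clog 2 l.length)) (gs ++ split n K.le l)) := by
    refine Runs.while (fun s' τ => ∃ i ≤ Nat.clog 2 l.length,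
      GroupInv K n a (a + l.length) (2 ^ i) g (runsAt K.le l i) (gs ++ emits n K.le l i) s' ∧
      τ = (Nat.clog 2 l.length - i) * (l.length * sortCost) + 5)
      ⟨0, by omega, h₁, by simp⟩ ?_ ?_
    all_goals
      rintro s' τ hF' ⟨i, hi, h', rfl⟩ hb
      have hA' : s'.var vA = a := (hF'.var vA rfl).trans hA₁
      simp only [Test.holds, WExp.eval, hA', h'.w_eq, h'.b_eq, Nat.add_lt_add_iff_left] at hb
    · have hi' : i < Nat.clog 2 l.length := (Nat.lt_clog_iff_pow_lt (by omega)).2 hb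
      have hm := emits_length_mono n K.le l (show i + 1 ≤ Nat.clog 2 l.length from hi')
      have hsl := split_length_le n K.le l
      have hfl := h'.end_eq
      rw [split] at hE hsl
      simp only [emits, List.flatten_append, List.length_append] at hm
      have hpos : 0 < l.length := by have := Nat.one_le_two_pow (n := i); omega
      refine ⟨l.length * (mergeStep.cost + 80) + 11,
        (Nat.clog 2 l.length - (i + 1)) * (l.length * sortCost) + 5, ?_, ?_⟩
      · obtain ⟨k, hk⟩ : ∃ k, Nat.clog 2 l.length = i + 1 + k := ⟨_, (Nat.add_sub_of_le hi').symm⟩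
        rw [hk, show i + 1 + k - i = k + 1 by omega, show i + 1 + k - (i + 1) = k by omega]
        simp only [Test.cost, WExp.cost, sortCost]
        nlinarith
      · have h3 := passProg_spec (by positivity) (runsAt_chunked K.le l i) hA' (B := B) (by omega)
          (by simp only [List.flatten_append, List.length_append]; omega)
          (by simp only [List.length_append]; omega) h'
        rw [runsAt_flatten_length] at h3
        refine h3.mono le_rfl fun s'' _ h'' => ⟨i + 1, hi', ?_, rfl⟩
        rw [pow_succ', runsAt_succ, emits, ← List.append_assoc]
        exact h''
    · refine ⟨by simp [Test.cost, WExp.cost], ?_⟩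
      have : Nat.clog 2 l.length ≤ i := (Nat.clog_le_iff_le_pow (by omega)).2 (by omega)
      obtain rfl : i = Nat.clog 2 l.length := by omega
      exact h'
  refine (h2.seq (t' := 4) ?_).mono (by omega) fun _ _ h => h
  intro s₂ hF₂ h₂
  have hcur₂ : s₂.var vCur = g := (hF₂.var vCur rfl).trans hcur₁
  refine Runs.of_wp (c := .setVar vCur (.add (.var vCur) (.const 1))) ?_
  simp only [wp, WExp.eval, hcur₂]
  refine ⟨by omega, ⟨?_, h₂.keys_eq, ?_, ?_, ?_, ?_⟩, ?_⟩
  · simpa using h₂.n_eq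
  · simp
  · simpa using h₂.pend_mem
  · simpa using h₂.groups_eq
  · have := h₂.start_eq
    simp only [State.setVar_var, State.setVar_arr, Nat.reduceEqDiff, reduceIte, this, h₂.end_eq]
  · have := h₂.end_eq
    simp only [List.flatten_append, List.length_append] at this
    simp [-List.length_flatten]; omega

end Dominance

/-! ### Rounds over all groups, and violations and weights of tuples as separable sums. -/

namespace Dominance

open RAM

/-! ## A round: splitting all waiting groups by one key -/

/-- Split all groups up to number `vGroupsEnd`. -/
def roundLoop : Prog := .while (.wlt (.var vCur) (.var vGroupsEnd)) groupProg

theorem split_flatten_length (n : ℕ) (le : ℕ → ℕ → Prop) [DecidableRel le] (l : List ℕ) :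
    (split n le l).flatten.length ≤ Nat.clog 2 l.length * l.length :=
  emits_flatten_length n le l _

/-- `L` bounds the number of passes per group. Emitted groups are queued behind `vGroupsEnd`, so
each group is split once by the current key. In the invariant, `rest` are the groups still to be
split and `es` those emitted so far. -/
theorem roundLoop_spec {B n g L : ℕ} {K : Keys} {gs : List (List ℕ)} {s : State}
    (hL : ∀ l ∈ gs, Nat.clog 2 l.length ≤ L)
    (hE : s.var vEnd + gs.flatten.length * (L + 1) < B)
    (hG : g + gs.length + gs.flatten.length + 1 < B)
    (hge : s.var vGroupsEnd = g + gs.length) (h : QueueInv K n g gs s) :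
    Runs B roundLoop s (gs.flatten.length * (L * sortCost) + gs.length * (sortCost + 3) + 3) fun s' =>
      QueueInv K n (g + gs.length) (splitAll n K.le gs) s' ∧
        s'.var vEnd = s.var vEnd + (splitAll n K.le gs).flatten.length := by
  rw [mul_add, mul_one] at hE
  refine Runs.while (fun s' τ => ∃ rest es, QueueInv K n (g + gs.length - rest.length) (rest ++ es) s' ∧
    es ++ splitAll n K.le rest = splitAll n K.le gs ∧ s'.var vEnd = s.var vEnd + es.flatten.length ∧
    es.length + rest.flatten.length ≤ gs.flatten.length ∧
    es.flatten.length + rest.flatten.length * L ≤ gs.flatten.length * L ∧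
    rest.length ≤ gs.length ∧ (∀ l ∈ rest, Nat.clog 2 l.length ≤ L) ∧
    τ = rest.flatten.length * (L * sortCost) + rest.length * (sortCost + 3) + 3)
    ⟨gs, [], by simpa using h, by simp, by simp, by simp, by simp, le_rfl, hL, rfl⟩ ?_ ?_
  all_goals
    rintro s' τ hF ⟨rest, es, hq, hes, hend, hlen, htot, hle, hL', rfl⟩ hb
    have hge' : s'.var vGroupsEnd = g + gs.length := (hF.var vGroupsEnd rfl).trans hge
    simp only [Test.holds, WExp.eval, hge', hq.cur_eq] at hb
  · rcases rest with _ | ⟨l, rest⟩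
    · simp at hb
    rw [List.flatten_cons, List.length_append] at hlen htot
    rw [List.length_cons] at hle hq
    rw [add_mul] at htot
    simp only [List.mem_cons, forall_eq_or_imp] at hL'
    have hsp := split_flatten_length n K.le l
    have hsl := split_length_le n K.le l
    have hmul : Nat.clog 2 l.length * l.length ≤ l.length * L := by
      rw [mul_comm]; exact Nat.mul_le_mul_left _ hL'.1
    have hspec := groupProg_spec (B := B) (gs := rest ++ es) (l := l)
      (by rw [hend]; omega)
      (by simp only [List.length_append]; omega) hq
    refine ⟨_, rest.flatten.length * (L * sortCost) + rest.length * (sortCost + 3) + 3, ?_,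
      hspec.mono le_rfl ?_⟩
    · rw [List.flatten_cons, List.length_append, List.length_cons]
      have : Nat.clog 2 l.length * (l.length * sortCost) ≤ l.length * (L * sortCost) := by
        rw [← mul_assoc, ← mul_assoc]; exact Nat.mul_le_mul_right _ hmul
      simp only [Test.cost, WExp.cost]
      nlinarith
    · rintro s'' - ⟨h1, h2⟩
      refine ⟨rest, es ++ split n K.le l, ?_, ?_, ?_, ?_, ?_, by omega, hL'.2, rfl⟩
      · rw [← List.append_assoc]
        convert h1 using 1; omega
      · rw [List.append_assoc, ← splitAll_cons, hes]
      · rw [h2, hend, List.flatten_append, List.length_append]; ring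
      · rw [List.length_append]; omega
      · rw [List.flatten_append, List.length_append]; omega
  · have hr : rest = [] := by
      rcases rest with _ | ⟨l, rest⟩
      · rfl
      · rw [List.length_cons] at hb hle; omega
    subst hr
    have : splitAll n K.le [] = [] := rfl
    rw [this, List.append_nil] at hes
    subst hes
    exact ⟨by simp [Test.cost, WExp.cost], by simpa using hq, hend⟩

/-! ## Values of tuples -/

/-- The pattern graph, the number of vertices, the adjacency matrix and the weight matrix. -/
structure Inst (h : ℕ) where
  H : SimpleGraph (Fin h)
  n : ℕ
  adj : ℕ → ℕ
  w : ℕ → ℝ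

section Values

variable {h : ℕ} (I : Inst h)

open Classical in
/-- Is the pair of vertices of `H` mapped correctly by `f` (`0` if so)? -/
noncomputable def Inst.pairViol (f : ℕ → ℕ) (p : Fin h × Fin h) : ℕ :=
  if I.H.Adj p.1 p.2 then 1 - I.adj (f p.1 * I.n + f p.2)
  -- By truncated subtraction the second summand is `1` exactly if the two images coincide. Adjacent
  -- pairs need no such term, because the diagonal of an adjacency matrix is zero.
  else I.adj (f p.1 * I.n + f p.2) + (1 - ((f p.1 - f p.2) + (f p.2 - f p.1)))

/-- Number of violations of `f` on a list of pairs. -/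
noncomputable def Inst.viol (f : ℕ → ℕ) (L : List (Fin h × Fin h)) : ℕ :=
  (L.map (I.pairViol f)).sum

/-- Weight of `f` on a list of pairs. -/
noncomputable def Inst.wt (f : ℕ → ℕ) (L : List (Fin h × Fin h)) : ℝ :=
  (L.map fun p => I.w (f p.1 * I.n + f p.2)).sum

/-- The image of the vertex `x` of `H` in the current tuple. -/
def vtx (x : Fin h) : WExp := .arr aTup (.const x)

/-- Matrix index of a pair. -/
def idx (p : Fin h × Fin h) : WExp := .add (.mul (vtx p.1) (.var vN)) (vtx p.2)

open Classical in
/-- Expression for `Inst.viol`. -/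
noncomputable def violExp (H : SimpleGraph (Fin h)) (L : List (Fin h × Fin h)) : WExp :=
  L.foldr (fun p e => .add (if H.Adj p.1 p.2 then .sub (.const 1) (.arr 0 (idx p))
    else .add (.arr 0 (idx p)) (.sub (.const 1) (.add (.sub (vtx p.1) (vtx p.2))
      (.sub (vtx p.2) (vtx p.1))))) e) (.const 0)

/-- Expression for `Inst.wt`. -/
def wtExp (L : List (Fin h × Fin h)) : RExp :=
  L.foldr (fun p e => .add (.arr 0 (idx p)) e) (.arr rZero (.const 0))

/-- The instance is stored in memory. -/
structure HasInst (s : State) : Prop where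
  n_eq : s.var vN = I.n
  adj_eq : s.arr 0 = I.adj
  w_eq : s.real 0 = I.w
  zero : s.real rZero = fun _ => 0

/-- The tuple `f` is stored in memory. -/
def HasTup (h : ℕ) (f : ℕ → ℕ) (s : State) : Prop := ∀ l < h, s.arr aTup l = f l

variable {I} {s : State} {f : ℕ → ℕ}

theorem HasInst.of_frame {c : Prog} {s' : State} (hs : HasInst I s) (hF : Frame c s s')
    (h1 : c.writesVar vN = false) (h2 : c.writesArr 0 = false) (h3 : c.writesReal 0 = false)
    (h4 : c.writesReal rZero = false) : HasInst I s' :=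
  ⟨(hF.var _ h1).trans hs.n_eq, (hF.arr _ h2).trans hs.adj_eq, (hF.real _ h3).trans hs.w_eq,
    (hF.real _ h4).trans hs.zero⟩

theorem idx_eval (hs : HasInst I s) (hf : HasTup h f s) (p : Fin h × Fin h) :
    (idx p).eval s = f p.1 * I.n + f p.2 := by
  simp [idx, vtx, WExp.eval, hs.n_eq, hf p.1 p.1.2, hf p.2 p.2.2]

theorem violExp_eval (hs : HasInst I s) (hf : HasTup h f s) (L : List (Fin h × Fin h)) :
    (violExp I.H L).eval s = I.viol f L := by
  induction L with
  | nil => rfl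
  | cons p L ih =>
    have : (violExp I.H (p :: L)).eval s = I.pairViol f p + (violExp I.H L).eval s := by
      rw [violExp, List.foldr_cons, WExp.eval, Inst.pairViol]
      congr 1
      split_ifs <;> simp [WExp.eval, idx_eval hs hf, hs.adj_eq, vtx, hf p.1 p.1.2, hf p.2 p.2.2]
    rw [this, ih]; simp [Inst.viol]

theorem wtExp_eval (hs : HasInst I s) (hf : HasTup h f s) (L : List (Fin h × Fin h)) :
    (wtExp L).eval s = I.wt f L := by
  induction L with
  | nil => simp [wtExp, RExp.eval, WExp.eval, hs.zero, Inst.wt]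
  | cons p L ih =>
    have : (wtExp (p :: L)).eval s = I.w (f p.1 * I.n + f p.2) + (wtExp L).eval s := by
      rw [wtExp, List.foldr_cons, RExp.eval, RExp.eval, idx_eval hs hf, hs.w_eq]; rfl
    rw [this, ih]; simp [Inst.wt]

theorem Inst.viol_congr (I : Inst h) {f f' : ℕ → ℕ} {L : List (Fin h × Fin h)}
    (hff : ∀ p ∈ L, f p.1 = f' p.1 ∧ f p.2 = f' p.2) : I.viol f L = I.viol f' L := by
  unfold Inst.viol
  congr 1
  refine List.map_congr_left fun p hp => ?_
  rw [Inst.pairViol, Inst.pairViol, (hff p hp).1, (hff p hp).2]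

theorem Inst.wt_congr (I : Inst h) {f f' : ℕ → ℕ} {L : List (Fin h × Fin h)}
    (hff : ∀ p ∈ L, f p.1 = f' p.1 ∧ f p.2 = f' p.2) : I.wt f L = I.wt f' L := by
  unfold Inst.wt
  congr 1
  refine List.map_congr_left fun p hp => ?_
  rw [(hff p hp).1, (hff p hp).2]

theorem Inst.viol_le (hadj : ∀ i, I.adj i ≤ 1) (f : ℕ → ℕ) (L : List (Fin h × Fin h)) :
    I.viol f L ≤ 2 * L.length := by
  induction L with
  | nil => simp [Inst.viol]
  | cons p L ih =>
    have : I.pairViol f p ≤ 2 := by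
      have := hadj (f p.1 * I.n + f p.2)
      rw [Inst.pairViol]; split_ifs <;> omega
    simp only [Inst.viol, List.map_cons, List.sum_cons, List.length_cons] at *
    omega

variable (h) in
/-- All pairs `x < y` of vertices of `H`. -/
def allPairs : List (Fin h × Fin h) :=
  (List.finRange h ×ˢ List.finRange h).filter fun p => p.1 < p.2

variable (h) in
/-- The pairs with the vertex `2` but not the vertex `1`. -/
def redPairs : List (Fin h × Fin h) :=
  (allPairs h).filter fun p => (p.1.1 = 2 ∨ p.2.1 = 2) ∧ p.1.1 ≠ 1

variable (h) in
/-- The pair of the vertices `1` and `2`. -/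
def bluePairs : List (Fin h × Fin h) :=
  (allPairs h).filter fun p => (p.1.1 = 2 ∨ p.2.1 = 2) ∧ p.1.1 = 1

variable (h) in
/-- The pairs without the vertex `2`. -/
def restPairs : List (Fin h × Fin h) :=
  (allPairs h).filter fun p => ¬ (p.1.1 = 2 ∨ p.2.1 = 2)

theorem lt_of_mem_allPairs {p : Fin h × Fin h} (hp : p ∈ allPairs h) : p.1.1 < p.2.1 :=
  (by simpa [allPairs] using hp : _ ∧ p.1 < p.2).2

theorem sum_map_filter {α M : Type*} [AddCommMonoid M] (F : α → M) (P Q : α → Prop)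
    [DecidablePred P] [DecidablePred Q] (L : List α) :
    (L.map F).sum = ((L.filter fun p => P p ∧ ¬ Q p).map F).sum +
      ((L.filter fun p => P p ∧ Q p).map F).sum + ((L.filter fun p => ¬ P p).map F).sum := by
  induction L with
  | nil => simp
  | cons p L ih =>
    simp only [List.filter_cons, List.map_cons, List.sum_cons, ih]
    by_cases h1 : P p <;> by_cases h2 : Q p <;> simp [h1, h2] <;> abel

/-- The decomposition A(i,k) + B(j,k) + C(i,j) behind the method: red pairs do not see the image of
`1`, the blue pair does not see that of `0`, and the rest does not see that of `2`. -/
theorem sum_map_allPairs {M : Type*} [AddCommMonoid M] (F : Fin h × Fin h → M) :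
    ((allPairs h).map F).sum =
      ((redPairs h).map F).sum + ((bluePairs h).map F).sum + ((restPairs h).map F).sum :=
  sum_map_filter F _ _ _

/-- The tuple with the entries `i`, `j`, `k`, and the other entries those of `r`. -/
def tup (r : ℕ → ℕ) (i j k : ℕ) (l : ℕ) : ℕ :=
  if l = 0 then i else if l = 1 then j else if l = 2 then k else r l

variable (I) in
/-- Number of violations of a tuple. -/
noncomputable def Inst.violAll (f : ℕ → ℕ) : ℕ := I.viol f (allPairs h)

variable (I) in
/-- Weight of a tuple. -/
noncomputable def Inst.wtAll (f : ℕ → ℕ) : ℝ := I.wt f (allPairs h)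

/-- In an increasing pair that contains `2`, the vertex `1` can only be the first component. -/
theorem red_congr (r : ℕ → ℕ) (i j j' k : ℕ) {p : Fin h × Fin h} (hp : p ∈ redPairs h) :
    tup r i j k p.1 = tup r i j' k p.1 ∧ tup r i j k p.2 = tup r i j' k p.2 := by
  rw [redPairs, List.mem_filter] at hp
  have := lt_of_mem_allPairs hp.1
  have h2 := hp.2
  simp only [decide_eq_true_eq] at h2
  unfold tup
  constructor <;> split_ifs <;> omega

theorem blue_congr (r : ℕ → ℕ) (i i' j k : ℕ) {p : Fin h × Fin h} (hp : p ∈ bluePairs h) :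
    tup r i j k p.1 = tup r i' j k p.1 ∧ tup r i j k p.2 = tup r i' j k p.2 := by
  rw [bluePairs, List.mem_filter] at hp
  have := lt_of_mem_allPairs hp.1
  have h2 := hp.2
  simp only [decide_eq_true_eq] at h2
  unfold tup
  constructor <;> split_ifs <;> omega

theorem rest_congr (r : ℕ → ℕ) (i j k k' : ℕ) {p : Fin h × Fin h} (hp : p ∈ restPairs h) :
    tup r i j k p.1 = tup r i j k' p.1 ∧ tup r i j k p.2 = tup r i j k' p.2 := by
  rw [restPairs, List.mem_filter] at hp
  have h2 := hp.2
  simp only [decide_eq_true_eq] at h2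
  unfold tup
  constructor <;> split_ifs <;> omega

variable (I) in
/-- Among the tuples with the entries `i` and `j`, the entry `k₀` beats the entry `k`: it is better, or
equally good and not larger. -/
def Inst.Beats (r : ℕ → ℕ) (i j k₀ k : ℕ) : Prop :=
  I.violAll (tup r i j k₀) < I.violAll (tup r i j k) ∨
    I.violAll (tup r i j k₀) = I.violAll (tup r i j k) ∧
      I.wtAll (tup r i j k) ≤ I.wtAll (tup r i j k₀) ∧
        (¬ I.wtAll (tup r i j k₀) ≤ I.wtAll (tup r i j k) ∨ k₀ ≤ k)

variable (I) in
/-- The keys of the points `x` (red) and `n + x` (blue) are those for comparing `k₀` with `k`. -/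
structure KeysAt (r : ℕ → ℕ) (k₀ k : ℕ) (K : Keys) (x : ℕ) : Prop where
  red_vP : K.vP x = I.viol (tup r x x k₀) (redPairs h)
  red_vM : K.vM x = I.viol (tup r x x k) (redPairs h)
  red_wP : K.wP x = I.wt (tup r x x k₀) (redPairs h)
  red_wM : K.wM x = I.wt (tup r x x k) (redPairs h)
  red_tie : K.tie x = 1
  blue_vP : K.vP (I.n + x) = I.viol (tup r x x k) (bluePairs h)
  blue_vM : K.vM (I.n + x) = I.viol (tup r x x k₀) (bluePairs h)
  blue_wP : K.wP (I.n + x) = I.wt (tup r x x k) (bluePairs h)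
  blue_wM : K.wM (I.n + x) = I.wt (tup r x x k₀) (bluePairs h)
  -- The value is `0` if `k₀ ≤ k` and `2` otherwise; compared with the red value `1` it decides ties
  -- in favour of the smaller vertex.
  blue_tie : K.tie (I.n + x) = 2 * (1 - (1 - (k₀ - k)))

/-- The term without vertex `2` is the same for `k₀` and `k` and cancels; what remains compares a
quantity of the blue point `j` with one of the red point `i`. Thus a comparison of candidates
becomes a comparison of points. -/
theorem KeysAt.le_iff {r : ℕ → ℕ} {k₀ k i j : ℕ} {K : Keys} (hi : KeysAt I r k₀ k K i)
    (hj : KeysAt I r k₀ k K j) : K.le (I.n + j) i ↔ I.Beats r i j k₀ k := by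
  have hv (k : ℕ) : I.violAll (tup r i j k) = I.viol (tup r i i k) (redPairs h) +
      I.viol (tup r j j k) (bluePairs h) + I.viol (tup r i j 0) (restPairs h) := by
    rw [← I.viol_congr fun p hp => red_congr r i j i k hp,
      ← I.viol_congr fun p hp => blue_congr r i j j k hp,
      ← I.viol_congr fun p hp => rest_congr r i j k 0 hp]
    exact sum_map_allPairs _
  have hw (k : ℕ) : I.wtAll (tup r i j k) = I.wt (tup r i i k) (redPairs h) +
      I.wt (tup r j j k) (bluePairs h) + I.wt (tup r i j 0) (restPairs h) := by
    rw [← I.wt_congr fun p hp => red_congr r i j i k hp,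
      ← I.wt_congr fun p hp => blue_congr r i j j k hp,
      ← I.wt_congr fun p hp => rest_congr r i j k 0 hp]
    exact sum_map_allPairs _
  rw [Keys.le, Inst.Beats, hi.red_vP, hi.red_vM, hi.red_wP, hi.red_wM, hi.red_tie, hj.blue_vP,
    hj.blue_vM, hj.blue_wP, hj.blue_wM, hj.blue_tie, hv, hv, hw, hw]
  refine or_congr (by omega) (and_congr (by omega) (and_congr ?_ (or_congr (not_congr ?_) ?_)))
  · constructor <;> intro <;> linarith
  · constructor <;> intro <;> linarith
  · omega

end Values

end Dominance

/-! ### Computing the keys, and maintaining the best tuple found so far. -/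

namespace Dominance

open RAM

notation "vVal" => 27
notation "vY" => 28
notation "vStack" => 29
notation "vU" => 30
notation "vPoint" => 31

variable {h : ℕ} {I : Inst h} {B : ℕ} {s : State} {f r : ℕ → ℕ}

/-! ## Computing the keys -/

/-- The entries of the tuple for the vertices from `3` on are those of `r`. -/
def HasRest (h : ℕ) (r : ℕ → ℕ) (s : State) : Prop := ∀ l, 3 ≤ l → l < h → s.arr aTup l = r l

theorem HasInst.setArr (hs : HasInst I s) {a : ℕ} (ha : a ≠ 0) (i v : ℕ) :
    HasInst I (s.setArr a i v) :=
  ⟨hs.n_eq, by rw [State.setArr_arr, if_neg ha.symm]; exact hs.adj_eq, hs.w_eq, hs.zero⟩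

theorem HasInst.setReal (hs : HasInst I s) {a : ℕ} (ha : a ≠ 0) (ha' : rZero ≠ a) (i : ℕ) (v : ℝ) :
    HasInst I (s.setReal a i v) :=
  ⟨hs.n_eq, hs.adj_eq, by rw [State.setReal_real, if_neg ha.symm]; exact hs.w_eq,
    by rw [State.setReal_real, if_neg ha']; exact hs.zero⟩

theorem HasTup.setArr (hf : HasTup h f s) {a : ℕ} (ha : aTup ≠ a) (i v : ℕ) :
    HasTup h f (s.setArr a i v) := fun l hl => by
  rw [State.setArr_arr, if_neg ha]; exact hf l hl

theorem HasTup.setReal (hf : HasTup h f s) (a i : ℕ) (v : ℝ) : HasTup h f (s.setReal a i v) := hf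

theorem HasTup.of_rest {i j k : ℕ} (hr : HasRest h r s) (h0 : s.arr aTup 0 = i)
    (h1 : s.arr aTup 1 = j) (h2 : s.arr aTup 2 = k) : HasTup h (tup r i j k) s := fun l hl => by
  unfold tup
  split_ifs with h3 h4 h5
  · rw [h3, h0]
  · rw [h4, h1]
  · rw [h5, h2]
  · exact hr l (by omega) hl

/-- Evaluate the tuple on a list of pairs. -/
noncomputable def writeKeys (H : SimpleGraph (Fin h)) (a b : ℕ) (i : WExp)
    (L : List (Fin h × Fin h)) : Prog :=
  .seq (.setArr a i (violExp H L)) (.setReal b i (wtExp L))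

theorem writeKeys_spec (hs : HasInst I s) (hf : HasTup h f s) {a b v : ℕ} {i : WExp}
    {L : List (Fin h × Fin h)} (ha : a ≠ 0) (ha' : aTup ≠ a)
    (hi : ∀ s' : State, s'.var = s.var → i.eval s' = v) (hB : I.viol f L < B) :
    Runs B (writeKeys I.H a b i L) s (writeKeys I.H a b i L).cost fun s' =>
      s' = (s.setArr a v (I.viol f L)).setReal b v (I.wt f L) := by
  refine Runs.of_wp ?_
  simp only [writeKeys, wp, hi s rfl, violExp_eval hs hf]
  refine ⟨hB, ?_⟩
  rw [hi _ (State.setArr_var _ _ _ _), wtExp_eval (hs.setArr ha _ _) (hf.setArr ha' _ _)]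

/-- The index of the blue point with number `vX`. -/
def blueIdx : WExp := .add (.var vN) (.var vX)

/-- Put the point number `vX` and the vertex `vK₀` into the tuple. -/
def setPoint : Prog :=
  .seq (.setArr aTup (.const 0) (.var vX)) (.seq (.setArr aTup (.const 1) (.var vX))
    (.setArr aTup (.const 2) (.var vK₀)))

/-- Compute the keys of the red and the blue point with number `vX`. -/
noncomputable def fillBody (H : SimpleGraph (Fin h)) : Prog :=
  .seq setPoint
    (.seq (writeKeys H aVP rP (.var vX) (redPairs h))
    (.seq (writeKeys H aVM rM blueIdx (bluePairs h))
    (.seq (.setArr aTup (.const 2) (.var vK))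
    (.seq (writeKeys H aVM rM (.var vX) (redPairs h))
    (.seq (writeKeys H aVP rP blueIdx (bluePairs h))
    (.seq (.setArr aTie (.var vX) (.const 1))
      (.setArr aTie blueIdx (.mul (.const 2) (.sub (.const 1)
        (.sub (.const 1) (.sub (.var vK₀) (.var vK))))))))))))

/-- Both keys of a point are expressions whose size depends only on `H`, so they take constant time.
The number `x` may stand at both positions `0` and `1`, as red pairs ignore the latter and blue ones
the former. -/
theorem fillBody_spec {x k₀ k : ℕ} (hx : x < I.n) (hs : HasInst I s) (hr : HasRest h r s)
    (hX : s.var vX = x) (hk₀ : s.var vK₀ = k₀) (hk : s.var vK = k)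
    (hB : ∀ f L, L.length ≤ (allPairs h).length → I.viol f L < B) (hB3 : 3 ≤ B)
    (hxB : x < B) (hk₀B : k₀ < B) (hkB : k < B)
    (hold : ∀ y < x, KeysAt I r k₀ k (keys s) y) :
    Runs B (fillBody I.H) s (fillBody I.H).cost fun s' =>
      (∀ y < x + 1, KeysAt I r k₀ k (keys s') y) ∧ HasRest h r s' := by
  have hred : (redPairs h).length ≤ (allPairs h).length := List.length_filter_le _ _
  have hblue : (bluePairs h).length ≤ (allPairs h).length := List.length_filter_le _ _
  have h1 : Runs B setPoint s setPoint.cost fun s' =>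
      s' = ((s.setArr aTup 0 x).setArr aTup 1 x).setArr aTup 2 k₀ := by
    refine Runs.of_wp ?_
    simp only [setPoint, wp, WExp.eval, State.setArr_var, hX, hk₀]
    exact ⟨hxB, hxB, hk₀B, trivial⟩
  refine h1.seq ?_
  rintro s₁ - hs₁
  have hv₁ : s₁.var = s.var := by rw [hs₁]; rfl
  have hi₁ : HasInst I s₁ := by
    rw [hs₁]; exact ((hs.setArr (by omega) _ _).setArr (by omega) _ _).setArr (by omega) _ _
  have hf₁ : HasTup h (tup r x x k₀) s₁ := by
    rw [hs₁]
    refine HasTup.of_rest (fun l hl hl' => ?_) ?_ ?_ ?_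
    · simp only [State.setArr_arr, if_true]
      rw [Function.update_of_ne (by omega), Function.update_of_ne (by omega),
        Function.update_of_ne (by omega)]
      exact hr l hl hl'
    all_goals simp
  refine (writeKeys_spec (v := x) hi₁ hf₁ (by omega) (by omega) (fun s' hs' => ?_) (hB _ _ hred)).seq ?_
  · simp only [WExp.eval, hs', hv₁, hX]
  rintro s₂ - hs₂
  have hv₂ : s₂.var = s.var := by rw [hs₂]; exact hv₁
  have hi₂ : HasInst I s₂ := by
    rw [hs₂]; exact (hi₁.setArr (by omega) _ _).setReal (by omega) (by omega) _ _
  have hf₂ : HasTup h (tup r x x k₀) s₂ := by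
    rw [hs₂]; exact (hf₁.setArr (by omega) _ _).setReal _ _ _
  refine (writeKeys_spec (v := I.n + x) hi₂ hf₂ (by omega) (by omega) (fun s' hs' => ?_)
    (hB _ _ hblue)).seq ?_
  · simp only [blueIdx, WExp.eval, hs', hv₂, hX, hs.n_eq]
  rintro s₃ - hs₃
  have hv₃ : s₃.var = s.var := by rw [hs₃]; exact hv₂
  have hi₃ : HasInst I s₃ := by
    rw [hs₃]; exact (hi₂.setArr (by omega) _ _).setReal (by omega) (by omega) _ _
  have hf₃ : HasTup h (tup r x x k₀) s₃ := by
    rw [hs₃]; exact (hf₂.setArr (by omega) _ _).setReal _ _ _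
  have h4 : Runs B (.setArr aTup (.const 2) (.var vK)) s₃ (Prog.setArr aTup (.const 2) (.var vK)).cost fun s' =>
      s' = s₃.setArr aTup 2 k := by
    refine Runs.of_wp ?_
    simp only [wp, WExp.eval, hv₃, hk]
    exact ⟨hkB, trivial⟩
  refine h4.seq ?_
  rintro s₄ - hs₄
  have hv₄ : s₄.var = s.var := by rw [hs₄]; exact hv₃
  have hi₄ : HasInst I s₄ := by rw [hs₄]; exact hi₃.setArr (by omega) _ _
  have hf₄ : HasTup h (tup r x x k) s₄ := by
    rw [hs₄]
    intro l hl
    have := hf₃ l hl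
    unfold tup at this ⊢
    simp only [State.setArr_arr, if_true, Function.update_apply]
    split_ifs at this ⊢ <;> omega
  refine (writeKeys_spec (v := x) hi₄ hf₄ (by omega) (by omega) (fun s' hs' => ?_) (hB _ _ hred)).seq ?_
  · simp only [WExp.eval, hs', hv₄, hX]
  rintro s₅ - hs₅
  have hv₅ : s₅.var = s.var := by rw [hs₅]; exact hv₄
  have hi₅ : HasInst I s₅ := by
    rw [hs₅]; exact (hi₄.setArr (by omega) _ _).setReal (by omega) (by omega) _ _
  have hf₅ : HasTup h (tup r x x k) s₅ := by
    rw [hs₅]; exact (hf₄.setArr (by omega) _ _).setReal _ _ _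
  refine (writeKeys_spec (v := I.n + x) hi₅ hf₅ (by omega) (by omega) (fun s' hs' => ?_)
    (hB _ _ hblue)).seq ?_
  · simp only [blueIdx, WExp.eval, hs', hv₅, hX, hs.n_eq]
  rintro s₆ - hs₆
  have hv₆ : s₆.var = s.var := by rw [hs₆]; exact hv₅
  have hf₆ : HasTup h (tup r x x k) s₆ := by
    rw [hs₆]; exact (hf₅.setArr (by omega) _ _).setReal _ _ _
  refine Runs.of_wp ?_
  simp only [wp, WExp.eval, blueIdx, State.setArr_var, hv₆, hX, hk, hk₀, hs.n_eq]
  refine ⟨by omega, by omega, ?_, ?_⟩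
  · have e6 : s₆.arr 6 = Function.update (Function.update (s.arr 6) x
        (I.viol (tup r x x k₀) (redPairs h))) (I.n + x) (I.viol (tup r x x k) (bluePairs h)) := by
      rw [hs₆, hs₅, hs₄, hs₃, hs₂, hs₁]; simp
    have e7 : s₆.arr 7 = Function.update (Function.update (s.arr 7) (I.n + x)
        (I.viol (tup r x x k₀) (bluePairs h))) x (I.viol (tup r x x k) (redPairs h)) := by
      rw [hs₆, hs₅, hs₄, hs₃, hs₂, hs₁]; simp
    have e8 : s₆.arr 8 = s.arr 8 := by
      rw [hs₆, hs₅, hs₄, hs₃, hs₂, hs₁]; simp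
    have e1 : s₆.real 1 = Function.update (Function.update (s.real 1) x
        (I.wt (tup r x x k₀) (redPairs h))) (I.n + x) (I.wt (tup r x x k) (bluePairs h)) := by
      rw [hs₆, hs₅, hs₄, hs₃, hs₂, hs₁]; simp
    have e2 : s₆.real 2 = Function.update (Function.update (s.real 2) (I.n + x)
        (I.wt (tup r x x k₀) (bluePairs h))) x (I.wt (tup r x x k) (redPairs h)) := by
      rw [hs₆, hs₅, hs₄, hs₃, hs₂, hs₁]; simp
    have hne : I.n ≠ 0 := by omega
    intro y hy
    by_cases hyx : y = x
    · subst hyx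
      constructor <;> simp [keys, e6, e7, e8, e1, e2, hne]
    -- Red cells lie below `I.n` and blue ones do not, so the keys of an earlier `y` are not
    -- overwritten.
    · have hy' : y ≠ I.n + x := by omega
      have hy'' : I.n + y ≠ x := by omega
      have hold := hold y (by omega)
      obtain ⟨a1, a2, a3, a4, a5, a6, a7, a8, a9, a10⟩ := hold
      simp only [keys] at a1 a2 a3 a4 a5 a6 a7 a8 a9 a10
      constructor <;>
        simp [keys, *]
  · intro l hl hl'
    have := hf₆ l hl'
    simp only [State.setArr_arr, Nat.reduceEqDiff, reduceIte]
    rw [this, tup, if_neg (by omega), if_neg (by omega), if_neg (by omega)]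

/-- Compute the keys of all points. -/
noncomputable def fillLoop (H : SimpleGraph (Fin h)) : Prog := forLoop vX (.var vN) (fillBody H)

theorem fillLoop_spec {k₀ k : ℕ} (hs : HasInst I s) (hr : HasRest h r s)
    (hk₀ : s.var vK₀ = k₀) (hk : s.var vK = k)
    (hB : ∀ f L, L.length ≤ (allPairs h).length → I.viol f L < B) (hB3 : 3 ≤ B)
    (hnB : I.n < B) (hk₀B : k₀ < B) (hkB : k < B) :
    Runs B (fillLoop I.H) s (I.n * ((fillBody I.H).cost + 7) + 5) fun s' =>
      (∀ y < I.n, KeysAt I r k₀ k (keys s') y) ∧ HasRest h r s' := by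
  refine (Runs.for_range_const (N := I.n) (t := (fillBody I.H).cost) (fun x s' =>
    ((∀ y < x, KeysAt I r k₀ k (keys s') y) ∧ HasRest h r s') ∧ s'.var vN = I.n) (e := .var vN) rfl hnB
    (fun i s' h => by simpa only [WExp.eval] using h.2) ⟨⟨by simp, hr⟩, by simpa using hs.n_eq⟩ ?_).mono le_rfl fun _ _ h => h.1
  rintro x hx s' hF hX ⟨⟨hK, hr'⟩, -⟩
  have hs' := hs.of_frame hF rfl rfl rfl rfl
  refine (fillBody_spec hx hs' hr' hX ((hF.var vK₀ rfl).trans hk₀) ((hF.var vK rfl).trans hk) hB hB3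
    (by omega) hk₀B hkB hK).mono le_rfl fun s'' hF' h'' => ⟨⟨h''.1, h''.2⟩, ?_⟩
  simpa [hF'.var vN rfl] using hs'.n_eq

/-! ## The best tuple so far -/

variable (I) in
/-- The best tuple so far is at least as good as `f`. -/
def Covers (s : State) (f : ℕ → ℕ) : Prop :=
  s.var vFound = 1 ∧ (s.var vBest < I.violAll f ∨
    s.var vBest = I.violAll f ∧ I.wtAll f ≤ s.real rBest 0)

variable (I) in
/-- The data of the best tuple so far are correct. -/
def Sound (s : State) : Prop :=
  s.var vFound = 0 ∨ s.var vFound = 1 ∧ ∃ f : ℕ → ℕ, (∀ l < h, f l < I.n) ∧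
    (∀ l < h, s.arr 1 l = f l) ∧ s.var vBest = I.violAll f ∧ s.real rBest 0 = I.wtAll f

/-- The current tuple, with `vVal` violations, is better than the best one so far. -/
def betterTest (h : ℕ) : Test :=
  .not (.and (.weq (.var vFound) (.const 1)) (.and (.not (.wlt (.var vVal) (.var vBest)))
    (.not (.and (.weq (.var vVal) (.var vBest))
      (.not (.rle (wtExp (allPairs h)) (.arr rBest (.const 0))))))))

/-- Store the value of the current tuple as the best one so far. -/
def storeValue (h : ℕ) : Prog :=
  .seq (.setVar vFound (.const 1)) (.seq (.setVar vBest (.var vVal))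
    (.setReal rBest (.const 0) (wtExp (allPairs h))))

/-- Store the current tuple as the best one so far. -/
def storeProg (h : ℕ) : Prog :=
  .seq (storeValue h)
    (forLoop vY (.const h) (.setArr 1 (.var vY) (.arr aTup (.var vY))))

/-- Compare the current tuple with the best one so far. -/
noncomputable def checkProg (H : SimpleGraph (Fin h)) : Prog :=
  .seq (.setVar vVal (violExp H (allPairs h))) (.ite (betterTest h) (storeProg h) .skip)

theorem storeProg_spec {v : ℕ} (hs : HasInst I s) (hf : HasTup h f s) (hv : s.var vVal = v)
    (hvB : v < B) (hhB : h < B) :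
    Runs B (storeProg h) s (h * 11 + (wtExp (allPairs h)).cost + 14) fun s' =>
      s'.var vFound = 1 ∧ s'.var vBest = v ∧ s'.real rBest 0 = I.wtAll f ∧
        ∀ l < h, s'.arr 1 l = f l := by
  have h1 : Runs B (storeValue h) s (storeValue h).cost fun s' =>
      s' = ((s.setVar vFound 1).setVar vBest v).setReal rBest 0 (I.wtAll f) := by
    refine Runs.of_bounded fun hb => Runs.of_wp ?_
    have := hb.two_le
    have hi : HasInst I ((s.setVar vFound 1).setVar vBest v) :=
      ⟨by simpa using hs.n_eq, hs.adj_eq, hs.w_eq, hs.zero⟩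
    have he : (wtExp (allPairs h)).eval ((s.setVar vFound 1).setVar vBest v) = I.wtAll f :=
      wtExp_eval hi hf _
    simp only [storeValue, wp, WExp.eval, State.setVar_var, Nat.reduceEqDiff, reduceIte, hv, he]
    exact ⟨by omega, hvB, trivial⟩
  refine (h1.seq (t' := h * 11 + 5) ?_).mono
    (by simp only [storeValue, Prog.cost, WExp.cost]; omega) fun _ _ h => h
  rintro s₁ hF₁ hs₁
  have hf₁ : HasTup h f s₁ := by rw [hs₁]; exact hf
  refine (Runs.for_range_const (N := h) (t := 4) (fun i s' => ∀ l < i, s'.arr 1 l = f l) rfl hhB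
    (fun i s' _ => rfl) (fun l hl => absurd hl (by omega)) ?_).mono
      (by simp only [WExp.cost]; omega) fun s₂ hF₂ h₂ => ?_
  · intro i hi s' hF' hi' hI
    refine Runs.of_bounded fun hb => (Runs.of_wp ?_).mono (by simp [Prog.cost, WExp.cost]) fun _ _ h => h
    simp only [wp, WExp.eval, hi']
    refine ⟨hb.arr _ _, fun l hl => ?_⟩
    simp only [State.setVar_arr, State.setArr_arr, if_true, Function.update_apply]
    split_ifs with hli
    · rw [hF'.arr aTup rfl, hli]; exact hf₁ i hi
    · exact hI l (by omega)
  · refine ⟨?_, ?_, ?_, h₂⟩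
    · rw [hF₂.var vFound rfl, hs₁]; simp
    · rw [hF₂.var vBest rfl, hs₁]; simp
    · rw [hF₂.real rBest rfl, hs₁]; simp

/-- Running time of `checkProg`. -/
noncomputable def checkCost (H : SimpleGraph (Fin h)) : ℕ :=
  (violExp H (allPairs h)).cost + 1 + ((betterTest h).cost + (h * 11 + (wtExp (allPairs h)).cost + 14))

/-- `f` replaces the stored tuple only if that one does not cover it; the ranking is total, so `f`
is then better and covers whatever was covered before. -/
theorem checkProg_spec (hs : HasInst I s) (hf : HasTup h f s) (hval : ∀ l < h, f l < I.n)
    (hB : I.violAll f < B) (hhB : h < B) (hS : Sound I s) :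
    Runs B (checkProg I.H) s (checkCost I.H) fun s' =>
      Sound I s' ∧ Covers I s' f ∧ ∀ g, Covers I s g → Covers I s' g := by
  have h1 : Runs B (.setVar vVal (violExp I.H (allPairs h))) s ((violExp I.H (allPairs h)).cost + 1) fun s' =>
      s' = s.setVar vVal (I.violAll f) := by
    refine Runs.of_wp (c := .setVar _ _) ?_
    simp only [wp, violExp_eval hs hf]
    exact ⟨hB, rfl⟩
  refine h1.seq ?_
  rintro s₁ - rfl
  have hs₁ : HasInst I (s.setVar vVal (I.violAll f)) :=
    ⟨by simpa using hs.n_eq, hs.adj_eq, hs.w_eq, hs.zero⟩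
  have hf₁ : HasTup h f (s.setVar vVal (I.violAll f)) := hf
  have hbt : (betterTest h).holds (s.setVar vVal (I.violAll f)) ↔ ¬ Covers I s f := by
    have he : (wtExp (allPairs h)).eval (s.setVar vVal (I.violAll f)) = I.wtAll f :=
      wtExp_eval hs₁ hf₁ _
    simp only [betterTest, Test.holds, WExp.eval, RExp.eval, State.setVar_var, he, State.setVar_real,
      Nat.reduceEqDiff, reduceIte, Covers]
    refine not_congr (and_congr Iff.rfl ?_)
    rcases lt_trichotomy (I.violAll f) (s.var vBest) with hlt | heq | hgt
    · simp [hlt, hlt.not_gt, hlt.ne']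
    · simp [heq]
    · simp [hgt, hgt.not_gt, hgt.ne']
  refine Runs.ite (fun hc => ?_) fun hc => ?_
  · rw [hbt] at hc
    refine (storeProg_spec hs₁ hf₁ (by simp) hB hhB).mono le_rfl fun s₂ hF₂ ⟨a1, a2, a3, a4⟩ => ?_
    refine ⟨Or.inr ⟨a1, f, hval, a4, a2, a3⟩, ⟨a1, Or.inr ⟨a2.symm ▸ rfl, a3.ge⟩⟩, fun g hg => ⟨a1, ?_⟩⟩
    rw [a2, a3]
    unfold Covers at hc hg
    obtain ⟨hg1, hg2⟩ := hg
    rw [hg1] at hc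
    simp only [true_and, not_or, not_and, not_lt, not_le] at hc
    rcases hg2 with hg2 | ⟨hg2, hg3⟩
    · exact Or.inl (hc.1.trans_lt hg2)
    · rcases hc.1.lt_or_eq with hlt | heq
      · exact Or.inl (by omega)
      · exact Or.inr ⟨by omega, hg3.trans (hc.2 heq.symm).le⟩
  · rw [hbt, not_not] at hc
    refine (Runs.of_wp (c := .skip) ?_).mono (by simp only [Prog.cost]; omega) fun _ _ h => h
    have hcov : ∀ g, Covers I s g → Covers I (s.setVar vVal (I.violAll f)) g := fun g hg => by
      simpa [Covers] using hg
    refine ⟨?_, hcov f hc, hcov⟩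
    simpa [Sound] using hS

theorem Covers.of_frame {c : Prog} {s' : State} (hc : Covers I s f) (hF : Frame c s s')
    (h1 : c.writesVar vFound = false) (h2 : c.writesVar vBest = false)
    (h3 : c.writesReal rBest = false) : Covers I s' f := by
  unfold Covers
  rw [hF.var _ h1, hF.var _ h2, hF.real _ h3]; exact hc

theorem Sound.of_frame {c : Prog} {s' : State} (hc : Sound I s) (hF : Frame c s s')
    (h1 : c.writesVar vFound = false) (h2 : c.writesVar vBest = false)
    (h3 : c.writesReal rBest = false) (h4 : c.writesArr 1 = false) : Sound I s' := by
  unfold Sound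
  rw [hF.var _ h1, hF.var _ h2, hF.real _ h3, hF.arr _ h4]; exact hc

end Dominance

/-! ### Enumerating and checking the pairs represented by the final groups. -/

namespace Dominance

open RAM

variable {h : ℕ} {I : Inst h} {B : ℕ} {s : State} {f r : ℕ → ℕ}

/-! ## Reporting the pairs of a group -/

/-- Check the pair of the red point in the tuple and the blue point number `vU` of the stack. -/
noncomputable def pairStep (H : SimpleGraph (Fin h)) : Prog :=
  .seq (.setArr aTup (.const 1) (.sub (.arr aTmp (.var vU)) (.var vN))) (checkProg H)

/-- Check the pairs of a red point with all earlier blue points. -/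
noncomputable def redStep (H : SimpleGraph (Fin h)) : Prog :=
  .seq (.setArr aTup (.const 0) (.var vPoint)) (forLoop vU (.var vStack) (pairStep H))

/-- Put a blue point on the stack. -/
def blueStep : Prog :=
  .seq (.setArr aTmp (.var vStack) (.var vPoint)) (.setVar vStack (.add (.var vStack) (.const 1)))

/-- Process the next point of a group. -/
noncomputable def scanStep (H : SimpleGraph (Fin h)) : Prog :=
  .seq (.setVar vPoint (.arr aPts (.var vA)))
    (.seq (.ite (.wlt (.var vPoint) (.var vN)) (redStep H) blueStep)
      (.setVar vA (.add (.var vA) (.const 1))))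

/-- Prepare to process the current group. -/
def scanInit : Prog :=
  .seq (.setVar vA (.arr aStart (.var vCur)))
    (.seq (.setVar vB (.arr aStart (.add (.var vCur) (.const 1)))) (.setVar vStack (.const 0)))

/-- Check all pairs of a red point and an earlier blue point of the current group. -/
noncomputable def scanGroup (H : SimpleGraph (Fin h)) : Prog :=
  .seq scanInit (.seq (.while (.wlt (.var vA) (.var vB)) (scanStep H))
    (.setVar vCur (.add (.var vCur) (.const 1))))

/-- Check the pairs of all groups. -/
noncomputable def scanAll (H : SimpleGraph (Fin h)) : Prog :=
  .while (.wlt (.var vCur) (.var vGroups)) (scanGroup H)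

/-- Memory while pairs are checked for the vertices `k₀` and `r`. -/
structure ScanBase (I : Inst h) (r : ℕ → ℕ) (k₀ : ℕ) (s : State) : Prop where
  inst : HasInst I s
  rest : HasRest h r s
  mid : s.arr aTup 2 = k₀
  sound : Sound I s

/-- Bounds for the entries of the tuples. -/
structure Valid (I : Inst h) (r : ℕ → ℕ) (k₀ B : ℕ) : Prop where
  mid_lt : k₀ < I.n
  rest_lt : ∀ l, 3 ≤ l → l < h → r l < I.n
  viol_lt : ∀ f, I.violAll f < B
  h_lt : h < B
  n_lt : 2 * I.n < B

theorem Valid.tup_lt {k₀ i j : ℕ} (hV : Valid I r k₀ B) (hi : i < I.n) (hj : j < I.n) :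
    ∀ l < h, tup r i j k₀ l < I.n := fun l hl => by
  unfold tup
  split_ifs with h1 h2 h3
  · exact hi
  · exact hj
  · exact hV.mid_lt
  · exact hV.rest_lt l (by omega) hl

theorem ScanBase.of_frame {k₀ : ℕ} {c : Prog} {s' : State} (hs : ScanBase I r k₀ s)
    (hF : Frame c s s') (h1 : c.writesVar vN = false) (h2 : c.writesArr 0 = false)
    (h3 : c.writesReal 0 = false) (h4 : c.writesReal rZero = false) (h5 : c.writesArr aTup = false)
    (h6 : c.writesVar vFound = false) (h7 : c.writesVar vBest = false)
    (h8 : c.writesReal rBest = false) (h9 : c.writesArr 1 = false) : ScanBase I r k₀ s' :=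
  ⟨hs.inst.of_frame hF h1 h2 h3 h4, fun l hl hl' => by rw [hF.arr _ h5]; exact hs.rest l hl hl',
    by rw [hF.arr _ h5]; exact hs.mid, hs.sound.of_frame hF h6 h7 h8 h9⟩

/-- Setting the tuple entry of vertex `0` or `1`. -/
theorem ScanBase.setTup {k₀ : ℕ} (hs : ScanBase I r k₀ s) {i : ℕ} (hi : i < 2) (v : ℕ) :
    ScanBase I r k₀ (s.setArr aTup i v) := by
  refine ⟨hs.inst.setArr (by omega) _ _, fun l hl hl' => ?_, ?_, hs.sound⟩
  · simp only [State.setArr_arr, if_true]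
    rw [Function.update_of_ne (by omega)]
    exact hs.rest l hl hl'
  · simp only [State.setArr_arr, if_true]
    rw [Function.update_of_ne (by omega)]
    exact hs.mid

theorem pairStep_spec {k₀ i q u : ℕ} (hV : Valid I r k₀ B) (hi : i < I.n) (hq : q < 2 * I.n)
    (hq' : I.n ≤ q) (hs : ScanBase I r k₀ s) (h0 : s.arr aTup 0 = i) (hu : s.var vU = u)
    (hT : s.arr aTmp u = q) :
    Runs B (pairStep I.H) s (checkCost I.H + 6) fun s' => ScanBase I r k₀ s' ∧ s'.arr aTup 0 = i ∧
      Covers I s' (tup r i (q - I.n) k₀) ∧ ∀ g, Covers I s g → Covers I s' g := by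
  have h1 : Runs B (.setArr aTup (.const 1) (.sub (.arr aTmp (.var vU)) (.var vN))) s 6
      fun s' => s' = s.setArr aTup 1 (q - I.n) := by
    refine Runs.of_wp (c := .setArr aTup (.const 1) (.sub (.arr aTmp (.var vU)) (.var vN))) ?_
    have := hV.n_lt
    simp only [wp, WExp.eval, hu, hT, hs.inst.n_eq]
    exact ⟨by omega, trivial⟩
  refine (h1.seq (t' := checkCost I.H) ?_).mono (by omega) fun _ _ h => h
  rintro s₁ - rfl
  have hs₁ := hs.setTup (show 1 < 2 by omega) (q - I.n)
  have h0₁ : (s.setArr aTup 1 (q - I.n)).arr aTup 0 = i := by simpa using h0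
  refine (checkProg_spec hs₁.inst (HasTup.of_rest (j := q - I.n) hs₁.rest h0₁ (by simp) hs₁.mid)
    (hV.tup_lt hi (by omega)) (hV.viol_lt _) hV.h_lt hs₁.sound).mono le_rfl ?_
  rintro s₂ hF ⟨h2, h3, h4⟩
  exact ⟨⟨hs₁.inst.of_frame hF rfl rfl rfl rfl,
    fun l hl hl' => by rw [hF.arr aTup rfl]; exact hs₁.rest l hl hl',
    by rw [hF.arr aTup rfl]; exact hs₁.mid, h2⟩, by rw [hF.arr aTup rfl]; exact h0₁, h3, h4⟩

theorem AtL.getElem {g : ℕ → ℕ} {lo : ℕ} {l : List ℕ} (h : AtL g lo l) {i : ℕ} (hi : i < l.length) :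
    g (lo + i) = l[i] := by
  induction l generalizing lo i with
  | nil => simp at hi
  | cons x l ih =>
    cases i with
    | zero => exact h.1
    | succ i =>
      rw [show lo + (i + 1) = lo + 1 + i by ring]
      exact ih h.2 _

theorem redStep_spec {k₀ i : ℕ} {bl : List ℕ} (hV : Valid I r k₀ B) (hi : i < I.n)
    (hbl : ∀ q ∈ bl, I.n ≤ q ∧ q < 2 * I.n) (hs : ScanBase I r k₀ s) (hp : s.var vPoint = i)
    (hst : s.var vStack = bl.length) (hT : AtL (s.arr aTmp) 0 bl) (hB : bl.length < B) :
    Runs B (redStep I.H) s (bl.length * (checkCost I.H + 13) + 8) fun s' => ScanBase I r k₀ s' ∧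
      (∀ q ∈ bl, Covers I s' (tup r i (q - I.n) k₀)) ∧ ∀ g, Covers I s g → Covers I s' g := by
  have h1 : Runs B (.setArr aTup (.const 0) (.var vPoint)) s 3
      fun s' => s' = s.setArr aTup 0 i := by
    refine Runs.of_wp (c := .setArr aTup (.const 0) (.var vPoint)) ?_
    have := hV.n_lt
    simp only [wp, WExp.eval, hp]
    exact ⟨by omega, trivial⟩
  refine (h1.seq (t' := bl.length * (checkCost I.H + 13) + 5) ?_).mono (by omega) fun _ _ h => h
  rintro s₁ - rfl
  have hs₁ := hs.setTup (show 0 < 2 by omega) i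
  generalize hs₁' : s.setArr aTup 0 i = s₁ at hs₁
  have h0 : s₁.arr aTup 0 = i := by rw [← hs₁']; simp
  have hT₁ : AtL (s₁.arr aTmp) 0 bl := by rw [← hs₁']; simpa using hT
  have hst₁ : s₁.var vStack = bl.length := by rw [← hs₁']; exact hst
  have hcov : ∀ g, Covers I s g → Covers I s₁ g := fun g hg => by rw [← hs₁']; exact hg
  refine (Runs.for_range_const (N := bl.length) (t := checkCost I.H + 6) (e := .var vStack)
    (fun u s' => (ScanBase I r k₀ s' ∧ s'.arr aTup 0 = i ∧
      (∀ (v : ℕ) (hv : v < bl.length), v < u → Covers I s' (tup r i (bl[v] - I.n) k₀)) ∧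
      ∀ g, Covers I s₁ g → Covers I s' g) ∧ s'.var vStack = bl.length) rfl hB
    (fun _ _ h => by simpa only [WExp.eval] using h.2)
    ⟨⟨?_, by simpa using h0, by simp, fun g hg => by simpa [Covers] using hg⟩, by simpa using hst₁⟩
    ?_).mono (by simp [WExp.cost]) ?_
  · exact hs₁.of_frame (Frame.setVar (x := vU) (e := .const 0) _ _) rfl rfl rfl rfl rfl rfl rfl rfl rfl
  · rintro u hu s₂ hF₂ hu₂ ⟨⟨hs₂, h0₂, hc₂, hm₂⟩, -⟩
    have hTu : s₂.arr aTmp u = bl[u] := by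
      rw [hF₂.arr aTmp rfl]; simpa using hT₁.getElem hu
    have hq := hbl bl[u] (List.getElem_mem hu)
    refine (pairStep_spec hV hi hq.2 hq.1 hs₂ h0₂ hu₂ hTu).mono le_rfl ?_
    rintro s₃ hF₃ ⟨hs₃, h0₃, hc₃, hm₃⟩
    have hset : ∀ g, Covers I s₃ g → Covers I (s₃.setVar vU (u + 1)) g :=
      fun g hg => by simpa [Covers] using hg
    refine ⟨⟨hs₃.of_frame (Frame.setVar (x := vU) (e := .const 0) _ _) rfl rfl rfl rfl rfl rfl rfl rfl
      rfl, by simpa using h0₃, fun v hv hvu => ?_, fun g hg => hset g (hm₃ g (hm₂ g hg))⟩, ?_⟩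
    · rcases (Nat.lt_succ_iff.1 hvu).lt_or_eq with hlt | rfl
      · exact hset _ (hm₃ _ (hc₂ v hv hlt))
      · exact hset _ hc₃
    · simp only [State.setVar_var, Nat.reduceEqDiff, reduceIte]
      rw [hF₃.var vStack rfl, hF₂.var vStack rfl, hst₁]
  · rintro s₂ - ⟨⟨hs₂, -, hc₂, hm₂⟩, -⟩
    refine ⟨hs₂, fun q hq => ?_, fun g hg => hm₂ g (hcov g hg)⟩
    obtain ⟨v, hv, rfl⟩ := List.getElem_of_mem hq
    exact hc₂ v hv hv

/-- Time for one checked pair or one scanned point. -/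
noncomputable def scanCost (H : SimpleGraph (Fin h)) : ℕ := checkCost H + 40

/-- Blue points go onto a stack, and a red point is paired with the whole stack; the work is the
number of pairs plus the length of the list. By the invariant a counted pair is already covered, or
has its blue point on the stack and its red one ahead, or lies entirely ahead. -/
theorem scanLoop_spec {k₀ a b : ℕ} {l : List ℕ} (hV : Valid I r k₀ B) (hs : ScanBase I r k₀ s)
    (hl : ∀ x ∈ l, x < 2 * I.n) (hA : s.var vA = a) (hb : s.var vB = b) (hab : a + l.length = b)
    (hbB : b < B) (hmem : AtL (s.arr aPts) a l) (hst : s.var vStack = 0) :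
    Runs B (.while (.wlt (.var vA) (.var vB)) (scanStep I.H)) s
      ((pairs I.n 0 l + l.length) * scanCost I.H + 3) fun s' => ScanBase I r k₀ s' ∧
      (∀ g, Covers I s g → Covers I s' g) ∧
      ∀ q p, I.n ≤ q → p < I.n → 0 < cnt q p l → Covers I s' (tup r p (q - I.n) k₀) := by
  refine Runs.while (fun s' τ => ∃ bl rest, ScanBase I r k₀ s' ∧
    (∀ q ∈ bl, I.n ≤ q ∧ q < 2 * I.n) ∧ (∀ x ∈ rest, x < 2 * I.n) ∧
    s'.var vA + rest.length = b ∧ bl.length + rest.length ≤ b ∧ AtL (s'.arr aPts) (s'.var vA) rest ∧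
    s'.var vStack = bl.length ∧ AtL (s'.arr aTmp) 0 bl ∧
    (∀ g, Covers I s g → Covers I s' g) ∧
    (∀ q p, I.n ≤ q → p < I.n → 0 < cnt q p l → Covers I s' (tup r p (q - I.n) k₀) ∨
      (q ∈ bl ∧ p ∈ rest) ∨ 0 < cnt q p rest) ∧
    τ = (pairs I.n bl.length rest + rest.length) * scanCost I.H + 3)
    ⟨[], l, hs, by simp, hl, by omega, by simp; omega, hA ▸ hmem, by simpa using hst, trivial,
      fun _ h => h, fun q p _ _ h => Or.inr (Or.inr h), rfl⟩ ?_ ?_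
  all_goals
    rintro s' τ hF ⟨bl, rest, hs', hbl, hrest, hend, hlen, hm, hst', hT, hmono, hcov, rfl⟩ hlt
    have hb' : s'.var vB = b := (hF.var vB rfl).trans hb
    simp only [Test.holds, WExp.eval, hb'] at hlt
  · rcases rest with _ | ⟨x, rest⟩
    · simp at hend; omega
    rw [List.length_cons] at hend hlen
    simp only [List.mem_cons, forall_eq_or_imp] at hrest
    have hn2 := hV.n_lt
    have h1 : Runs B (.setVar vPoint (.arr aPts (.var vA))) s' 3
        fun s'' => s'' = s'.setVar vPoint x := by
      refine Runs.of_wp (c := .setVar vPoint (.arr aPts (.var vA))) ?_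
      simp only [wp, WExp.eval, hm.1]
      exact ⟨by omega, trivial⟩
    have hs₁ : ScanBase I r k₀ (s'.setVar vPoint x) :=
      hs'.of_frame (Frame.setVar (x := vPoint) (e := .const 0) _ _) rfl rfl rfl rfl rfl rfl rfl rfl rfl
    have hcov₁ : ∀ g, Covers I s' g → Covers I (s'.setVar vPoint x) g :=
      fun g hg => by simpa [Covers] using hg
    by_cases hx : x < I.n
    · refine ⟨(bl.length * (checkCost I.H + 13) + 8) + 16,
        (pairs I.n bl.length rest + rest.length) * scanCost I.H + 3, ?_, ?_⟩
      · rw [pairs, if_pos hx]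
        simp only [Test.cost, WExp.cost, scanCost, List.length_cons]
        nlinarith
      refine (h1.seq (t' := (bl.length * (checkCost I.H + 13) + 8) + 13) ?_).mono (by omega)
        fun _ _ h => h
      rintro s₁ - rfl
      have h2 : Runs B (.ite (.wlt (.var vPoint) (.var vN)) (redStep I.H) blueStep)
          (s'.setVar vPoint x) (3 + (bl.length * (checkCost I.H + 13) + 8))
          fun s'' => (ScanBase I r k₀ s'' ∧ (∀ q ∈ bl, Covers I s'' (tup r x (q - I.n) k₀)) ∧
            ∀ g, Covers I (s'.setVar vPoint x) g → Covers I s'' g) ∧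
              Frame (redStep I.H) (s'.setVar vPoint x) s'' :=
        Runs.ite (fun _ => (redStep_spec hV hx hbl hs₁ (by simp) (by simpa using hst')
          (by simpa using hT) (by omega)).mono le_rfl fun _ hF h => ⟨h, hF⟩) fun hc => absurd hx (by
            simpa [Test.holds, WExp.eval, hs'.inst.n_eq] using hc)
      refine (h2.seq (t' := 4) ?_).mono (by omega) fun _ _ h => h
      rintro s₂ - ⟨⟨hs₂, hc₂, hm₂⟩, hF₂⟩
      have hA₂ : s₂.var vA = s'.var vA := (hF₂.var vA rfl).trans (by simp)
      refine Runs.of_wp (c := .setVar vA (.add (.var vA) (.const 1))) ?_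
      simp only [wp, WExp.eval, hA₂]
      have hset : ∀ g, Covers I s₂ g → Covers I (s₂.setVar vA (s'.var vA + 1)) g :=
        fun g hg => by simpa [Covers] using hg
      refine ⟨by omega, bl, rest, hs₂.of_frame (Frame.setVar (x := vA) (e := .const 0) _ _) rfl rfl rfl
        rfl rfl rfl rfl rfl rfl, hbl, hrest.2, by simp; omega, by omega, ?_, ?_, ?_, ?_, ?_, rfl⟩
      · simpa [hF₂.arr aPts rfl] using hm.2
      · simpa [hF₂.var vStack rfl] using hst'
      · simpa [hF₂.arr aTmp rfl] using hT
      · exact fun g hg => hset g (hm₂ g (hcov₁ g (hmono g hg)))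
      · intro q p hq hp hcnt
        rcases hcov q p hq hp hcnt with h | ⟨h3, h4⟩ | h
        · exact Or.inl (hset _ (hm₂ _ (hcov₁ _ h)))
        · rcases List.mem_cons.1 h4 with rfl | h4
          · exact Or.inl (hset _ (hc₂ q h3))
          · exact Or.inr (Or.inl ⟨h3, h4⟩)
        · rw [cnt, if_neg (by omega), zero_add] at h
          exact Or.inr (Or.inr h)
    · refine ⟨24, (pairs I.n (bl ++ [x]).length rest + rest.length) * scanCost I.H + 3, ?_, ?_⟩
      · rw [pairs, if_neg hx, List.length_append, List.length_singleton]
        simp only [Test.cost, WExp.cost, scanCost, List.length_cons]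
        nlinarith
      refine (h1.seq (t' := 21) ?_).mono (by omega) fun _ _ h => h
      rintro s₁ - rfl
      have h2 : Runs B (.ite (.wlt (.var vPoint) (.var vN)) (redStep I.H) blueStep)
          (s'.setVar vPoint x) (3 + blueStep.cost) fun s₂ =>
            s₂ = ((s'.setVar vPoint x).setArr aTmp bl.length x).setVar vStack (bl.length + 1) := by
        refine Runs.ite (fun hc => absurd ?_ hx) fun hc => Runs.of_wp ?_
        · simpa [Test.holds, WExp.eval, hs'.inst.n_eq] using hc
        · simp only [blueStep, wp, WExp.eval, State.setVar_var, State.setArr_var, Nat.reduceEqDiff,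
            reduceIte, hst']
          exact ⟨by omega, by omega, trivial⟩
      refine (h2.seq (t' := 4) ?_).mono (by decide) fun _ _ h => h
      rintro s₂ - rfl
      refine Runs.of_wp (c := .setVar vA (.add (.var vA) (.const 1))) ?_
      simp only [wp, WExp.eval, State.setVar_var, State.setArr_var, Nat.reduceEqDiff, reduceIte]
      refine ⟨by omega, bl ++ [x], rest, ?_, ?_, hrest.2, by omega, by simp; omega, ?_, ?_, ?_, ?_,
        ?_, rfl⟩
      · refine ⟨⟨by simpa using hs'.inst.n_eq, by simpa using hs'.inst.adj_eq, hs'.inst.w_eq,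
          hs'.inst.zero⟩, fun l hl hl' => ?_, ?_, ?_⟩
        · simpa using hs'.rest l hl hl'
        · simpa using hs'.mid
        · simpa [Sound] using hs'.sound
      · intro q hq
        rcases List.mem_append.1 hq with hq | hq
        · exact hbl q hq
        · rw [List.mem_singleton.1 hq]; exact ⟨by omega, hrest.1⟩
      · simpa using hm.2
      · simp
      · simpa using hT.snoc
      · exact fun g hg => by simpa [Covers] using hmono g hg
      · intro q p hq hp hcnt
        rcases hcov q p hq hp hcnt with h | ⟨h3, h4⟩ | h
        · left; simpa [Covers] using h
        · rcases List.mem_cons.1 h4 with rfl | h4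
          · omega
          · exact Or.inr (Or.inl ⟨by simp [h3], h4⟩)
        · rw [cnt] at h
          by_cases hxq : x = q
          · by_cases hp0 : 0 < rest.count p
            · exact Or.inr (Or.inl ⟨by simp [hxq], List.count_pos_iff.1 hp0⟩)
            · right; right; rw [if_pos hxq] at h; omega
          · rw [if_neg hxq, zero_add] at h
            exact Or.inr (Or.inr h)
  · have hr : rest = [] := List.length_eq_zero_iff.1 (by omega)
    subst hr
    refine ⟨by simp [Test.cost, WExp.cost], hs', hmono, fun q p hq hp hcnt => ?_⟩
    rcases hcov q p hq hp hcnt with h | ⟨-, h⟩ | h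
    · exact h
    · simp at h
    · simp [cnt] at h

theorem scanAll_spec {k₀ g : ℕ} {gs : List (List ℕ)} (hV : Valid I r k₀ B) (hs : ScanBase I r k₀ s)
    (hl : ∀ l ∈ gs, ∀ x ∈ l, x < 2 * I.n) (hmem : Groups (s.arr aStart) (s.arr aPts) g gs)
    (hcur : s.var vCur = g) (hgr : s.var vGroups = g + gs.length) (hgB : g + gs.length + 1 < B) :
    Runs B (scanAll I.H) s
      (((gs.map (pairs I.n 0)).sum + gs.flatten.length + gs.length) * scanCost I.H + 3) fun s' =>
      ScanBase I r k₀ s' ∧ (∀ f, Covers I s f → Covers I s' f) ∧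
      ∀ q p, I.n ≤ q → p < I.n → 0 < cntSum q p gs → Covers I s' (tup r p (q - I.n) k₀) := by
  refine Runs.while (fun s' τ => ∃ g rest, ScanBase I r k₀ s' ∧ (∀ l ∈ rest, ∀ x ∈ l, x < 2 * I.n) ∧
    Groups (s.arr aStart) (s.arr aPts) g rest ∧ s'.var vCur = g ∧ s.var vGroups = g + rest.length ∧
    (∀ f, Covers I s f → Covers I s' f) ∧
    (∀ q p, I.n ≤ q → p < I.n → 0 < cntSum q p gs → Covers I s' (tup r p (q - I.n) k₀) ∨
      0 < cntSum q p rest) ∧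
    τ = ((rest.map (pairs I.n 0)).sum + rest.flatten.length + rest.length) * scanCost I.H + 3)
    ⟨g, gs, hs, hl, hmem, hcur, hgr, fun _ h => h, fun q p _ _ h => Or.inr h, rfl⟩ ?_ ?_
  all_goals
    rintro s' τ hF ⟨g', rest, hs', hl', hm', hcur', hgr', hmono, hcov, rfl⟩ hb
    simp only [Test.holds, WExp.eval, hcur', hF.var vGroups rfl, hgr'] at hb
  · rcases rest with _ | ⟨l, rest⟩
    · simp at hb
    obtain ⟨hS, hA, hG⟩ := hm'
    simp only [List.mem_cons, forall_eq_or_imp] at hl'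
    rw [List.length_cons] at hgr'
    refine ⟨(pairs I.n 0 l + l.length) * scanCost I.H + 30,
      ((rest.map (pairs I.n 0)).sum + rest.flatten.length + rest.length) * scanCost I.H + 3, ?_, ?_⟩
    · simp only [List.map_cons, List.sum_cons, List.flatten_cons, List.length_append,
        List.length_cons, Test.cost, WExp.cost, scanCost]
      nlinarith
    refine Runs.of_bounded fun hbd => ?_
    have h1 : Runs B scanInit s' scanInit.cost fun s'' => s'' =
        ((s'.setVar vA (s.arr aStart g')).setVar vB (s.arr aStart (g' + 1))).setVar vStack 0 := by
      refine Runs.of_wp ?_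
      have e1 := hbd.arr aStart g'
      have e2 := hbd.arr aStart (g' + 1)
      rw [hF.arr aStart rfl] at e1 e2
      simp only [scanInit, wp, WExp.eval, State.setVar_var, State.setVar_arr, Nat.reduceEqDiff, reduceIte,
        hcur', hF.arr aStart rfl]
      exact ⟨e1, e2, by omega, trivial⟩
    refine (h1.seq (t' := (pairs I.n 0 l + l.length) * scanCost I.H + 7) ?_).mono
      (by have : scanInit.cost ≤ 23 := by decide
          omega) fun _ _ h => h
    rintro s₁ hF₁ hs₁
    have hs₁' := hs'.of_frame hF₁ rfl rfl rfl rfl rfl rfl rfl rfl rfl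
    have hbB : s.arr aStart (g' + 1) < B := by
      have := hbd.arr aStart (g' + 1); rwa [hF.arr aStart rfl] at this
    have h2 := scanLoop_spec (a := s.arr aStart g') (b := s.arr aStart (g' + 1)) hV hs₁' hl'.1
      (by rw [hs₁]; simp) (by rw [hs₁]; simp) hS.symm hbB
      (by rw [hF₁.arr aPts rfl, hF.arr aPts rfl]; exact hA) (by rw [hs₁]; simp)
    refine (h2.seq (t' := 4) ?_).mono (by omega) fun _ _ h => h
    rintro s₂ hF₂ ⟨hs₂, hmono₂, hcov₂⟩
    have hcur₂ : s₂.var vCur = g' := by rw [hF₂.var vCur rfl, hF₁.var vCur rfl, hcur']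
    refine Runs.of_wp (c := .setVar vCur (.add (.var vCur) (.const 1))) ?_
    simp only [wp, WExp.eval, hcur₂]
    have hset : ∀ g, Covers I s₂ g → Covers I (s₂.setVar vCur (g' + 1)) g :=
      fun g hg => by simpa [Covers] using hg
    have hmono₃ : ∀ f, Covers I s' f → Covers I (s₂.setVar vCur (g' + 1)) f := fun f hf =>
      hset f (hmono₂ f (hf.of_frame hF₁ rfl rfl rfl))
    refine ⟨by omega, g' + 1, rest, hs₂.of_frame (Frame.setVar (x := vCur) (e := .const 0) _ _) rfl rfl
      rfl rfl rfl rfl rfl rfl rfl, hl'.2, hG, by simp, by omega, fun f hf => hmono₃ f (hmono f hf), ?_, rfl⟩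
    intro q p hq hp hcnt
    rcases hcov q p hq hp hcnt with h | h
    · exact Or.inl (hmono₃ _ h)
    · rw [cntSum, List.map_cons, List.sum_cons] at h
      by_cases hc : 0 < cnt q p l
      · exact Or.inl (hset _ (hcov₂ q p hq hp hc))
      · right; rw [cntSum]; omega
  · have hr : rest = [] := List.length_eq_zero_iff.1 (by omega)
    subst hr
    refine ⟨by simp [Test.cost, WExp.cost], hs', hmono, fun q p hq hp hcnt => ?_⟩
    rcases hcov q p hq hp hcnt with h | h
    · exact h
    · simp [cntSum] at h

end Dominance

/-! ### Preparing an iteration, and the effect of a round on queue size and pair counts. -/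

namespace Dominance

open RAM

notation "vRem" => 32

variable {h : ℕ} {I : Inst h} {B : ℕ} {s : State} {f r : ℕ → ℕ}

/-! ## Decoding the tuple number -/

/-- The next digit of the tuple number. -/
def decodeStep : Prog :=
  .seq (.setArr aTup (.add (.var vX) (.const 2))
    (.sub (.var vRem) (.mul (.div (.var vRem) (.var vN)) (.var vN))))
    (.setVar vRem (.div (.var vRem) (.var vN)))

/-- Write the digits of the tuple number into the tuple. -/
def decodeProg (h : ℕ) : Prog :=
  .seq (.setVar vRem (.var vQ)) (forLoop vX (.const (h - 2)) decodeStep)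

/-- The entries of the tuple number `q` for the vertices from `2` on. -/
def digit (n q l : ℕ) : ℕ := q / n ^ (l - 2) % n

theorem decodeProg_spec {n q : ℕ} (hn : s.var vN = n) (hq : s.var vQ = q) (hhB : h < B) :
    Runs B (decodeProg h) s (h * 23 + 7) fun s' => ∀ l, 2 ≤ l → l < h → s'.arr aTup l = digit n q l := by
  refine Runs.of_bounded fun hbd => ?_
  have hqB : q < B := hq ▸ hbd.var vQ
  have h1 : Runs B (.setVar vRem (.var vQ)) s 2 fun s' => s' = s.setVar vRem q := by
    refine Runs.of_wp (c := .setVar vRem (.var vQ)) ?_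
    simp only [wp, WExp.eval, hq]
    exact ⟨hqB, trivial⟩
  refine (h1.seq (t' := (h - 2) * 23 + 5) ?_).mono (by omega) fun _ _ h => h
  rintro s₁ - rfl
  refine (Runs.for_range_const (N := h - 2) (t := 16) (e := .const (h - 2))
    (fun x s' => s'.var vRem = q / n ^ x ∧ ∀ l, 2 ≤ l → l < x + 2 → s'.arr aTup l = digit n q l)
    rfl (by omega) (fun _ _ _ => rfl) ⟨by simp, fun l h1 h2 => by omega⟩ ?_).mono
    (by simp [WExp.cost]) fun s' _ h' l h1 h2 => h'.2 l h1 (by omega)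
  rintro x hx s' hF hX ⟨hrem, hdig⟩
  have hn' : s'.var vN = n := by rw [hF.var vN rfl]; simpa using hn
  refine (Runs.of_wp (c := decodeStep) ?_).mono (by decide) fun _ _ h => h
  simp only [decodeStep, wp, WExp.eval, State.setArr_var, hX, hrem, hn']
  have h2 : q / n ^ x / n ≤ q := (Nat.div_le_self _ _).trans (Nat.div_le_self _ _)
  have h3 : q / n ^ x - q / n ^ x / n * n = q / n ^ x % n := by
    rw [Nat.mod_eq_sub_div_mul]
  refine ⟨(Nat.sub_le _ _).trans_lt ((Nat.div_le_self _ _).trans_lt hqB), by omega, ?_, ?_⟩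
  · simp [Nat.div_div_eq_div_mul, pow_succ]
  · intro l h4 h5
    simp only [State.setVar_arr, State.setArr_arr, if_true, Function.update_apply, h3]
    split_ifs with hl
    · rw [digit, hl]; simp
    · exact hdig l h4 (by omega)

/-! ## The initial queue -/

/-- Write the blue and the red point with number `vX`. -/
def queueStep : Prog :=
  .seq (.setArr aPts (.var vX) blueIdx) (.setArr aPts blueIdx (.var vX))

/-- Initialize the queue with one group of all blue points and all red points. -/
def queueProg : Prog :=
  .seq (forLoop vX (.var vN) queueStep)
    (.seq (.setArr aStart (.const 0) (.const 0)) (.seq (.setArr aStart (.const 1) (.add (.var vN) (.var vN)))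
      (.seq (.setVar vGroups (.const 1)) (.seq (.setVar vEnd (.add (.var vN) (.var vN)))
        (.setVar vCur (.const 0))))))

/-- All blue points, then all red points. -/
def initList (n : ℕ) : List ℕ := (List.range n).map (fun x => n + x) ++ List.range n

theorem initList_length (n : ℕ) : (initList n).length = 2 * n := by simp [initList]; ring

/-- The initial group represents each pair of a blue and a red point exactly once. -/
theorem cnt_initList {n i j : ℕ} (hi : i < n) (hj : j < n) : cnt (n + j) i (initList n) = 1 := by
  rw [initList, cnt_append, cnt_eq_zero_right, cnt_eq_zero_left]
  · rw [List.count_eq_one_of_mem, List.count_eq_one_of_mem List.nodup_range (List.mem_range.2 hi)]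
    · exact List.nodup_range.map (add_right_injective n)
    · exact List.mem_map.2 ⟨j, List.mem_range.2 hj, rfl⟩
  · simp
  · simp; omega

theorem mem_initList {n x : ℕ} (hx : x ∈ initList n) : x < 2 * n := by
  rw [initList, List.mem_append, List.mem_map, List.mem_range] at hx
  rcases hx with ⟨y, hy, rfl⟩ | hx
  · rw [List.mem_range] at hy; omega
  · omega

theorem queueProg_spec {n : ℕ} (hn : s.var vN = n) (hnB : 2 * n + 1 < B) :
    Runs B queueProg s (n * 18 + 40) fun s' => Groups (s'.arr aStart) (s'.arr aPts) 0 [initList n] ∧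
      s'.arr aStart 0 = 0 ∧ s'.var vGroups = 1 ∧ s'.var vEnd = 2 * n ∧ s'.var vCur = 0 := by
  have h1 : Runs B (forLoop vX (.var vN) queueStep) s (n * (queueStep.cost + 7) + 5) fun s' =>
      (AtL (s'.arr aPts) 0 ((List.range n).map fun x => n + x) ∧ AtL (s'.arr aPts) n (List.range n)) ∧
        s'.var vN = n := by
    refine (Runs.for_range_const (N := n) (t := queueStep.cost) (e := .var vN) (fun x s' =>
      (AtL (s'.arr aPts) 0 ((List.range x).map fun x => n + x) ∧ AtL (s'.arr aPts) n (List.range x)) ∧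
        s'.var vN = n) rfl (by omega) (fun _ _ h => by simpa only [WExp.eval] using h.2)
      ⟨⟨trivial, trivial⟩, by simpa using hn⟩ ?_).mono (by simp [WExp.cost]) fun _ _ h => h
    rintro x hx s' - hX ⟨⟨h1, h2⟩, hn'⟩
    refine Runs.of_wp ?_
    simp only [queueStep, blueIdx, wp, WExp.eval, State.setArr_var, hX, hn']
    refine ⟨by omega, by omega, ⟨?_, ?_⟩, by simpa using hn'⟩
    · simp only [State.setVar_arr, State.setArr_arr, if_true, List.range_succ, List.map_append,
        List.map_singleton]
      refine AtL.update ?_ (Or.inr (by simp; omega))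
      simpa using h1.snoc (v := n + x)
    · simp only [State.setVar_arr, State.setArr_arr, if_true, List.range_succ]
      have h3 := h2.update (i := x) (v := n + x) (Or.inl hx)
      simpa using h3.snoc (v := x)
  refine (h1.seq (t' := 30) ?_).mono
    (by have : queueStep.cost ≤ 11 := by decide
        nlinarith) fun _ _ h => h
  rintro s₁ - ⟨⟨h2, h3⟩, hn₁⟩
  refine (Runs.of_wp ?_).mono (t := Prog.cost (.seq (.setArr aStart (.const 0) (.const 0))
    (.seq (.setArr aStart (.const 1) (.add (.var vN) (.var vN)))
      (.seq (.setVar vGroups (.const 1)) (.seq (.setVar vEnd (.add (.var vN) (.var vN)))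
        (.setVar vCur (.const 0))))))) (by decide) fun _ _ h => h
  simp only [wp, WExp.eval, State.setArr_var, State.setVar_var, Nat.reduceEqDiff, reduceIte, hn₁]
  refine ⟨by omega, by omega, by omega, by omega, by omega, ⟨?_, ?_, trivial⟩, ?_, ?_, ?_, ?_⟩
  · simp [initList_length]; ring
  · simpa [initList, atL_append] using ⟨h2, h3⟩
  all_goals try simp
  all_goals omega

/-! ## The rounds -/

/-- One round: the key number `vC` of the block. -/
noncomputable def roundProg (H : SimpleGraph (Fin h)) : Prog :=
  -- The minimum of `vBase + vC` and `n - 1` by truncated subtraction. A short last block thus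
  -- repeats its last vertex, which does not affect being best in the block.
  .seq (.setVar vK (.sub (.sub (.var vN) (.const 1))
      (.sub (.sub (.var vN) (.const 1)) (.add (.var vBase) (.var vC)))))
    (.seq (fillLoop H) (.seq (.setVar vGroupsEnd (.var vGroups)) roundLoop))

/-- The `c`-th element of the block of `k₀`. -/
def blockElem (n d k₀ c : ℕ) : ℕ := min (k₀ / d * d + c) (n - 1)

/-- Bound for the total size of the groups of a round. -/
def maxSize (n d : ℕ) : ℕ := 4 ^ d * (2 * n * rt (2 * n))

theorem two_mul_le_maxSize (n d : ℕ) : 2 * n ≤ maxSize n d :=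
  (Nat.le_mul_of_pos_right _ (rt_pos _)).trans (Nat.le_mul_of_pos_left _ (by positivity))

/-- Time for a round. -/
noncomputable def roundCost (H : SimpleGraph (Fin h)) (n d : ℕ) : ℕ :=
  n * ((fillBody H).cost + 7) + maxSize n d * (Nat.clog 2 (maxSize n d) + 1) * (sortCost + 3) + 30

open Classical in
/-- The queue after `c` rounds. -/
structure RoundInv (I : Inst h) (r : ℕ → ℕ) (d k₀ c : ℕ) (g : ℕ) (gs : List (List ℕ)) (s : State) :
    Prop where
  rest : HasRest h r s
  mem : Groups (s.arr aStart) (s.arr aPts) g gs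
  cur_eq : s.var vCur = g
  groups_eq : s.var vGroups = g + gs.length
  end_eq : s.var vEnd = s.arr aStart g + gs.flatten.length
  cnt_eq : ∀ i < I.n, ∀ j < I.n, cntSum (I.n + j) i gs =
    if ∀ c' < c, I.Beats r i j k₀ (blockElem I.n d k₀ c') then 1 else 0
  pot_le : pot gs ≤ 4 ^ c * (2 * I.n * rt (2 * I.n))
  lt : ∀ l ∈ gs, ∀ x ∈ l, x < 2 * I.n
  length_le : gs.length ≤ maxSize I.n d
  cur_le : g ≤ c * maxSize I.n d
  end_le : s.var vEnd ≤ (c + 1) * maxSize I.n d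

/-- Bounds for the numbers in a round. -/
structure Big (I : Inst h) (d B : ℕ) : Prop where
  n_pos : 0 < I.n
  size_lt : (d + Nat.clog 2 (maxSize I.n d) + 4) * maxSize I.n d + 4 < B
  viol_lt : ∀ f L, L.length ≤ (allPairs h).length → I.viol f L < B
  h_lt : h < B

theorem Big.two_mul_lt {d : ℕ} (hB : Big I d B) : 2 * I.n + 4 < B := by
  have h1 := hB.size_lt
  have h2 := two_mul_le_maxSize I.n d
  nlinarith [Nat.zero_le (d + Nat.clog 2 (maxSize I.n d) + 3)]

/-- Splitting by the keys for the `c`-th element of the block adds one conjunct to the condition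
under which a pair survives, while the potential grows at most fourfold. -/
theorem roundProg_spec {d k₀ c g : ℕ} {gs : List (List ℕ)} (hB : Big I d B) (hc : c < d)
    (hk₀ : k₀ < I.n) (hs : HasInst I s) (hkv : s.var vK₀ = k₀) (hbase : s.var vBase = k₀ / d * d)
    (hcv : s.var vC = c) (h : RoundInv I r d k₀ c g gs s) :
    Runs B (roundProg I.H) s (roundCost I.H I.n d) fun s' =>
      ∃ g' gs', RoundInv I r d k₀ (c + 1) g' gs' s' := by
  have hn2 := hB.two_mul_lt
  have hnp := hB.n_pos
  have hsz := hB.size_lt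
  set k := blockElem I.n d k₀ c with hk
  set M := maxSize I.n d with hM
  have hkn : k < I.n := by rw [hk, blockElem]; omega
  have h1 : Runs B (.setVar vK (.sub (.sub (.var vN) (.const 1))
      (.sub (.sub (.var vN) (.const 1)) (.add (.var vBase) (.var vC))))) s 12
      fun s' => s' = s.setVar vK k := by
    refine Runs.of_wp (c := .setVar _ _) ?_
    have : I.n - 1 - (I.n - 1 - (k₀ / d * d + c)) = k := by rw [hk, blockElem]; omega
    simp only [wp, WExp.eval, hs.n_eq, hbase, hcv, this]
    exact ⟨by omega, trivial⟩
  have hpot : pot gs ≤ M := h.pot_le.trans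
    (Nat.mul_le_mul_right _ (Nat.pow_le_pow_right (by omega) hc.le))
  have hfl : gs.flatten.length ≤ M := (length_flatten_le_pot gs).trans hpot
  have hcM : (c + 1) * M ≤ d * M := Nat.mul_le_mul_right _ hc
  refine (h1.seq (t' := I.n * ((fillBody I.H).cost + 7) +
    M * (Nat.clog 2 M + 1) * (sortCost + 3) + 18) ?_).mono (by rw [roundCost, ← hM]; omega) fun _ _ h => h
  rintro s₁ hF₁ hs₁
  have hr₁ : HasRest _ r s₁ := fun l hl hl' => by rw [hF₁.arr aTup rfl]; exact h.rest l hl hl'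
  have h2 := fillLoop_spec (B := B) (hs.of_frame hF₁ rfl rfl rfl rfl) hr₁
    ((hF₁.var vK₀ rfl).trans hkv) (k₀ := k₀) (k := k) (by rw [hs₁]; simp) hB.viol_lt (by omega)
    (by omega) (hk₀.trans (by omega)) (hkn.trans (by omega))
  refine (h2.seq (t' := M * (Nat.clog 2 M + 1) * (sortCost + 3) + 8) ?_).mono (by omega)
    fun _ _ h => h
  rintro s₂ hF₂ ⟨hK, hr₂⟩
  have hgr₂ : s₂.var vGroups = g + gs.length :=
    ((hF₂.var vGroups rfl).trans (hF₁.var vGroups rfl)).trans h.groups_eq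
  have hgl := h.length_le
  have hgc := h.cur_le
  rw [← hM] at hgl hgc
  -- The memory budget: `d * M` for everything queued so far, `M * (Nat.clog 2 M + 1)` for the
  -- present round, and a reserve.
  have hadd : (d + Nat.clog 2 M + 4) * M = d * M + M * (Nat.clog 2 M + 1) + 3 * M := by ring
  have h3 : Runs B (.setVar vGroupsEnd (.var vGroups)) s₂ 2
      fun s' => s' = s₂.setVar vGroupsEnd (g + gs.length) := by
    refine Runs.of_wp (c := .setVar vGroupsEnd (.var vGroups)) ?_
    simp only [wp, WExp.eval, hgr₂]
    refine ⟨?_, trivial⟩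
    rw [add_mul, one_mul] at hcM
    omega
  refine (h3.seq (t' := M * (Nat.clog 2 M + 1) * (sortCost + 3) + 3) ?_).mono (by omega)
    fun _ _ h => h
  rintro s₃ hF₃ hs₃
  have hmem : Groups (s₃.arr aStart) (s₃.arr aPts) g gs := by
    rw [hF₃.arr aStart rfl, hF₂.arr aStart rfl, hF₁.arr aStart rfl, hF₃.arr aPts rfl,
      hF₂.arr aPts rfl, hF₁.arr aPts rfl]
    exact h.mem
  have hend₃ : s₃.var vEnd = s.var vEnd :=
    (hF₃.var vEnd rfl).trans ((hF₂.var vEnd rfl).trans (hF₁.var vEnd rfl))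
  have hst₃ : s₃.arr aStart = s.arr aStart :=
    (hF₃.arr aStart rfl).trans ((hF₂.arr aStart rfl).trans (hF₁.arr aStart rfl))
  have hn₃ : s₃.var vN = I.n := (hF₃.var vN rfl).trans
    ((hF₂.var vN rfl).trans ((hF₁.var vN rfl).trans hs.n_eq))
  have hK₃ : keys s₃ = keys s₂ := by rw [hs₃]; rfl
  have hq : QueueInv (keys s₂) I.n g gs s₃ := by
    refine ⟨hn₃, hK₃, (hF₃.var vCur rfl).trans ((hF₂.var vCur rfl).trans
      ((hF₁.var vCur rfl).trans h.cur_eq)), hmem, (hF₃.var vGroups rfl).trans hgr₂, ?_⟩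
    rw [hend₃, hst₃]; exact h.end_eq
  have hL : ∀ l ∈ gs, Nat.clog 2 l.length ≤ Nat.clog 2 M := fun l hl =>
    Nat.clog_mono_right 2 ((List.Sublist.length_le (List.sublist_flatten_of_mem hl)).trans hfl)
  have hele := h.end_le
  rw [← hM] at hele
  have hm1 : gs.flatten.length * (Nat.clog 2 M + 1) ≤ M * (Nat.clog 2 M + 1) :=
    Nat.mul_le_mul_right _ hfl
  have h4 := roundLoop_spec (B := B) (s := s₃) hL (by rw [hend₃]; omega)
    (by rw [add_mul, one_mul] at hcM; omega) (by rw [hs₃]; simp) hq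
  refine h4.mono ?_ ?_
  · have e1 : gs.flatten.length * (Nat.clog 2 M * sortCost) ≤ M * (Nat.clog 2 M * sortCost) :=
      Nat.mul_le_mul_right _ hfl
    have e2 : gs.length * (sortCost + 3) ≤ M * (sortCost + 3) := Nat.mul_le_mul_right _ hgl
    nlinarith [Nat.zero_le (M * Nat.clog 2 M)]
  · rintro s₄ hF₄ ⟨hq₄, hend₄⟩
    have hsl := splitAll_length_le I.n (keys s₂).le gs
    have hpot' : pot (splitAll I.n (keys s₂).le gs) ≤ 4 ^ (c + 1) * (2 * I.n * rt (2 * I.n)) := by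
      have := pot_splitAll I.n (keys s₂).le gs
      have := h.pot_le
      rw [pow_succ]; nlinarith
    have hfl' : (splitAll I.n (keys s₂).le gs).flatten.length ≤ M :=
      (length_flatten_le_pot _).trans (hpot'.trans
        (Nat.mul_le_mul_right _ (Nat.pow_le_pow_right (by omega) hc)))
    refine ⟨_, _, ⟨?_, hq₄.mem, hq₄.cur_eq, hq₄.groups_eq, hq₄.end_eq, ?_, hpot', ?_, ?_, ?_, ?_⟩⟩
    · intro l hl hl'
      rw [hF₄.arr aTup rfl, hF₃.arr aTup rfl]
      exact hr₂ l hl hl'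
    · intro i hi j hj
      rw [cntSum_splitAll I.n _ (Keys.total _) (Keys.trans _) (by omega) hi, h.cnt_eq i hi j hj]
      have hiff := (hK i hi).le_iff (hK j hj)
      have : (∀ c' < c + 1, I.Beats r i j k₀ (blockElem I.n d k₀ c')) ↔
          I.Beats r i j k₀ k ∧ ∀ c' < c, I.Beats r i j k₀ (blockElem I.n d k₀ c') := by
        constructor
        · exact fun h => ⟨h c (by omega), fun c' hc' => h c' (by omega)⟩
        · rintro ⟨h1, h2⟩ c' hc'
          rcases (Nat.lt_succ_iff.1 hc').lt_or_eq with hlt | rfl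
          · exact h2 c' hlt
          · exact h1
      by_cases hb : I.Beats r i j k₀ k
      · rw [if_pos (hiff.2 hb)]
        by_cases hc : ∀ c' < c, I.Beats r i j k₀ (blockElem I.n d k₀ c')
        · rw [if_pos hc, if_pos (this.2 ⟨hb, hc⟩)]
        · rw [if_neg hc, if_neg fun h => hc (this.1 h).2]
      · rw [if_neg fun h => hb (hiff.1 h), if_neg fun h => hb (this.1 h).1]
    · intro l hl x hx
      obtain ⟨l', hl', hx'⟩ := List.mem_flatten.1 (mem_of_mem_splitAll I.n _ hl hx)
      exact h.lt l' hl' x hx'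
    · exact hsl.trans hfl
    · rw [← hM, add_mul, one_mul]; omega
    · rw [← hM, hend₄, hend₃, add_mul _ 1, one_mul]; omega

end Dominance

/-! ### One iteration: all rounds for a fixed `k₀` and `r`, followed by the scan. -/

namespace Dominance

open RAM

variable {h : ℕ} {I : Inst h} {B : ℕ} {s : State} {f r : ℕ → ℕ}

/-! ## One iteration of the outer loop -/

/-- Sort the queue by all keys of the block. -/
noncomputable def roundsProg (H : SimpleGraph (Fin h)) : Prog := forLoop vC (.var vD) (roundProg H)

theorem sum_pairs_eq {n N : ℕ} {gs : List (List ℕ)} (h : ∀ l ∈ gs, ∀ x ∈ l, x < N) :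
    (gs.map (pairs n 0)).sum = ∑ q ∈ Finset.Ico n N, ∑ p ∈ Finset.range n, cntSum q p gs := by
  induction gs with
  | nil => simp [cntSum]
  | cons l gs ih =>
    simp only [List.mem_cons, forall_eq_or_imp] at h
    rw [List.map_cons, List.sum_cons, ih h.2, pairs_eq n 0 h.1, zero_mul, zero_add,
      ← Finset.sum_add_distrib]
    refine Finset.sum_congr rfl fun q _ => ?_
    rw [← Finset.sum_add_distrib]
    exact Finset.sum_congr rfl fun p _ => by simp [cntSum]

open Classical in
/-- Number of pairs for which `k₀` is best in its block. -/
noncomputable def winCount (I : Inst h) (r : ℕ → ℕ) (d k₀ : ℕ) : ℕ :=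
  ∑ j ∈ Finset.range I.n, ∑ i ∈ Finset.range I.n,
    if ∀ c < d, I.Beats r i j k₀ (blockElem I.n d k₀ c) then 1 else 0

/-- Since each winning pair is represented exactly once, the scan does no more work on pairs than
there are winning pairs. -/
theorem RoundInv.sum_pairs {d k₀ g : ℕ} {gs : List (List ℕ)} (h : RoundInv I r d k₀ d g gs s) :
    (gs.map (pairs I.n 0)).sum = winCount I r d k₀ := by
  rw [sum_pairs_eq h.lt, Finset.sum_Ico_eq_sum_range, show 2 * I.n - I.n = I.n by omega]
  exact Finset.sum_congr rfl fun j hj => Finset.sum_congr rfl fun i hi =>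
    h.cnt_eq i (Finset.mem_range.1 hi) j (Finset.mem_range.1 hj)

theorem RoundInv.of_setVar {d k₀ c g : ℕ} {gs : List (List ℕ)} (h : RoundInv I r d k₀ c g gs s)
    (v : ℕ) : RoundInv I r d k₀ c g gs (s.setVar vC v) :=
  ⟨h.rest, h.mem, by simpa using h.cur_eq, by simpa using h.groups_eq, by simpa using h.end_eq,
    h.cnt_eq, h.pot_le, h.lt, h.length_le, h.cur_le, by simpa using h.end_le⟩

theorem Big.maxSize_pos {d : ℕ} (hB : Big I d B) : 2 ≤ maxSize I.n d := by
  have := two_mul_le_maxSize I.n d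
  have := hB.n_pos
  omega

theorem Big.d_lt {d : ℕ} (hB : Big I d B) : d < B := by
  have h1 := hB.maxSize_pos
  have h2 := hB.size_lt
  nlinarith [Nat.zero_le (Nat.clog 2 (maxSize I.n d)), Nat.zero_le d]

theorem roundsProg_spec {d k₀ : ℕ} (hB : Big I d B) (hk₀ : k₀ < I.n) (hs : HasInst I s)
    (hD : s.var vD = d) (hkv : s.var vK₀ = k₀) (hbase : s.var vBase = k₀ / d * d)
    (hr : HasRest h r s) (hgr : Groups (s.arr aStart) (s.arr aPts) 0 [initList I.n])
    (hst : s.arr aStart 0 = 0) (hg : s.var vGroups = 1) (he : s.var vEnd = 2 * I.n)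
    (hc : s.var vCur = 0) :
    Runs B (roundsProg I.H) s (d * (roundCost I.H I.n d + 7) + 5) fun s' =>
      ∃ g gs, RoundInv I r d k₀ d g gs s' := by
  have hM := two_mul_le_maxSize I.n d
  have hM2 := hB.maxSize_pos
  refine (Runs.for_range_const (N := d) (t := roundCost I.H I.n d) (e := .var vD)
    (fun c s' => (∃ g gs, RoundInv I r d k₀ c g gs s') ∧ s'.var vD = d)
    rfl hB.d_lt (fun _ _ h => by simpa only [WExp.eval] using h.2) ⟨⟨0, [initList I.n], ?_⟩, by simpa using hD⟩ ?_).mono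
    (by simp [WExp.cost]) fun _ _ h => h.1
  · refine RoundInv.of_setVar ⟨hr, hgr, hc, by simpa using hg, ?_, ?_, ?_, ?_, ?_, ?_, ?_⟩ 0
    · simp [hst, he, initList_length]
    · intro i hi j hj
      simp [cntSum, cnt_initList hi hj]
    · simp [pot, initList_length]
    · intro l hl x hx
      rw [List.mem_singleton.1 hl] at hx
      exact mem_initList hx
    · simp; omega
    · simp
    · simp [he, hM]
  · rintro c hcd s' hF hC ⟨⟨g, gs, hI⟩, hD'⟩
    refine (roundProg_spec hB hcd hk₀ (hs.of_frame hF rfl rfl rfl rfl) ((hF.var vK₀ rfl).trans hkv)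
      ((hF.var vBase rfl).trans hbase) hC hI).mono le_rfl ?_
    rintro s'' hF' ⟨g', gs', hI'⟩
    refine ⟨⟨g', gs', hI'.of_setVar _⟩, ?_⟩
    simpa [hF'.var vD rfl] using hD'

/-- Determine the vertex `k₀` and its block. -/
def blockProg : Prog :=
  .seq (.setVar vK₀ (.arr aTup (.const 2))) (.setVar vBase (.mul (.div (.var vK₀) (.var vD)) (.var vD)))

/-- Find the tuples with number `vQ` that are best in their blocks. -/
noncomputable def searchProg (H : SimpleGraph (Fin h)) : Prog :=
  .seq (decodeProg h) (.seq blockProg (.seq queueProg (.seq (roundsProg H)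
    -- The rounds have used this cell for the vertices compared with `k₀`.
    (.setArr aTup (.const 2) (.var vK₀)))))

/-- One iteration: check the tuples with number `vQ` that are best in their blocks. -/
noncomputable def iterProg (H : SimpleGraph (Fin h)) : Prog := .seq (searchProg H) (scanAll H)

/-- Time for an iteration, apart from the time for the pairs that are checked. -/
noncomputable def iterCost (H : SimpleGraph (Fin h)) (n d : ℕ) : ℕ :=
  h * 23 + n * 18 + d * (roundCost H n d + 7) + 2 * maxSize n d * scanCost H + 80

theorem iterProg_spec {q d : ℕ} (hh : 3 ≤ h) (hB : Big I d B) (hs : HasInst I s)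
    (hD : s.var vD = d) (hq : s.var vQ = q) (hsound : Sound I s) :
    Runs B (iterProg I.H) s
      (iterCost I.H I.n d + winCount I (digit I.n q) d (digit I.n q 2) * scanCost I.H) fun s' =>
      Sound I s' ∧ (∀ f, Covers I s f → Covers I s' f) ∧
      ∀ i < I.n, ∀ j < I.n, (∀ c < d, I.Beats (digit I.n q) i j (digit I.n q 2)
        (blockElem I.n d (digit I.n q 2) c)) → Covers I s' (tup (digit I.n q) i j (digit I.n q 2)) := by
  have hn2 := hB.two_mul_lt
  have hdig (l : ℕ) : digit I.n q l < I.n := Nat.mod_lt _ hB.n_pos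
  set k₀ := digit I.n q 2 with hk₀
  have hM2 := hB.maxSize_pos
  have hsz := hB.size_lt
  have hV : Valid I (digit I.n q) k₀ B := ⟨hdig 2, fun l _ _ => hdig l,
    fun f => hB.viol_lt f _ le_rfl, hB.h_lt, by omega⟩
  have hpost {s₁ : State} {c : Prog} (hF : Frame c s s₁) (h1 : c.writesVar vFound = false)
      (h2 : c.writesVar vBest = false) (h3 : c.writesReal rBest = false) (h4 : c.writesArr 1 = false) :
      Sound I s₁ ∧ ∀ f, Covers I s f → Covers I s₁ f :=
    ⟨hsound.of_frame hF h1 h2 h3 h4, fun f hf => hf.of_frame hF h1 h2 h3⟩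
  have hfst : Runs B (searchProg I.H) s
      (h * 23 + 7 + (12 + (I.n * 18 + 40 + (d * (roundCost I.H I.n d + 7) + 5 + 3)))) fun s' =>
      HasRest h (digit I.n q) s' ∧ s'.arr aTup 2 = k₀ ∧
        ∃ g gs, RoundInv I (digit I.n q) d k₀ d g gs s' := by
    refine (decodeProg_spec hs.n_eq hq hB.h_lt).seq ?_
    rintro s₁ hF₁ hdec
    have hs₁ := hs.of_frame hF₁ rfl rfl rfl rfl
    have hD₁ := (hF₁.var vD rfl).trans hD
    have h1 : Runs B blockProg s₁ 12 fun s' => s' = (s₁.setVar vK₀ k₀).setVar vBase (k₀ / d * d) := by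
      refine (Runs.of_wp (c := blockProg) ?_).mono (by decide) fun _ _ h => h
      have := Nat.div_mul_le_self k₀ d
      simp only [blockProg, wp, WExp.eval, hdec 2 le_rfl (by omega), ← hk₀, State.setVar_var,
        Nat.reduceEqDiff, reduceIte, hD₁]
      exact ⟨(hdig 2).trans (by omega), this.trans_lt ((hdig 2).trans (by omega)), trivial⟩
    refine h1.seq ?_
    rintro s₂ hF₂ hs₂
    have hI₂ := hs₁.of_frame hF₂ rfl rfl rfl rfl
    refine (queueProg_spec hI₂.n_eq (by omega)).seq ?_
    rintro s₃ hF₃ ⟨hgr, hst, hg, he, hc⟩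
    have hr₃ : HasRest h (digit I.n q) s₃ := fun l hl hl' => by
      rw [hF₃.arr aTup rfl, hF₂.arr aTup rfl]; exact hdec l (by omega) hl'
    have hD₃ := (hF₃.var vD rfl).trans ((hF₂.var vD rfl).trans hD₁)
    have hk₃ : s₃.var vK₀ = k₀ := by rw [hF₃.var vK₀ rfl, hs₂]; simp
    have hb₃ : s₃.var vBase = k₀ / d * d := by rw [hF₃.var vBase rfl, hs₂]; simp
    refine (roundsProg_spec hB (hdig 2) (hI₂.of_frame hF₃ rfl rfl rfl rfl) hD₃ hk₃ hb₃ hr₃ hgr hst hg he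
      hc).seq ?_
    rintro s₄ hF₄ ⟨g, gs, hI⟩
    have hk₄ := (hF₄.var vK₀ rfl).trans hk₃
    refine Runs.of_wp (c := .setArr aTup (.const 2) (.var vK₀)) ?_
    simp only [wp, WExp.eval, hk₄]
    refine ⟨(hdig 2).trans (by omega), fun l hl hl' => ?_, by simp, g, gs, ?_⟩
    · rw [State.setArr_arr, if_pos rfl, Function.update_of_ne (by omega)]
      exact hI.rest l hl hl'
    · refine ⟨fun l hl hl' => ?_, ?_, hI.cur_eq, hI.groups_eq, ?_, hI.cnt_eq, hI.pot_le, hI.lt,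
        hI.length_le, hI.cur_le, hI.end_le⟩
      · rw [State.setArr_arr, if_pos rfl, Function.update_of_ne (by omega)]
        exact hI.rest l hl hl'
      · simpa using hI.mem
      · simpa using hI.end_eq
  refine (hfst.seq (t' := 2 * maxSize I.n d * scanCost I.H +
    winCount I (digit I.n q) d k₀ * scanCost I.H + 3) ?_).mono (by rw [iterCost]; omega) fun _ _ h => h
  rintro s₁ hF₁ ⟨hr, hmid, g, gs, hI⟩
  obtain ⟨hs₁, hc₁⟩ := hpost hF₁ rfl rfl rfl rfl
  have hle := hI.length_le
  have hcl := hI.cur_le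
  have hfl : gs.flatten.length ≤ maxSize I.n d := (length_flatten_le_pot gs).trans hI.pot_le
  have hadd : (d + Nat.clog 2 (maxSize I.n d) + 4) * maxSize I.n d = d * maxSize I.n d +
    (Nat.clog 2 (maxSize I.n d) + 3) * maxSize I.n d + maxSize I.n d := by ring
  refine (scanAll_spec hV ⟨hs.of_frame hF₁ rfl rfl rfl rfl, hr, hmid, hs₁⟩ hI.lt hI.mem hI.cur_eq
    hI.groups_eq (by omega)).mono ?_ ?_
  · rw [hI.sum_pairs]
    nlinarith [Nat.mul_le_mul_right (scanCost I.H) (add_le_add hfl hle)]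
  · rintro s₂ hF₂ ⟨hb₂, hmono, hcov⟩
    refine ⟨hb₂.sound, fun f hf => hmono f (hc₁ f hf), fun i hi j hj hbeat => ?_⟩
    have := hcov (I.n + j) i (by omega) hi (by rw [hI.cnt_eq i hi j hj, if_pos hbeat]; exact one_pos)
    rwa [Nat.add_sub_cancel_left] at this

end Dominance

/-! ### Winners of blocks, the total number of reported pairs, and the outer loop. -/

namespace Dominance

open RAM

variable {h : ℕ} {I : Inst h} {B : ℕ} {s : State} {f r : ℕ → ℕ}

/-! ## Winners of blocks -/

theorem tup_congr {r r' : ℕ → ℕ} (h : ∀ l, 3 ≤ l → r l = r' l) (i j k : ℕ) :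
    tup r i j k = tup r' i j k := by
  funext l
  unfold tup
  split_ifs with h1 h2 h3
  · rfl
  · rfl
  · rfl
  · exact h l (by omega)

variable (I) in
/-- The lexicographic key by which the best vertex of a block is chosen. -/
noncomputable def winKey (r : ℕ → ℕ) (i j k : ℕ) : ℕ ×ₗ (ℝᵒᵈ ×ₗ ℕ) :=
  toLex (I.violAll (tup r i j k), toLex (OrderDual.toDual (I.wtAll (tup r i j k)), k))

/-- Weights are to be maximized, hence the dual order. The vertex as last component makes the key
injective in `k`. -/
theorem beats_iff {i j k k' : ℕ} : I.Beats r i j k k' ↔ winKey I r i j k ≤ winKey I r i j k' := by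
  simp only [Inst.Beats, winKey, Prod.Lex.toLex_le_toLex, OrderDual.toDual_lt_toDual,
    OrderDual.toDual_inj]
  refine or_congr_right (and_congr_right fun _ => ?_)
  rcases lt_trichotomy (I.wtAll (tup r i j k')) (I.wtAll (tup r i j k)) with h | h | h
  · simp [h, h.le]
  · simp [h]
  · simp [h.not_gt, h.not_ge, h.ne]

theorem blockElem_div {n d k₀ c : ℕ} (hk : k₀ < n) (hc : c < d) :
    blockElem n d k₀ c < n ∧ blockElem n d k₀ c / d = k₀ / d := by
  have h1 := Nat.div_mul_le_self k₀ d
  refine ⟨by unfold blockElem; omega, ?_⟩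
  have h2 := Nat.div_add_mod k₀ d
  have h3 := Nat.mod_lt k₀ (by omega : 0 < d)
  rw [mul_comm] at h2
  have h4 : (k₀ / d + 1) * d = k₀ / d * d + d := by ring
  rw [Nat.div_eq_iff (by omega)]
  unfold blockElem
  omega

theorem exists_blockElem_eq {n d k₀ k : ℕ} (hd : 0 < d) (hk : k < n) (hkk : k / d = k₀ / d) :
    ∃ c < d, blockElem n d k₀ c = k := by
  have h2 := Nat.div_add_mod k d
  have h3 := Nat.mod_lt k hd
  rw [mul_comm] at h2
  refine ⟨k % d, h3, ?_⟩
  rw [blockElem, ← hkk]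
  omega

variable (I) in
/-- The vertex `k₀` is the best one of its block. -/
def Wins (r : ℕ → ℕ) (d i j k₀ : ℕ) : Prop := ∀ c < d, I.Beats r i j k₀ (blockElem I.n d k₀ c)

/-- Take a minimum of `winKey` over the block of `k`. Hence checking only winners of blocks
suffices. -/
theorem exists_wins {d k : ℕ} (hk : k < I.n) (r : ℕ → ℕ) (i j : ℕ) :
    ∃ k₀ < I.n, Wins I r d i j k₀ ∧ I.Beats r i j k₀ k := by
  obtain ⟨k₀, hk₀, hmin⟩ := ((Finset.range I.n).filter fun k' => k' / d = k / d).exists_min_image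
    (winKey I r i j) ⟨k, by simp [hk]⟩
  simp only [Finset.mem_filter, Finset.mem_range] at hk₀ hmin
  refine ⟨k₀, hk₀.1, fun c hc => beats_iff.2 (hmin _ ?_), beats_iff.2 (hmin k ⟨hk, rfl⟩)⟩
  obtain ⟨h1, h2⟩ := blockElem_div hk₀.1 hc
  exact ⟨h1, h2.trans hk₀.2⟩

/-- Two winners of the same block beat each other, so their keys agree, including the vertex. -/
theorem Wins.unique {d i j k k' : ℕ} (hd : 0 < d) (hk : k < I.n) (hk' : k' < I.n)
    (h : Wins I r d i j k) (h' : Wins I r d i j k') (hkk : k / d = k' / d) : k = k' := by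
  obtain ⟨c, hc, hck⟩ := exists_blockElem_eq hd hk hkk
  obtain ⟨c', hc', hck'⟩ := exists_blockElem_eq hd hk' hkk.symm
  have h1 := beats_iff.1 (hck ▸ h' c hc)
  have h2 := beats_iff.1 (hck' ▸ h c' hc')
  have h3 := le_antisymm h1 h2
  simp only [winKey, EmbeddingLike.apply_eq_iff_eq, Prod.mk.injEq] at h3
  exact h3.2.2.symm

-- The map `k ↦ k / d` is injective on winners, and it takes at most `I.n / d + 1` values. This is
-- where the factor of order `d` is saved.
open Classical in
theorem sum_wins_le {d : ℕ} (hd : 0 < d) (r : ℕ → ℕ) (i j : ℕ) :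
    ∑ k ∈ Finset.range I.n, (if Wins I r d i j k then 1 else 0) ≤ I.n / d + 1 := by
  rw [← Finset.card_filter]
  conv_rhs => rw [← Finset.card_range (I.n / d + 1)]
  refine Finset.card_le_card_of_injOn (· / d) (fun k hk => ?_) fun k hk k' hk' hkk => ?_
  · simp only [Finset.coe_filter, Finset.mem_range, Set.mem_ofPred_eq] at hk
    simp only [Finset.coe_range, Set.mem_Iio]
    exact Nat.lt_succ_of_le (Nat.div_le_div_right hk.1.le)
  · simp only [Finset.coe_filter, Finset.mem_range, Set.mem_ofPred_eq] at hk hk'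
    exact Wins.unique hd hk.1 hk'.1 hk.2 hk'.2 hkk

theorem sum_range_mul (F : ℕ → ℕ) (n m : ℕ) :
    ∑ q ∈ Finset.range (n * m), F q = ∑ p ∈ Finset.range m, ∑ k ∈ Finset.range n, F (n * p + k) := by
  induction m with
  | zero => simp
  | succ m ih => rw [mul_add_one, Finset.sum_range_add, ih, Finset.sum_range_succ]

/-- The image of vertex `2` is the lowest digit of the tuple number. So for fixed `p` the numbers
`I.n * p + k` run through all `k` with the same remaining entries, and for each of the pairs `i`,
`j` one counts the winners of blocks. -/
theorem sum_winCount_le {d : ℕ} (hd : 0 < d) (m : ℕ) :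
    ∑ q ∈ Finset.range (I.n ^ (m + 1)), winCount I (digit I.n q) d (digit I.n q 2) ≤
      I.n ^ m * (I.n * (I.n * (I.n / d + 1))) := by
  classical
  rw [pow_succ', sum_range_mul]
  refine (Finset.sum_le_card_nsmul _ _ (I.n * (I.n * (I.n / d + 1))) fun p _ => ?_).trans
    (by simp)
  have h1 : ∀ k ∈ Finset.range I.n, winCount I (digit I.n (I.n * p + k)) d (digit I.n (I.n * p + k) 2) =
      ∑ j ∈ Finset.range I.n, ∑ i ∈ Finset.range I.n,
        if Wins I (fun l => p / I.n ^ (l - 3) % I.n) d i j k then 1 else 0 := by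
    intro k hk
    rw [Finset.mem_range] at hk
    have h2 : digit I.n (I.n * p + k) 2 = k := by simp [digit, Nat.mod_eq_of_lt hk]
    have h3 : ∀ l, 3 ≤ l → digit I.n (I.n * p + k) l = p / I.n ^ (l - 3) % I.n := by
      intro l hl
      have h4 : (I.n * p + k) / I.n = p := by
        rw [Nat.mul_add_div (by omega), Nat.div_eq_of_lt hk, add_zero]
      rw [digit, show l - 2 = (l - 3) + 1 by omega, pow_succ', ← Nat.div_div_eq_div_mul, h4]
    rw [h2]
    refine Finset.sum_congr rfl fun j _ => Finset.sum_congr rfl fun i _ => ?_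
    refine if_congr ?_ rfl rfl
    simp only [Wins, Inst.Beats, tup_congr h3]
  rw [Finset.sum_congr rfl h1, Finset.sum_comm]
  refine (Finset.sum_le_card_nsmul _ _ (I.n * (I.n / d + 1)) fun j _ => ?_).trans (by simp)
  rw [Finset.sum_comm]
  exact (Finset.sum_le_card_nsmul _ _ _ fun i _ => sum_wins_le hd _ i j).trans (by simp)

theorem exists_digits {n : ℕ} (m : ℕ) (f : ℕ → ℕ) (hf : ∀ x < m, f x < n) :
    ∃ q < n ^ m, ∀ x < m, q / n ^ x % n = f x := by
  induction m generalizing f with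
  | zero => exact ⟨0, by simp, by simp⟩
  | succ m ih =>
    obtain ⟨q, hq, hd⟩ := ih (fun x => f (x + 1)) fun x hx => hf _ (by omega)
    have h0 := hf 0 (by omega)
    refine ⟨n * q + f 0, ?_, fun x hx => ?_⟩
    · rw [pow_succ']
      calc n * q + f 0 < n * q + n := by omega
        _ = n * (q + 1) := by ring
        _ ≤ n * n ^ m := Nat.mul_le_mul_left _ hq
    · cases x with
      | zero => simp [Nat.mod_eq_of_lt h0]
      | succ x =>
        rw [pow_succ', ← Nat.div_div_eq_div_mul, Nat.mul_add_div (by omega), Nat.div_eq_of_lt h0,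
          add_zero]
        exact hd x (by omega)

/-! ## The outer loop -/

theorem violAll_congr {f g : ℕ → ℕ} (h' : ∀ l < h, f l = g l) : I.violAll f = I.violAll g :=
  Inst.viol_congr _ fun p _ => ⟨h' _ p.1.2, h' _ p.2.2⟩

theorem wtAll_congr {f g : ℕ → ℕ} (h' : ∀ l < h, f l = g l) : I.wtAll f = I.wtAll g :=
  Inst.wt_congr _ fun p _ => ⟨h' _ p.1.2, h' _ p.2.2⟩

theorem Covers.of_beats {i j k₀ k : ℕ} {g : ℕ → ℕ} (hc : Covers I s (tup r i j k₀))
    (hb : I.Beats r i j k₀ k) (hg : ∀ l < h, tup r i j k l = g l) : Covers I s g := by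
  rw [Inst.Beats, violAll_congr hg, wtAll_congr hg] at hb
  refine ⟨hc.1, ?_⟩
  rcases hc.2 with h1 | ⟨h1, h2⟩ <;> rcases hb with h3 | ⟨h3, h4, -⟩
  · exact Or.inl (h1.trans h3)
  · exact Or.inl (h3 ▸ h1)
  · exact Or.inl (h1 ▸ h3)
  · exact Or.inr ⟨h1.trans h3, h4.trans h2⟩

/-- The loop over all tuple numbers. -/
noncomputable def searchAll (H : SimpleGraph (Fin h)) : Prog := forLoop vQ (.var vNumQ) (iterProg H)

/-- The time bound sums the reported pairs over all iterations instead of bounding each iteration.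
The bounds `Big` are needed only for `0 < I.n`, because otherwise the loop has no iteration. -/
theorem searchAll_spec {d : ℕ} (hh : 3 ≤ h) (hd : 0 < d) (hB : 0 < I.n → Big I d B) (hs : HasInst I s)
    (hD : s.var vD = d) (hN : s.var vNumQ = I.n ^ (h - 2)) (hNB : I.n ^ (h - 2) < B)
    (hfound : s.var vFound = 0) :
    Runs B (searchAll I.H) s (I.n ^ (h - 2) * (iterCost I.H I.n d + 7) +
      I.n ^ (h - 3) * (I.n * (I.n * (I.n / d + 1))) * scanCost I.H + 5) fun s' =>
      Sound I s' ∧ ∀ g : ℕ → ℕ, (∀ l < h, g l < I.n) → Covers I s' g := by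
  have hcost : ∑ q ∈ Finset.range (I.n ^ (h - 2)), (iterCost I.H I.n d +
      winCount I (digit I.n q) d (digit I.n q 2) * scanCost I.H + (WExp.cost (.var vNumQ) + 6)) +
      (WExp.cost (.var vNumQ) + 4) ≤ I.n ^ (h - 2) * (iterCost I.H I.n d + 7) +
      I.n ^ (h - 3) * (I.n * (I.n * (I.n / d + 1))) * scanCost I.H + 5 := by
    have h1 := Nat.mul_le_mul_right (scanCost I.H) (sum_winCount_le (I := I) hd (h - 3))
    rw [show h - 3 + 1 = h - 2 by omega] at h1
    simp only [Finset.sum_add_distrib, ← Finset.sum_mul, Finset.sum_const, Finset.card_range, smul_eq_mul,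
      WExp.cost] at h1 ⊢
    linarith
  refine (Runs.for_range (N := I.n ^ (h - 2)) (e := .var vNumQ) (fun q s' =>
    (Sound I s' ∧ ∀ q' < q, ∀ i < I.n, ∀ j < I.n, Wins I (digit I.n q') d i j (digit I.n q' 2) →
      Covers I s' (tup (digit I.n q') i j (digit I.n q' 2))) ∧ s'.var vNumQ = I.n ^ (h - 2))
    (fun q => iterCost I.H I.n d + winCount I (digit I.n q) d (digit I.n q 2) * scanCost I.H) rfl hNB
    (fun _ _ h => by simpa only [WExp.eval] using h.2) ⟨⟨Or.inl (by simpa using hfound), by simp⟩,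
      by simpa using hN⟩ ?_).mono hcost ?_
  · rintro q hq s' hF hQ ⟨⟨hsd, hcov⟩, hN'⟩
    have hn : 0 < I.n := by
      rcases Nat.eq_zero_or_pos I.n with h0 | h0
      · rw [h0, zero_pow_eq] at hq
        split_ifs at hq with h1
        · omega
        · omega
      · exact h0
    refine (iterProg_spec hh (hB hn) (hs.of_frame hF rfl rfl rfl rfl) ((hF.var vD rfl).trans hD) hQ
      hsd).mono le_rfl ?_
    rintro s'' hF' ⟨h1, h2, h3⟩
    refine ⟨⟨?_, fun q' hq' i hi j hj hw => ?_⟩, ?_⟩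
    · simpa [Sound] using h1
    · have : Covers I s'' (tup (digit I.n q') i j (digit I.n q' 2)) := by
        rcases (Nat.lt_succ_iff.1 hq').lt_or_eq with hlt | rfl
        · exact h2 _ (hcov q' hlt i hi j hj hw)
        · exact h3 i hi j hj hw
      simpa [Covers] using this
    · simpa [hF'.var vNumQ rfl] using hN'
  · rintro s' - ⟨⟨hsd, hcov⟩, -⟩
    refine ⟨hsd, fun g hg => ?_⟩
    -- Replace the entry `g 2` by the winner of its block; the resulting tuple is checked in
    -- iteration `q` and is at least as good as `g`.
    obtain ⟨k₀, hk₀, hw, hb⟩ := exists_wins (d := d) (hg 2 (by omega)) g (g 0) (g 1)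
    obtain ⟨q, hq, hdig⟩ := exists_digits (h - 2) (fun x => if x = 0 then k₀ else g (x + 2))
      (n := I.n) fun x hx => by
        split_ifs
        · exact hk₀
        · exact hg _ (by omega)
    have h2 : digit I.n q 2 = k₀ := by simpa [digit] using hdig 0 (by omega)
    have h3 : ∀ l, 3 ≤ l → l < h → digit I.n q l = g l := fun l hl hl' => by
      rw [digit, hdig (l - 2) (by omega), if_neg (by omega), show l - 2 + 2 = l by omega]
    have h4 (k : ℕ) : ∀ l < h, tup (digit I.n q) (g 0) (g 1) k l = tup g (g 0) (g 1) k l := by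
      intro l hl
      unfold tup
      split_ifs with h5 h6 h7
      · rfl
      · rfl
      · rfl
      · exact h3 l (by omega) hl
    have h5 (k k' : ℕ) : I.Beats (digit I.n q) (g 0) (g 1) k k' ↔ I.Beats g (g 0) (g 1) k k' := by
      simp only [Inst.Beats, violAll_congr (h4 k), wtAll_congr (h4 k), violAll_congr (h4 k'),
        wtAll_congr (h4 k')]
    refine (hcov q hq (g 0) (hg 0 (by omega)) (g 1) (hg 1 (by omega)) ?_).of_beats (k := g 2) ?_ ?_
    · rw [h2]; exact fun c hc => (h5 _ _).2 (hw c hc)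
    · rw [h2]; exact (h5 _ _).2 hb
    · intro l hl
      rw [h4 _ l hl]
      unfold tup
      split_ifs with h6 h7 h8
      · rw [h6]
      · rw [h7]
      · rw [h8]
      · rfl

end Dominance

/-! ### Block length, number of tuples, and the complete program. -/

namespace Dominance

open RAM

variable {h : ℕ} {I : Inst h} {B : ℕ} {s : State} {f r : ℕ → ℕ}

/-! ## The whole program -/

/-- Compute the block length. -/
def blockLengthProg : Prog :=
  .seq (.setVar vD (.const 1)) (.seq (.setVar vPow (.const 1))
    (.while (.wlt (.mul (.var vPow) (.const 256)) (.add (.var vN) (.const 1)))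
      (.seq (.setVar vPow (.mul (.var vPow) (.const 256))) (.setVar vD (.add (.var vD) (.const 1))))))

theorem blockLengthProg_spec (hn : s.var vN = n) (hnB : n + 1 < B) :
    Runs B blockLengthProg s (Nat.log 256 n * 15 + 11) fun s' => s'.var vD = Nat.log 256 n + 1 := by
  have h1 : Runs B (.setVar vD (.const 1)) s 2 fun s' => s' = s.setVar vD 1 :=
    Runs.of_wp (c := .setVar vD (.const 1)) ⟨by simp [WExp.eval]; omega, rfl⟩
  refine (h1.seq (t' := Nat.log 256 n * 15 + 9) ?_).mono (by omega) fun _ _ h => h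
  rintro s₁ - rfl
  have h2 : Runs B (.setVar vPow (.const 1)) (s.setVar vD 1) 2
      fun s' => s' = (s.setVar vD 1).setVar vPow 1 :=
    Runs.of_wp (c := .setVar vPow (.const 1)) ⟨by simp [WExp.eval]; omega, rfl⟩
  refine (h2.seq (t' := Nat.log 256 n * 15 + 7) ?_).mono (by omega) fun _ _ h => h
  rintro s₂ - rfl
  -- The alternative `e = 0` is there for `n = 0`, where even `256 ^ 0 ≤ n` fails.
  refine Runs.while (fun s' τ => ∃ e, s'.var vD = e + 1 ∧ s'.var vPow = 256 ^ e ∧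
    (e = 0 ∨ 256 ^ e ≤ n) ∧ τ = (Nat.log 256 n - e) * 15 + 7) ⟨0, by simp, by simp, by simp, rfl⟩ ?_ ?_
  · rintro s' τ hF ⟨e, hD, hP, he, rfl⟩ hb
    have hn' : s'.var vN = n := (hF.var vN rfl).trans (by simpa using hn)
    simp only [Test.holds, WExp.eval, hP, hn', ← pow_succ] at hb
    have hlog : e + 1 ≤ Nat.log 256 n := Nat.le_log_of_pow_le (by omega) (by omega)
    refine ⟨8, (Nat.log 256 n - (e + 1)) * 15 + 7, ?_, (Runs.of_wp ?_).mono (by decide) fun _ _ h => h⟩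
    · simp only [Test.cost, WExp.cost]; omega
    · simp only [wp, WExp.eval, hP, ← pow_succ, State.setVar_var, hD]
      have := Nat.lt_pow_self (n := e + 1) (a := 256) (by omega)
      refine ⟨by omega, by simp; omega, e + 1, by simp, by simp, Or.inr (by omega), rfl⟩
  · rintro s' τ hF ⟨e, hD, hP, he, rfl⟩ hb
    have hn' : s'.var vN = n := (hF.var vN rfl).trans (by simpa using hn)
    simp only [Test.holds, WExp.eval, hP, hn', ← pow_succ] at hb
    refine ⟨by simp only [Test.cost, WExp.cost]; omega, ?_⟩
    rw [hD]
    rcases he with rfl | he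
    · rw [Nat.log_of_lt (by omega)]
    · rw [Nat.log_eq_of_pow_le_of_lt_pow he (by omega)]

/-- Compute the number of tuples. -/
def countProg (h : ℕ) : Prog :=
  .seq (.setVar vNumQ (.const 1))
    (forLoop vX (.const (h - 2)) (.setVar vNumQ (.mul (.var vNumQ) (.var vN))))

theorem countProg_spec {n m : ℕ} (hn : s.var vN = n) (hmB : m < B) (hB : ∀ x ≤ m, n ^ x < B) :
    Runs B (countProg (m + 2)) s (m * 11 + 7) fun s' => s'.var vNumQ = n ^ m := by
  have h1 : Runs B (.setVar vNumQ (.const 1)) s 2 fun s' => s' = s.setVar vNumQ 1 :=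
    Runs.of_wp (c := .setVar vNumQ (.const 1)) ⟨by simpa [WExp.eval] using hB 0 (by omega), rfl⟩
  refine (h1.seq (t' := m * 11 + 5) ?_).mono (by omega) fun _ _ h => h
  rintro s₁ - rfl
  refine (Runs.for_range_const (N := m) (t := 4) (e := .const m) (fun x s' => s'.var vNumQ = n ^ x)
    rfl hmB (fun _ _ _ => rfl) (by simp) ?_).mono (by simp [WExp.cost]) fun _ _ h => h
  rintro x hx s' hF hX hN
  have hn' : s'.var vN = n := (hF.var vN rfl).trans (by simpa using hn)
  refine (Runs.of_wp ?_).mono (by decide) fun _ _ h => h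
  simp only [wp, WExp.eval, hN, hn', ← pow_succ]
  exact ⟨hB _ hx, by simp⟩

/-- Report whether an induced copy was found. -/
def reportProg : Prog :=
  .ite (.and (.weq (.var vFound) (.const 1)) (.weq (.var vBest) (.const 0)))
    (.setVar vRes (.const 1)) (.setVar vRes (.const 0))

/-- Find the best tuple. -/
noncomputable def mainProg (H : SimpleGraph (Fin h)) : Prog :=
  .seq blockLengthProg (.seq (countProg h) (.seq (searchAll H) reportProg))

/-- Time for the whole program. -/
noncomputable def mainCost (H : SimpleGraph (Fin h)) (n : ℕ) : ℕ :=
  n ^ (h - 2) * (iterCost H n (Nat.log 256 n + 1) + 7) +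
    n ^ (h - 3) * (n * (n * (n / (Nat.log 256 n + 1) + 1))) * scanCost H +
    Nat.log 256 n * 15 + h * 11 + 40

variable (I) in
/-- The output describes a tuple without violations of maximum weight. -/
def Correct (s : State) : Prop :=
  (s.var vRes = 1 ∧ ∃ f : ℕ → ℕ, (∀ l < h, f l < I.n) ∧ (∀ l < h, s.arr 1 l = f l) ∧
    I.violAll f = 0 ∧ ∀ g : ℕ → ℕ, (∀ l < h, g l < I.n) → I.violAll g = 0 → I.wtAll g ≤ I.wtAll f) ∨
  (s.var vRes = 0 ∧ ∀ g : ℕ → ℕ, (∀ l < h, g l < I.n) → I.violAll g ≠ 0)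

/-- The stored tuple is at least as good as every tuple. So some tuple without violations exists
exactly if the stored one has none, and then it has maximum weight among them. -/
theorem mainProg_spec (hh : 3 ≤ h) (hB : 0 < I.n → Big I (Nat.log 256 I.n + 1) B) (hs : HasInst I s)
    (hnB : I.n + 1 < B) (hhB : h < B) (hpow : ∀ x ≤ h - 2, I.n ^ x < B) (hfound : s.var vFound = 0) :
    Runs B (mainProg I.H) s (mainCost I.H I.n) (Correct I) := by
  have hcount {s : State} (hn : s.var vN = I.n) :
      Runs B (countProg h) s ((h - 2) * 11 + 7) fun s' => s'.var vNumQ = I.n ^ (h - 2) := by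
    have := countProg_spec (m := h - 2) hn (by omega) hpow
    rwa [show h - 2 + 2 = h by omega] at this
  refine ((blockLengthProg_spec hs.n_eq hnB).seq (t' := (h - 2) * 11 + 7 + ((I.n ^ (h - 2) *
    (iterCost I.H I.n (Nat.log 256 I.n + 1) + 7) + I.n ^ (h - 3) *
    (I.n * (I.n * (I.n / (Nat.log 256 I.n + 1) + 1))) * scanCost I.H + 5) + 20)) ?_).mono
    (by rw [mainCost]; omega) fun _ _ h => h
  rintro s₁ hF₁ hD₁
  have hs₁ := hs.of_frame hF₁ rfl rfl rfl rfl
  refine (hcount hs₁.n_eq).seq ?_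
  rintro s₂ hF₂ hN₂
  refine (searchAll_spec hh (Nat.succ_pos _) hB (hs₁.of_frame hF₂ rfl rfl rfl rfl)
    ((hF₂.var vD rfl).trans hD₁) hN₂ (hpow _ le_rfl)
    ((hF₂.var vFound rfl).trans ((hF₁.var vFound rfl).trans hfound))).seq ?_
  rintro s₃ - ⟨hsd, hcov⟩
  refine (Runs.of_wp (c := reportProg) ?_).mono (by decide) fun _ _ h => h
  simp only [reportProg, wp, WExp.eval, Test.holds]
  refine ⟨fun ⟨h1, h2⟩ => ⟨by omega, Or.inl ⟨by simp, ?_⟩⟩, fun hne => ⟨by omega, Or.inr ⟨by simp, ?_⟩⟩⟩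
  · rcases hsd with h0 | ⟨-, f, hf, hout, hv, hw⟩
    · omega
    · refine ⟨f, hf, fun l hl => by simpa using hout l hl, by omega, fun g hg hg0 => ?_⟩
      rcases (hcov g hg).2 with h3 | ⟨-, h3⟩
      · omega
      · rwa [← hw]
  · intro g hg hg0
    obtain ⟨h1, h2⟩ := hcov g hg
    exact hne ⟨h1, by omega⟩

end Dominance

/-! ### Estimates: queue size, word size and running time. -/

namespace Dominance

open RAM

variable {h : ℕ} {I : Inst h}

/-! ## Estimates -/

theorem rt_sq_le {m : ℕ} (hm : 2 ≤ m) : rt m ^ 2 ≤ 4 * m := by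
  have h1 : 2 ^ (Nat.clog 2 m).pred < m := Nat.pow_pred_clog_lt_self (by omega) (by omega)
  have h2 : 0 < Nat.clog 2 m := Nat.clog_pos (by omega) hm
  calc rt m ^ 2 = 2 ^ ((Nat.clog 2 m + 1) / 2 * 2) := by rw [rt, pow_mul]
    _ ≤ 2 ^ ((Nat.clog 2 m).pred + 2) := Nat.pow_le_pow_right (by omega)
      (by rw [Nat.pred_eq_sub_one]; omega)
    _ ≤ 4 * m := by rw [pow_add]; omega

/-- As `256 = 4 ^ 4`, the growth `4 ^ d` costs only a factor of order n^(1/4) on top of n^(3/2). The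
result n^(7/4) is below n² by a power of n, which absorbs all logarithms. Fourth powers keep the
statement in the naturals. -/
theorem maxSize_pow_four_le {n : ℕ} (hn : 0 < n) : maxSize n (Nat.log 256 n + 1) ^ 4 ≤ 2 ^ 18 * n ^ 7 := by
  have h1 := rt_sq_le (m := 2 * n) (by omega)
  have h2 : 256 ^ Nat.log 256 n ≤ n := Nat.pow_log_le_self _ (by omega)
  calc maxSize n (Nat.log 256 n + 1) ^ 4
      = 2 ^ 12 * n ^ 4 * (4 ^ Nat.log 256 n) ^ 4 * (rt (2 * n) ^ 2) ^ 2 := by rw [maxSize]; ring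
    _ = 2 ^ 12 * n ^ 4 * 256 ^ Nat.log 256 n * (rt (2 * n) ^ 2) ^ 2 := by
      rw [← pow_mul 4, mul_comm _ 4, pow_mul 4]; norm_num
    _ ≤ 2 ^ 12 * n ^ 4 * n * (4 * (2 * n)) ^ 2 := by gcongr
    _ = 2 ^ 18 * n ^ 7 := by ring

/-- A cruder bound that suffices for word sizes and for logarithms. -/
theorem maxSize_le {n : ℕ} (hn : 0 < n) : maxSize n (Nat.log 256 n + 1) ≤ 32 * n ^ 2 := by
  refine le_of_pow_le_pow_left₀ (n := 4) (by omega) (Nat.zero_le _) ((maxSize_pow_four_le hn).trans ?_)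
  calc 2 ^ 18 * n ^ 7 ≤ 2 ^ 20 * n ^ 8 :=
        Nat.mul_le_mul (by norm_num) (Nat.pow_le_pow_right hn (by omega))
    _ = (32 * n ^ 2) ^ 4 := by ring

theorem allPairs_length_le (h : ℕ) : (allPairs h).length ≤ h * h := by
  refine (List.length_filter_le _ _).trans ?_
  rw [List.length_product, List.length_finRange]

/-- Of the exponent, `4` is for addresses, which are O(n⁴), `7` absorbs their constant 1220 because
`I.n + 2` is at least `3`, and `2 * h` provides for violation counts, which are at most 2h². -/
theorem big_of_adj_le (hadj : ∀ i, I.adj i ≤ 1) (hn : 0 < I.n) :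
    Big I (Nat.log 256 I.n + 1) ((I.n + 2) ^ (2 * h + 11)) := by
  have hpow (a b : ℕ) (hab : a ≤ b) : 2 ^ a ≤ (I.n + 2) ^ b :=
    (Nat.pow_le_pow_left (by omega) a).trans (Nat.pow_le_pow_right (by omega) hab)
  have hh : h < 2 ^ h := Nat.lt_two_pow_self
  refine ⟨hn, ?_, fun f L hL => ?_, hh.trans_le (hpow _ _ (by omega))⟩
  · have hM := maxSize_le hn
    set M := maxSize I.n (Nat.log 256 I.n + 1)
    have h1 : Nat.clog 2 M ≤ M := Nat.clog_le_of_le_pow Nat.lt_two_pow_self.le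
    have h2 : Nat.log 256 I.n ≤ I.n := Nat.log_le_self _ _
    have h3 : Nat.log 256 I.n + 1 + Nat.clog 2 M + 4 ≤ 38 * I.n ^ 2 := by
      nlinarith
    calc (Nat.log 256 I.n + 1 + Nat.clog 2 M + 4) * M + 4
        ≤ 38 * I.n ^ 2 * (32 * I.n ^ 2) + 4 * I.n ^ 4 := by
          have : 1 ≤ I.n ^ 4 := Nat.one_le_pow _ _ hn
          have := Nat.mul_le_mul h3 hM
          omega
      _ = 1220 * I.n ^ 4 := by ring
      _ < 3 ^ 7 * (I.n + 2) ^ 4 := by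
          have : I.n ^ 4 < (I.n + 2) ^ 4 := Nat.pow_lt_pow_left (by omega) (by omega)
          omega
      _ ≤ (I.n + 2) ^ 7 * (I.n + 2) ^ 4 := Nat.mul_le_mul_right _ (Nat.pow_le_pow_left (by omega) _)
      _ = (I.n + 2) ^ 11 := by ring
      _ ≤ (I.n + 2) ^ (2 * h + 11) := Nat.pow_le_pow_right (by omega) (by omega)
  · have h1 := Inst.viol_le hadj f L
    have h2 := allPairs_length_le h
    have h3 : h * h < 2 ^ h * 2 ^ h := Nat.mul_lt_mul'' hh hh
    have h4 := hpow (2 * h + 1) (2 * h + 11) (by omega)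
    rw [pow_succ, two_mul, pow_add] at h4
    rw [two_mul]
    omega

/-! ## The running time -/

section Time

local notation "L" => fun n : ℕ => Real.log (n : ℝ)
local notation "U" => fun n : ℕ => (n : ℝ) ^ (7 / 4 : ℝ)

theorem tendsto_log_natCast : Tendsto L atTop atTop :=
  Real.tendsto_log_atTop.comp tendsto_natCast_atTop_atTop

theorem one_isBigO_log : (fun _ : ℕ => (1 : ℝ)) =O[atTop] L := by
  refine IsBigO.of_bound' ?_
  filter_upwards [tendsto_log_natCast.eventually_ge_atTop 1] with n hn
  simpa [abs_of_nonneg (zero_le_one.trans hn)] using hn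

theorem natLog_isBigO : (fun n : ℕ => ((Nat.log 256 n + 1 : ℕ) : ℝ)) =O[atTop] L := by
  have h1 : (fun n : ℕ => ((Nat.log 256 n : ℕ) : ℝ)) =O[atTop] L := by
    refine IsBigO.of_bound 1 ?_
    filter_upwards [eventually_ge_atTop 1] with n hn
    have h2 : ((256 ^ Nat.log 256 n : ℕ) : ℝ) ≤ n := by
      exact_mod_cast Nat.pow_log_le_self 256 (by omega)
    have h3 := Real.log_le_log (by positivity) h2
    rw [Nat.cast_pow, Real.log_pow] at h3
    have h4 : (1 : ℝ) ≤ Real.log ((256 : ℕ) : ℝ) := by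
      rw [Real.le_log_iff_exp_le (by norm_num)]
      exact Real.exp_one_lt_d9.le.trans (by norm_num)
    have h5 : (0 : ℝ) ≤ Real.log n := Real.log_nonneg (by exact_mod_cast hn)
    simp only [Real.norm_eq_abs, Nat.abs_cast, abs_of_nonneg h5, one_mul]
    nlinarith [(Nat.log 256 n).cast_nonneg (α := ℝ)]
  simpa using h1.add one_isBigO_log

theorem maxSize_isBigO : (fun n : ℕ => (maxSize n (Nat.log 256 n + 1) : ℝ)) =O[atTop] U := by
  refine IsBigO.of_bound 32 ?_
  filter_upwards [eventually_ge_atTop 1] with n hn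
  have h1 : (0 : ℝ) ≤ n := Nat.cast_nonneg n
  have h2 : ((maxSize n (Nat.log 256 n + 1) : ℕ) : ℝ) ^ 4 ≤ 2 ^ 18 * (n : ℝ) ^ 7 := by
    exact_mod_cast maxSize_pow_four_le hn
  have h3 : ((n : ℝ) ^ (7 / 4 : ℝ)) ^ 4 = (n : ℝ) ^ 7 := by
    rw [← Real.rpow_natCast, ← Real.rpow_mul h1, ← Real.rpow_natCast]; norm_num
  rw [Real.norm_eq_abs, Nat.abs_cast, Real.norm_eq_abs, abs_of_nonneg (by positivity)]
  refine le_of_pow_le_pow_left₀ (n := 4) (by omega) (by positivity) (h2.trans ?_)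
  rw [mul_pow, h3]
  gcongr
  norm_num

theorem clog_isBigO :
    (fun n : ℕ => ((Nat.clog 2 (maxSize n (Nat.log 256 n + 1)) + 1 : ℕ) : ℝ)) =O[atTop] L := by
  have h1 : ∀ᶠ n : ℕ in atTop, ‖((Nat.clog 2 (maxSize n (Nat.log 256 n + 1)) + 1 : ℕ) : ℝ)‖ ≤
      1 * ‖(23 : ℝ) + 16 * ((Nat.log 256 n + 1 : ℕ) : ℝ)‖ := by
    filter_upwards [eventually_ge_atTop 1] with n hn
    have h2 : Nat.clog 2 (maxSize n (Nat.log 256 n + 1)) ≤ 5 + 16 * (Nat.log 256 n + 1) := by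
      refine Nat.clog_le_of_le_pow ((maxSize_le hn).trans ?_)
      have h3 : n ≤ 256 ^ (Nat.log 256 n + 1) := (Nat.lt_pow_succ_log_self (by omega) n).le
      generalize Nat.log 256 n + 1 = e at h3
      have h4 : 256 ^ e = 2 ^ (8 * e) := by rw [pow_mul]; norm_num
      calc 32 * n ^ 2 ≤ 32 * (256 ^ e) ^ 2 := Nat.mul_le_mul_left _ (Nat.pow_le_pow_left h3 2)
        _ = 2 ^ (5 + 16 * e) := by
          rw [h4, ← pow_mul, pow_add, mul_right_comm]; norm_num
    rw [Real.norm_eq_abs, Nat.abs_cast, one_mul, Real.norm_eq_abs, abs_of_nonneg (by positivity)]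
    exact_mod_cast (by omega : Nat.clog 2 (maxSize n (Nat.log 256 n + 1)) + 1 ≤ 23 + 16 * (Nat.log 256 n + 1))
  refine (IsBigO.of_bound _ h1).trans (IsBigO.add ?_ (natLog_isBigO.const_mul_left 16))
  simpa using one_isBigO_log.const_mul_left 23

theorem natCast_isBigO : (fun n : ℕ => (n : ℝ)) =O[atTop] U := by
  refine IsBigO.of_bound' ?_
  filter_upwards [eventually_ge_atTop 1] with n hn
  have h1 : (1 : ℝ) ≤ n := by exact_mod_cast hn
  rw [Real.norm_eq_abs, Nat.abs_cast, Real.norm_eq_abs, abs_of_nonneg (by positivity)]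
  calc (n : ℝ) = (n : ℝ) ^ (1 : ℝ) := (Real.rpow_one _).symm
    _ ≤ _ := Real.rpow_le_rpow_of_exponent_le h1 (by norm_num)

theorem one_isBigO_natCast : (fun _ : ℕ => (1 : ℝ)) =O[atTop] fun n : ℕ => (n : ℝ) := by
  refine IsBigO.of_bound' ?_
  filter_upwards [eventually_ge_atTop 1] with n hn
  simpa using (by exact_mod_cast hn : (1 : ℝ) ≤ n)

theorem roundCost_isBigO (H : SimpleGraph (Fin h)) :
    (fun n : ℕ => (roundCost H n (Nat.log 256 n + 1) : ℝ)) =O[atTop] fun n : ℕ => U n * L n := by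
  have h1 : U =O[atTop] fun n : ℕ => U n * L n := by
    simpa using (isBigO_refl U atTop).mul one_isBigO_log
  have h2 := (maxSize_isBigO.mul clog_isBigO).mul (isBigO_const_const ((sortCost + 3 : ℕ) : ℝ)
    (one_ne_zero (α := ℝ)) (atTop : Filter ℕ))
  have h3 := (natCast_isBigO.trans h1).mul (isBigO_const_const (((fillBody H).cost + 7 : ℕ) : ℝ)
    (one_ne_zero (α := ℝ)) (atTop : Filter ℕ))
  have h4 := ((one_isBigO_natCast.trans natCast_isBigO).trans h1).const_mul_left 30
  have h5 := (h3.add (by simpa using h2)).add (by simpa using h4)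
  simpa [roundCost] using h5

/-- The rounds dominate: O(log n) of them, each with O(log n) passes over O(n^(7/4)) entries. -/
theorem iterCost_isBigO (H : SimpleGraph (Fin h)) :
    (fun n : ℕ => (iterCost H n (Nat.log 256 n + 1) : ℝ)) =O[atTop] fun n : ℕ => U n * L n * L n := by
  have h0 : (fun n : ℕ => U n * L n) =O[atTop] fun n : ℕ => U n * L n * L n := by
    simpa using (isBigO_refl (fun n : ℕ => U n * L n) atTop).mul one_isBigO_log
  have h1 : U =O[atTop] fun n : ℕ => U n * L n := by
    simpa using (isBigO_refl U atTop).mul one_isBigO_log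
  have hone := (one_isBigO_natCast.trans natCast_isBigO).trans h1
  have h2 := ((hone.trans h0).const_mul_left (h * 23 : ℝ)).add
    (((natCast_isBigO.trans h1).trans h0).const_mul_left 18)
  have h3 := natLog_isBigO.mul ((roundCost_isBigO H).add (hone.const_mul_left 7))
  have h4 := ((maxSize_isBigO.trans h1).trans h0).const_mul_left (2 * scanCost H)
  have h5 := (hone.trans h0).const_mul_left (80 : ℝ)
  have h6 := ((h2.add (h3.trans_eventuallyEq (Eventually.of_forall fun n => by ring))).add h4).add h5
  refine h6.congr_left fun n => ?_
  simp only [iterCost]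
  push_cast
  ring

/-- Equivalent to log³ n = O(n^(1/4)). -/
theorem polylog_isBigO : (fun n : ℕ => U n * L n * L n) =O[atTop] fun n : ℕ => (n : ℝ) ^ 2 / L n := by
  have h1 : (fun n : ℕ => L n ^ 3) =O[atTop] fun n : ℕ => (n : ℝ) ^ (1 / 4 : ℝ) := by
    have := (isLittleO_log_rpow_rpow_atTop (s := 1 / 4) 3 (by norm_num)).isBigO.comp_tendsto
      tendsto_natCast_atTop_atTop
    refine this.congr_left fun n => ?_
    simp only [Function.comp]
    exact_mod_cast Real.rpow_natCast (Real.log n) 3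
  have h2 := ((isBigO_refl U atTop).mul h1).mul (isBigO_refl (fun n : ℕ => (L n)⁻¹) atTop)
  refine h2.congr' ?_ ?_
  · filter_upwards [tendsto_log_natCast.eventually_gt_atTop 0] with n hn
    field_simp
  · refine Eventually.of_forall fun n => ?_
    simp only [div_eq_mul_inv]
    rcases Nat.eq_zero_or_pos n with rfl | hn
    · simp
    · rw [← Real.rpow_add (by exact_mod_cast hn)]
      congr 1
      rw [← Real.rpow_natCast]
      norm_num

/-- The block length is at least log n / log 256, and the extra `1` is absorbed because log n =
O(n). -/
theorem blocks_isBigO :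
    (fun n : ℕ => ((n / (Nat.log 256 n + 1) + 1 : ℕ) : ℝ)) =O[atTop] fun n : ℕ => (n : ℝ) / L n := by
  have h1 : (fun _ : ℕ => (1 : ℝ)) =O[atTop] fun n : ℕ => (n : ℝ) / L n := by
    have h2 : L =O[atTop] fun n : ℕ => (n : ℝ) :=
      Real.isLittleO_log_id_atTop.isBigO.comp_tendsto tendsto_natCast_atTop_atTop
    refine (h2.mul (isBigO_refl (fun n : ℕ => (L n)⁻¹) atTop)).congr' ?_ (Eventually.of_forall fun n => by
      simp only [div_eq_mul_inv])
    filter_upwards [tendsto_log_natCast.eventually_gt_atTop 0] with n hn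
    field_simp
  have h2 : (fun n : ℕ => ((n / (Nat.log 256 n + 1) : ℕ) : ℝ)) =O[atTop] fun n : ℕ => (n : ℝ) / L n := by
    refine IsBigO.of_bound (Real.log 256) ?_
    filter_upwards [tendsto_log_natCast.eventually_gt_atTop 0, eventually_ge_atTop 1] with n hn hn1
    have h3 : (n : ℝ) ≤ 256 ^ (Nat.log 256 n + 1) := by
      exact_mod_cast (Nat.lt_pow_succ_log_self (by omega : 1 < 256) n).le
    have h4 := Real.log_le_log (by exact_mod_cast hn1) h3
    rw [Real.log_pow] at h4
    have h5 : (0 : ℝ) < ((Nat.log 256 n + 1 : ℕ) : ℝ) := by positivity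
    rw [Real.norm_eq_abs, Nat.abs_cast, Real.norm_eq_abs, abs_of_nonneg (by positivity)]
    refine Nat.cast_div_le.trans ?_
    rw [← mul_div_assoc, div_le_div_iff₀ h5 hn]
    nlinarith [(n.cast_nonneg (α := ℝ))]
  simpa using h2.add h1

/-- There are n^(h-2) iterations of O(n² / log n) each, plus n^(h-3)·n²·O(n / log n) checked pairs;
both give the claimed order. -/
theorem mainCost_isBigO (hh : 3 ≤ h) (H : SimpleGraph (Fin h)) :
    (fun n : ℕ => (mainCost H n : ℝ)) =O[atTop] fun n : ℕ => (n : ℝ) ^ h / Real.log (n : ℝ) := by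
  obtain ⟨m, rfl⟩ : ∃ m, h = m + 3 := ⟨h - 3, by omega⟩
  have hP (k : ℕ) : (fun n : ℕ => (n : ℝ) ^ k) =O[atTop] fun n : ℕ => (n : ℝ) ^ k := isBigO_refl _ _
  have hL : (fun n : ℕ => U n * L n * L n) =O[atTop] fun n : ℕ => (n : ℝ) ^ 2 / L n := polylog_isBigO
  have hU : U =O[atTop] fun n : ℕ => U n * L n * L n := by
    simpa using ((isBigO_refl U atTop).mul one_isBigO_log).mul one_isBigO_log
  have hone := ((one_isBigO_natCast.trans natCast_isBigO).trans hU).trans hL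
  have hlog : (fun n : ℕ => ((Nat.log 256 n + 1 : ℕ) : ℝ)) =O[atTop] fun n : ℕ => (n : ℝ) ^ 2 / L n := by
    refine IsBigO.trans ?_ hL
    simpa using ((one_isBigO_natCast.trans natCast_isBigO).mul natLog_isBigO).mul one_isBigO_log
  have h1 := (hP (m + 1)).mul (((iterCost_isBigO H).trans hL).add (hone.const_mul_left 7))
  have h2 := ((hP m).mul ((hP 1).mul ((hP 1).mul blocks_isBigO))).mul
    (isBigO_const_const (scanCost H : ℝ) (one_ne_zero (α := ℝ)) atTop)
  have hpow : (fun _ : ℕ => (1 : ℝ)) =O[atTop] fun n : ℕ => (n : ℝ) ^ (m + 1) := by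
    simpa using one_isBigO_natCast.pow (m + 1)
  have h3 := hpow.mul ((hlog.const_mul_left 15).add (hone.const_mul_left ((m + 3) * 11 + 25)))
  have h4 := ((h1.add ((h2.trans_eventuallyEq (Eventually.of_forall fun n => by
    simp only [pow_one, mul_one]; ring)))).add h3)
  refine (h4.congr_left fun n => ?_).congr_right fun n => ?_
  · simp only [mainCost, show m + 3 - 2 = m + 1 by omega, show m + 3 - 3 = m by omega]
    push_cast
    ring
  · ring

end Time

end Dominance

/-! ### From tuples without violations to induced subgraphs. -/

namespace Dominance

open RAM MaxSubgraph

variable {h n : ℕ} {H : SimpleGraph (Fin h)} {G : SimpleGraph (Fin n)} {w : G.edgeSet → ℝ}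

/-! ## Tuples and induced subgraphs -/

/-- The instance described by the input of the program. -/
noncomputable def inst (H : SimpleGraph (Fin h)) (w : G.edgeSet → ℝ) : Inst h :=
  ⟨H, n, (input G w).arr 0, (input G w).real 0⟩

theorem index_lt (u v : Fin n) : (u : ℕ) * n + v < n * n := by
  have h1 : ((u : ℕ) + 1) * n ≤ n * n := Nat.mul_le_mul_right _ u.2
  have := v.2
  rw [add_one_mul] at h1
  omega

theorem divNat_index (u v : Fin n) : Fin.divNat ⟨(u : ℕ) * n + v, index_lt u v⟩ = u := by
  ext
  change ((u : ℕ) * n + v) / n = u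
  rw [mul_comm, Nat.mul_add_div (by have := u.2; omega), Nat.div_eq_of_lt v.2, add_zero]

theorem modNat_index (u v : Fin n) : Fin.modNat ⟨(u : ℕ) * n + v, index_lt u v⟩ = v := by
  ext
  change ((u : ℕ) * n + v) % n = v
  rw [mul_comm, Nat.mul_add_mod, Nat.mod_eq_of_lt v.2]

theorem inst_adj (u v : Fin n) : (inst H w).adj (u * n + v) = adjEntry G u v := by
  simp only [inst, input, index_lt u v, and_self, dite_true, divNat_index, modNat_index]

theorem inst_w (u v : Fin n) : (inst H w).w (u * n + v) = weightEntry G w u v := by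
  simp only [inst, input, index_lt u v, and_self, dite_true, divNat_index, modNat_index]

theorem adjEntry_le (u v : Fin n) : adjEntry G u v ≤ 1 := by
  unfold adjEntry; split_ifs <;> omega

theorem input_arr_le (a i : ℕ) : (input G w).arr a i ≤ 1 := by
  unfold input
  simp only
  split_ifs
  · exact adjEntry_le _ _
  · omega

open Classical in
theorem inst_pairViol {f : ℕ → ℕ} {x y : Fin h} {u v : Fin n} (hx : f x = u) (hy : f y = v) :
    (inst H w).pairViol f (x, y) = if H.Adj x y then 1 - adjEntry G u v
      else adjEntry G u v + (1 - ((u - v : ℕ) + (v - u : ℕ))) := by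
  rw [← inst_adj (H := H) (w := w), ← hx, ← hy]
  rfl

theorem pairViol_eq_zero_iff {f : ℕ → ℕ} {x y : Fin h} {u v : Fin n} (hx : f x = u) (hy : f y = v) :
    (inst H w).pairViol f (x, y) = 0 ↔ (G.Adj u v ↔ H.Adj x y) ∧ (u = v → H.Adj x y) := by
  rw [inst_pairViol hx hy, adjEntry, Fin.ext_iff]
  by_cases ha : H.Adj x y <;> by_cases hg : G.Adj u v <;> simp [ha, hg]
  omega

/-- Equal images are excluded in both cases: for a non-adjacent pair by the extra term of
`pairViol`, for an adjacent one because `G` has no loops. -/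
theorem violAll_eq_zero_iff {f : ℕ → ℕ} {F : Fin h → Fin n} (hf : ∀ x : Fin h, f x = F x) :
    (inst H w).violAll f = 0 ↔ Function.Injective F ∧ ∀ x y, G.Adj (F x) (F y) ↔ H.Adj x y := by
  have h1 : (inst H w).violAll f = 0 ↔
      ∀ x y : Fin h, x < y → (G.Adj (F x) (F y) ↔ H.Adj x y) ∧ (F x = F y → H.Adj x y) := by
    rw [Inst.violAll, Inst.viol, List.sum_eq_zero_iff]
    simp only [List.forall_mem_map, Prod.forall]
    refine forall_congr' fun x => forall_congr' fun y => ?_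
    rw [pairViol_eq_zero_iff (hf x) (hf y)]
    simp [allPairs]
  rw [h1]
  constructor
  · intro h2
    have h3 : ∀ x y : Fin h, x < y → F x ≠ F y := fun x y hxy he => by
      obtain ⟨h4, h5⟩ := h2 x y hxy
      have := h4.2 (h5 he)
      rw [he] at this
      exact G.loopless.irrefl _ this
    refine ⟨fun x y he => ?_, fun x y => ?_⟩
    · rcases lt_trichotomy x y with hlt | heq | hlt
      · exact absurd he (h3 x y hlt)
      · exact heq
      · exact absurd he.symm (h3 y x hlt)
    · rcases lt_trichotomy x y with hlt | heq | hlt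
      · exact (h2 x y hlt).1
      · rw [heq]; simp
      · rw [G.adj_comm, H.adj_comm]; exact (h2 y x hlt).1
  · rintro ⟨h2, h3⟩ x y hxy
    exact ⟨h3 x y, fun he => absurd (h2 he) hxy.ne⟩

theorem exists_induced {F : Fin h → Fin n} (hF : Function.Injective F)
    (hadj : ∀ x y, G.Adj (F x) (F y) ↔ H.Adj x y) :
    ∃ S : G.Subgraph, S.IsInduced ∧ ∃ φ : H ≃g S.coe, ∀ i, (φ i : Fin n) = F i := by
  refine ⟨(⊤ : G.Subgraph).induce (Set.range F), ?_, ⟨Equiv.ofInjective F hF, ?_⟩, fun _ => rfl⟩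
  · intro u hu v hv huv
    exact ⟨hu, hv, huv⟩
  · intro x y
    rw [← hadj]
    exact ⟨fun hxy => hxy.2.2, fun hxy => ⟨⟨x, rfl⟩, ⟨y, rfl⟩, hxy⟩⟩

theorem violAll_of_iso {S : G.Subgraph} (hS : S.IsInduced) (φ : H ≃g S.coe) {f : ℕ → ℕ}
    (hf : ∀ x : Fin h, f x = (φ x : Fin n)) : (inst H w).violAll f = 0 := by
  refine (violAll_eq_zero_iff hf).2 ⟨Subtype.val_injective.comp φ.injective, fun x y => ?_⟩
  rw [← φ.map_adj_iff, SimpleGraph.Subgraph.coe_adj]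
  exact ⟨fun hxy => hS (φ x).2 (φ y).2 hxy, fun hxy => hxy.adj_sub⟩

theorem sum_allPairs {F : Fin h × Fin h → ℝ} :
    ((allPairs h).map F).sum = ∑ p : Fin h × Fin h with p.1 < p.2, F p := by
  have hnd : (allPairs h).Nodup := ((List.nodup_finRange h).product (List.nodup_finRange h)).filter _
  rw [← List.sum_toFinset F hnd]
  congr 1
  ext p
  simp only [allPairs, List.toFinset_filter, Finset.mem_filter, List.mem_toFinset, Finset.mem_univ,
    true_and, decide_eq_true_eq, and_iff_right_iff_imp]
  exact fun _ => List.pair_mem_product.2 ⟨List.mem_finRange _, List.mem_finRange _⟩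

-- The weight matrix is zero at non-edges, so the weight of a tuple sums over all pairs `x < y`; as
-- the subgraph is induced, the pairs that contribute are exactly its edges, each once.
open Classical in
theorem wtAll_of_iso {S : G.Subgraph} (hS : S.IsInduced) (φ : H ≃g S.coe) {f : ℕ → ℕ}
    -- Both sides are compared with a sum over all unordered pairs of vertices, extended by zero off
    -- the edges of `S`.
    (hf : ∀ x : Fin h, f x = (φ x : Fin n)) : (inst H w).wtAll f = weight w S := by
  set W : Sym2 (Fin n) → ℝ := fun e =>
    if he : e ∈ G.edgeSet then (if e ∈ S.edgeSet then w ⟨e, he⟩ else 0) else 0 with hW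
  have h1 : weight w S = ∑ e, W e := by
    refine Finset.sum_of_injOn Subtype.val Subtype.val_injective.injOn (fun _ _ => Finset.mem_coe.2 (Finset.mem_univ _)) ?_ ?_
    · intro e _ he
      have : e ∉ G.edgeSet := fun h => he ⟨⟨e, h⟩, Finset.mem_coe.2 (Finset.mem_univ _), rfl⟩
      simp only [hW, this, dite_false]
    · intro e _
      simp only [hW, e.2, dite_true]
  rw [h1, Inst.wtAll, Inst.wt, sum_allPairs]
  refine Finset.sum_of_injOn (fun p => s((φ p.1 : Fin n), (φ p.2 : Fin n))) ?_
    (fun _ _ => Finset.mem_coe.2 (Finset.mem_univ _)) ?_ ?_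
  · rintro ⟨x, y⟩ hp ⟨x', y'⟩ hp' he
    simp only [Finset.coe_filter, Finset.mem_univ, true_and, Set.mem_ofPred_eq] at hp hp'
    simp only [Sym2.eq_iff, Subtype.val_inj, φ.injective.eq_iff] at he
    rcases he with ⟨rfl, rfl⟩ | ⟨rfl, rfl⟩
    · rfl
    · exact absurd hp hp'.not_gt
  · intro e _ he
    induction e with
    | _ a b =>
      have : s(a, b) ∉ S.edgeSet := fun hab => by
        rw [SimpleGraph.Subgraph.mem_edgeSet] at hab
        obtain ⟨x, hx⟩ := φ.surjective ⟨a, hab.fst_mem⟩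
        obtain ⟨y, hy⟩ := φ.surjective ⟨b, hab.snd_mem⟩
        rcases lt_trichotomy x y with hlt | rfl | hlt
        · exact he ⟨(x, y), by simpa using hlt, by simp [hx, hy]⟩
        · have hab' : a = b := congrArg Subtype.val (hx.symm.trans hy)
          exact hab.ne hab'
        · exact he ⟨(y, x), by simpa using hlt, by simp [hx, hy, Sym2.eq_swap]⟩
      simp only [hW, this, if_false, dite_eq_ite, ite_self]
  · rintro ⟨x, y⟩ -
    have h2 : (inst H w).n = n := rfl
    simp only [hf, h2, inst_w, weightEntry, hW, SimpleGraph.mem_edgeSet, SimpleGraph.Subgraph.mem_edgeSet]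
    split_ifs with hg hs
    · rfl
    · exact absurd (hS (φ x).2 (φ y).2 hg) hs
    · rfl

theorem correctOutput_of_correct {s : State} (hc : Correct (inst H w) s) : CorrectOutput H w s := by
  have hext {S : G.Subgraph} (φ : H ≃g S.coe) : ∃ g : ℕ → ℕ, (∀ l < h, g l < n) ∧
      ∀ x : Fin h, g x = (φ x : Fin n) := by
    -- The value `0` from `h` on is arbitrary, as only entries below `h` matter.
    refine ⟨fun l => if hl : l < h then ((φ ⟨l, hl⟩ : Fin n) : ℕ) else 0, fun l hl => ?_, fun x => ?_⟩
    · simp only [hl, dite_true]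
      exact (φ ⟨l, hl⟩ : Fin n).2
    · simp
  rcases hc with ⟨hres, f, hf, hout, hv, hmax⟩ | ⟨hres, hnone⟩
  · obtain ⟨hinj, hadj⟩ := (violAll_eq_zero_iff (H := H) (w := w) (f := f)
      (F := fun x => ⟨f x, hf x x.2⟩) fun _ => rfl).1 hv
    obtain ⟨S, hS, φ, hφ⟩ := exists_induced hinj hadj
    have hfφ : ∀ x : Fin h, f x = (φ x : Fin n) := fun x => by rw [hφ]
    refine Or.inl ⟨hres, S, ⟨hS, ⟨φ⟩⟩, ?_, φ, fun i => (hout i i.2).trans (hfφ i)⟩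
    rintro S' ⟨hS', ⟨ψ⟩⟩
    obtain ⟨g, hg, hgψ⟩ := hext ψ
    rw [← wtAll_of_iso hS φ hfφ, ← wtAll_of_iso hS' ψ hgψ]
    exact hmax g hg (violAll_of_iso hS' ψ hgψ)
  · refine Or.inr ⟨hres, ?_⟩
    rintro ⟨S, hS, ⟨φ⟩⟩
    obtain ⟨g, hg, hgφ⟩ := hext φ
    exact hnone g hg (violAll_of_iso hS φ hgφ)

/-- Memory stays below `B = (n + 2) ^ (2 * h + 11)`, so the word bound `B ^ deg` is a power of `n +
2` whose exponent depends only on `H`: words of O(log n) bits. -/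
theorem mainProg_correct (hh : 3 ≤ h) (H : SimpleGraph (Fin h)) (w : G.edgeSet → ℝ) :
    ∃ t ≤ mainCost H n, ∃ s, Exec ((n + 2) ^ ((2 * h + 11) * (mainProg H).deg)) (mainProg H)
      (input G w) t s ∧ CorrectOutput H w s := by
  set B := (n + 2) ^ (2 * h + 11) with hB
  have hpow (a b : ℕ) (hab : a ≤ b) : (n + 2) ^ a ≤ (n + 2) ^ b := Nat.pow_le_pow_right (by omega) hab
  have hnB : n + 2 ≤ B := by simpa using hpow 1 (2 * h + 11) (by omega)
  have hhB : h < B := Nat.lt_two_pow_self.trans_le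
    ((Nat.pow_le_pow_left (by omega) h).trans (hpow _ _ (by omega)))
  have hbd : (input G w).Bounded B := by
    refine ⟨by omega, fun x => ?_, fun a i => (input_arr_le a i).trans_lt (by omega)⟩
    unfold input
    simp only
    split_ifs <;> omega
  have hrun := mainProg_spec (I := inst H w) (s := input G w) (B := B) hh
    (fun hn => big_of_adj_le (fun i => input_arr_le (w := w) 0 i) hn)
    ⟨by simp [input, inst], rfl, rfl, by funext i; simp [input]⟩ (by change n + 1 < B; omega) hhB
    (fun x hx => by
      change n ^ x < B
      calc n ^ x ≤ (n + 2) ^ x := Nat.pow_le_pow_left (by omega) _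
        _ < (n + 2) ^ (2 * h + 11) := Nat.pow_lt_pow_right (by omega) (by omega))
    (by simp [input])
  obtain ⟨t, ht, s, hex, -, hc⟩ := hrun hbd _ le_rfl
  rw [pow_mul]
  exact ⟨t, ht, s, hex, correctOutput_of_correct hc⟩

end Dominance

theorem theorem4 (h : ℕ) (hh : 3 ≤ h) (H : SimpleGraph (Fin h)) :
    ∃ (P : RAM.Prog) (c : ℕ) (T : ℕ → ℕ),
      ((fun n : ℕ => (T n : ℝ)) =O[atTop] fun n : ℕ => (n : ℝ) ^ h / Real.log (n : ℝ)) ∧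
      ∀ (n : ℕ) (G : SimpleGraph (Fin n)) (w : G.edgeSet → ℝ),
        ∃ (t : ℕ) (s : RAM.State), t ≤ T n ∧
          RAM.Exec ((n + 2) ^ c) P (MaxSubgraph.input G w) t s ∧
          MaxSubgraph.CorrectOutput H w s := by
  refine ⟨Dominance.mainProg H, (2 * h + 11) * (Dominance.mainProg H).deg, _, Dominance.mainCost_isBigO hh H, fun n G w => ?_⟩
  obtain ⟨t, ht, s, hex, hc⟩ := Dominance.mainProg_correct hh H w
  exact ⟨t, s, ht, hex, hc⟩
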